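/- Let $\Gamma$ be an infinite, connected graph (a locally finite CW complex of dimension at most $1$) with finitely many ends, and let $g\colon\Gamma\to\Gamma$ be a graph map, i.e. a continuous map sending vertices to vertices and edges to (possibly constant) edge paths. Suppose that $g$ is a homotopy equivalence and that it is end-periodic: each end $E$ of $\Gamma$ has a neighborhood $U_E$ such that $g$ restricts to a homeomorphism onto its image, sending edges to edges, on the largest subgraph contained in $\bigcup_E U_E$, and, for some $p>0$, every $U_E$ satisfies either $g^p(U_E)\subsetneq U_E$ and $(g^{pn}(U_E))_{n\ge 0}$ is a neighborhood basis of $E$, or $g^{-p}(U_E)\subsetneq U_E$ and $(g^{-pn}(U_E))_{n\ge 0}$ is a neighborhood basis of $E$. Let $Z_g=\Gamma\times[0,1]/(x,1)\sim(g(x),0)$ be the mapping torus of $g$ with its suspension semiflow $\psi$, and let $W_g=Z_g\sqcup\partial_+W_g\sqcup\partial_-W_g$ be the compactified mapping torus. Here the points of $\partial_+W_g$ are the flowlines of $\psi$ that leave every compact set in the forward direction, two of them being identified if they intersect, and the points of $\partial_-W_g$ are the maximal flowlines of $\psi$ that leave every compact set in the backward direction. In the topology of $W_g$, $Z_g$ is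 an open subspace, and a set is a neighborhood of the ideal endpoint of such a flowline if, for each point $z$ far enough along the flowline, it contains all points (ideal endpoints included) reached after some time $t$ by flowing from some neighborhood of $z$, forwards for $\partial_+W_g$ and backwards along unbounded backward flowlines for $\partial_-W_g$; a set is open if its intersection with $Z_g$ is open and it is a neighborhood of each of its ideal points. Then $\partial_+W_g$ and $\partial_-W_g$, with the subspace topology, are finite (possibly empty) graphs, and they have the same Euler characteristic (number of vertices minus number of edges): $$\chi(\partial_+W_g)=\chi(\partial_-W_g).$$ -/

import Mathlib

open Set Filter Topology
open scoped NNReal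

namespace EndPeriodic

universe u

/-! ### Graphs and graph maps -/

section Graphs

variable (X : Type u) [TopologicalSpace X] [CWComplex (univ : Set X)]

/-- The CW complex `X` is a graph: a (Hausdorff) locally finite complex of dimension at most one. -/
structure IsGraph : Prop where
  t2 : T2Space X
  dim_le_one : ∀ n, 2 ≤ n → IsEmpty (RelCWComplex.cell (univ : Set X) n)
  locallyFinite : LocallyFinite fun c : (Σ n, RelCWComplex.cell (univ : Set X) n) =>
    RelCWComplex.closedCell (C := (univ : Set X)) c.1 c.2

/-- A graph with finitely many cells. -/
structure IsFiniteGraph : Prop extends IsGraph X where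
  finite_cells : Finite (Σ n, RelCWComplex.cell (univ : Set X) n)

/-- The set of vertices. -/
def vertices : Set X :=
  ⋃ v : RelCWComplex.cell (univ : Set X) 0, RelCWComplex.closedCell (C := (univ : Set X)) 0 v

variable {X}

/-- The characteristic map of a closed edge, as a path parametrised by `[-1, 1]`. -/
def edgePath (e : RelCWComplex.cell (univ : Set X) 1) (s : ℝ) : X :=
  RelCWComplex.map (C := (univ : Set X)) 1 e (fun _ => s)

/-- The open edge with index `e`. -/
abbrev openEdge (e : RelCWComplex.cell (univ : Set X) 1) : Set X :=
  RelCWComplex.openCell (C := (univ : Set X)) 1 e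

/-- `g` sends the edge `e` to an edge path: either it collapses the closed edge to a vertex
(an edge path of length `0`), or the parameter interval has a finite subdivision
`-1 = t 0 < t 1 < ⋯ < t r = 1` such that each `t i` goes to a vertex and each open piece
`(t i, t (i + 1))` is mapped bijectively onto an open edge. -/
def MapsToEdgePath (g : X → X) (e : RelCWComplex.cell (univ : Set X) 1) : Prop :=
  (∃ v ∈ vertices X, ∀ s ∈ Icc (-1 : ℝ) 1, g (edgePath e s) = v) ∨
  ∃ (r : ℕ) (t : ℕ → ℝ), 0 < r ∧ t 0 = -1 ∧ t r = 1 ∧ (∀ i < r, t i < t (i + 1)) ∧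
    (∀ i ≤ r, g (edgePath e (t i)) ∈ vertices X) ∧
    ∀ i < r, ∃ e', BijOn (fun s => g (edgePath e s)) (Ioo (t i) (t (i + 1))) (openEdge e')

/-- Graph maps: continuous maps sending vertices to vertices and edges to edge paths. -/
structure IsGraphMap (g : X → X) : Prop where
  continuous : Continuous g
  mapsTo_vertices : MapsTo g (vertices X) (vertices X)
  mapsTo_edgePath : ∀ e, MapsToEdgePath g e

/-- The largest subgraph contained in `A`: the union of all closed cells contained in `A`. -/
def largestSubgraph (A : Set X) : Set X :=
  ⋃ (c : Σ n, RelCWComplex.cell (univ : Set X) n)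
    (_ : RelCWComplex.closedCell (C := (univ : Set X)) c.1 c.2 ⊆ A),
    RelCWComplex.closedCell (C := (univ : Set X)) c.1 c.2

end Graphs

/-! ### Ends -/

section Ends

variable (X : Type u) [TopologicalSpace X]

variable {X} in
/-- A nested sequence `U 0 ⊇ U 1 ⊇ ⋯` of nonempty sets is a neighbourhood basis for an end
if `U n` is a connected component of `X ∖ K n`, for some exhaustion `K 0 ⊆ K 1 ⊆ ⋯` of `X` by
compact sets. (In an exhaustion, the interiors of the `K n` cover `X`, so that every compact set
lies in some `K n`.) -/
def IsEndBasis (U : ℕ → Set X) : Prop :=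
  Antitone U ∧ ∃ K : ℕ → Set X, Monotone K ∧ (∀ n, IsCompact (K n)) ∧
    (⋃ n, interior (K n)) = univ ∧ ∀ n, ∃ x ∈ (K n)ᶜ, U n = connectedComponentIn (K n)ᶜ x

/-- Two neighbourhood bases define the same end if each term of either one contains a term of the
other. -/
def endSetoid : Setoid {U : ℕ → Set X // IsEndBasis U} where
  r U V := ∀ n, (∃ i, U.1 i ⊆ V.1 n) ∧ ∃ j, V.1 j ⊆ U.1 n
  iseqv :=
    { refl := fun _ n => ⟨⟨n, Subset.rfl⟩, ⟨n, Subset.rfl⟩⟩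
      symm := fun h n => ⟨(h n).2, (h n).1⟩
      trans := by
        intro U V W h k n
        obtain ⟨⟨i, hi⟩, -⟩ := k n
        obtain ⟨⟨i', hi'⟩, -⟩ := h i
        obtain ⟨-, ⟨j, hj⟩⟩ := h n
        obtain ⟨-, ⟨j', hj'⟩⟩ := k j
        exact ⟨⟨i', hi'.trans hi⟩, ⟨j', hj'.trans hj⟩⟩ }

/-- The ends of `X`. -/
def Ends : Type u := Quotient (endSetoid X)

variable {X}

/-- The sequence `U` is a neighbourhood basis for the end `E`. -/
def IsBasisOf (U : ℕ → Set X) (E : Ends X) : Prop :=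
  ∃ h : IsEndBasis U, (Quotient.mk (endSetoid X) ⟨U, h⟩ : Ends X) = E

/-- An open set is a neighbourhood of the end `E` if it contains the tail of every neighbourhood
basis for `E`, and meets only finitely many terms of any neighbourhood basis of another end. -/
def IsEndNhd (E : Ends X) (A : Set X) : Prop :=
  IsOpen A ∧ (∀ U, IsBasisOf U E → ∃ n, ∀ m ≥ n, U m ⊆ A) ∧
    ∀ E' ≠ E, ∀ U, IsBasisOf U E' → {n | (U n ∩ A).Nonempty}.Finite

end Ends

/-- End-periodic graph maps. In the last clause `E` is attracting or repelling according
to the alternative that holds. -/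
structure IsEndPeriodic {X : Type u} [TopologicalSpace X] [CWComplex (univ : Set X)]
    (g : X → X) : Prop extends IsGraphMap g where
  exists_nesting : ∃ U : Ends X → Set X,
    (∀ E, IsEndNhd E (U E)) ∧
    -- `g` restricts to a homeomorphism (onto its image) on the largest subgraph of `⋃ E, U E`,
    -- and sends the edges of this subgraph to edges
    IsEmbedding ((largestSubgraph (⋃ E, U E)).domRestrict g) ∧
    (∀ e, openEdge e ⊆ largestSubgraph (⋃ E, U E) → ∃ e', g '' openEdge e = openEdge e') ∧
    ∃ p > 0, ∀ E,
      (g^[p] '' U E ⊂ U E ∧ IsBasisOf (fun n => g^[p * n] '' U E) E) ∨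
      (g^[p] ⁻¹' U E ⊂ U E ∧ IsBasisOf (fun n => g^[p * n] ⁻¹' U E) E)

/-! ### The mapping torus and its suspension semiflow -/

section MappingTorus

variable {X : Type u} (g : X → X)

/-- The gluing `(x, 1) ∼ (g x, 0)` on `X × [0, 1]`. -/
inductive TorusRel : X × unitInterval → X × unitInterval → Prop
  | glue (x : X) : TorusRel (x, 1) (g x, 0)

/-- The mapping torus of `g`: the quotient of `X × [0, 1]` by the equivalence relation generated
by `(x, 1) ∼ (g x, 0)`, with the quotient topology. -/
def MappingTorus : Type u := Quot (TorusRel g)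

instance [TopologicalSpace X] : TopologicalSpace (MappingTorus g) :=
  inferInstanceAs (TopologicalSpace (Quot (TorusRel g)))

/-- The class of `(x, s)` in the mapping torus. -/
def MappingTorus.mk (x : X) (s : unitInterval) : MappingTorus g := Quot.mk _ (x, s)

/-- The class of `(g^k x, r)`, where `k` and `r` are the integer and the fractional part of `s`. -/
noncomputable def flowPoint (x : X) (s : ℝ) : MappingTorus g :=
  MappingTorus.mk g (g^[⌊s⌋₊] x) ⟨Int.fract s, Int.fract_nonneg s, (Int.fract_lt_one s).le⟩

theorem flowPoint_add_one (x : X) {s : ℝ} (hs : 0 ≤ s) :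
    flowPoint g x (s + 1) = flowPoint g (g x) s := by
  simp only [flowPoint, Int.fract_add_one, Nat.floor_add_one hs, Function.iterate_succ_apply]

/-- The suspension semiflow: upward unit-speed flow on `X × [0, 1]`, passing through the
gluing. -/
noncomputable def flow (t : ℝ≥0) : MappingTorus g → MappingTorus g :=
  Quot.lift (fun q => flowPoint g q.1 ((q.2 : ℝ) + t)) (by
    rintro _ _ ⟨x⟩
    have h := flowPoint_add_one g x t.2
    simpa [add_comm] using h)

theorem flow_add (a b : ℝ≥0) (z : MappingTorus g) : flow g (a + b) z = flow g a (flow g b z) := by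
  obtain ⟨x, s⟩ := z
  change flowPoint g x ((s : ℝ) + ((a + b : ℝ≥0) : ℝ)) =
    flowPoint g (g^[⌊(s : ℝ) + b⌋₊] x) (Int.fract ((s : ℝ) + b) + a)
  have hs : (0 : ℝ) ≤ s := s.2.1
  have ha : (0 : ℝ) ≤ a := a.2
  have hb : (0 : ℝ) ≤ b := b.2
  have key : ∀ (n : ℕ) (y : X) (r : ℝ), 0 ≤ r →
      flowPoint g y (r + n) = flowPoint g (g^[n] y) r := by
    intro n
    induction n with
    | zero => intro y r _; simp
    | succ n ih =>
      intro y r hr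
      rw [Nat.cast_succ, ← add_assoc, flowPoint_add_one g y (by positivity), ih _ _ hr,
        Function.iterate_succ_apply]
  rw [← key _ _ _ (add_nonneg (Int.fract_nonneg _) ha)]
  congr 1
  have h1 : ((⌊(s : ℝ) + b⌋₊ : ℕ) : ℝ) = (⌊(s : ℝ) + b⌋ : ℝ) := by
    rw [natCast_floor_eq_intCast_floor (by positivity)]
  rw [h1, NNReal.coe_add]
  have := Int.fract_add_floor ((s : ℝ) + b)
  linarith

end MappingTorus

/-! ### The compactified mapping torus -/

section Compactification

variable {X : Type u} [TopologicalSpace X] (g : X → X)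

/-- Points of the mapping torus whose forward flowline is unbounded: it leaves every compact
set. -/
def ForwardRay : Type u :=
  {z : MappingTorus g // Tendsto (fun t => flow g t z) atTop (cocompact (MappingTorus g))}

/-- Unbounded forward flowlines are identified if they intersect. -/
def posSetoid : Setoid (ForwardRay g) where
  r z w := ∃ s t, flow g s z.1 = flow g t w.1
  iseqv :=
    { refl := fun _ => ⟨0, 0, rfl⟩
      symm := fun ⟨s, t, h⟩ => ⟨t, s, h.symm⟩
      trans := by
        rintro x y z ⟨s, t, h⟩ ⟨a, b, k⟩
        refine ⟨a + s, t + b, ?_⟩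
        rw [flow_add, h, ← flow_add, add_comm a t, flow_add, k, ← flow_add] }

/-- Flowlines that are infinite in the reverse direction and leave every compact set in
that direction; `β t` is the point reached after flowing backwards for time `t`. -/
def BackwardRay : Type u :=
  {β : ℝ≥0 → MappingTorus g //
    (∀ s t, flow g s (β (t + s)) = β t) ∧ Tendsto β atTop (cocompact (MappingTorus g))}

/-- Backward rays are identified if they belong to the same maximal flowline: they have a common
tail. -/
def negSetoid : Setoid (BackwardRay g) where
  r β γ := ∃ a b, ∀ t, β.1 (t + a) = γ.1 (t + b)
  iseqv :=
    { refl := fun _ => ⟨0, 0, fun _ => rfl⟩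
      symm := fun ⟨a, b, h⟩ => ⟨b, a, fun t => (h t).symm⟩
      trans := by
        rintro x y z ⟨a, b, h⟩ ⟨c, d, k⟩
        refine ⟨c + a, b + d, fun t => ?_⟩
        rw [← add_assoc, h, add_right_comm, k, add_assoc] }

/-- The compactified mapping torus `W` of `g` as a set: the mapping torus, together with
an ideal point for every unbounded forward flowline and one for every flowline unbounded in the
reverse direction. -/
inductive CompactifiedTorus : Type u
  | inner (z : MappingTorus g) : CompactifiedTorus
  | posPoint (b : Quotient (posSetoid g)) : CompactifiedTorus
  | negPoint (b : Quotient (negSetoid g)) : CompactifiedTorus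

variable {g}

/-- The ideal forward endpoint of a forward ray. -/
def ForwardRay.endpoint (z : ForwardRay g) : CompactifiedTorus g := .posPoint (Quotient.mk _ z)

/-- The ideal backward endpoint of a backward ray. -/
def BackwardRay.endpoint (β : BackwardRay g) : CompactifiedTorus g := .negPoint (Quotient.mk _ β)

/-- `A` contains the set `ψ (N, (t, ∞])` swept out after time `t` by the neighbourhood `N` of a
point `w` of the mapping torus, ideal forward endpoints included. -/
def ContainsForwardFlow (A : Set (CompactifiedTorus g)) (w : MappingTorus g) : Prop :=
  ∃ N ∈ 𝓝 w, ∃ t : ℝ≥0, (∀ y ∈ N, ∀ s > t, .inner (flow g s y) ∈ A) ∧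
    ∀ y : ForwardRay g, y.1 ∈ N → y.endpoint ∈ A

/-- `A` contains the set swept out by the backward semiflow after time `t` from the neighbourhood
`N` of a point `w` of the mapping torus, ideal backward endpoints included. -/
def ContainsBackwardFlow (A : Set (CompactifiedTorus g)) (w : MappingTorus g) : Prop :=
  ∃ N ∈ 𝓝 w, ∃ t : ℝ≥0, ∀ β : BackwardRay g, β.1 0 ∈ N →
    (∀ s > t, .inner (β.1 s) ∈ A) ∧ β.endpoint ∈ A

/-- The topology of the compactified mapping torus: the mapping torus is an open subspace, and the
basic neighbourhoods of the ideal endpoint of a flowline are the sets swept out by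
neighbourhoods of points far along this flowline. -/
instance : TopologicalSpace (CompactifiedTorus g) where
  IsOpen A := IsOpen {z : MappingTorus g | .inner z ∈ A} ∧
    (∀ z : ForwardRay g, z.endpoint ∈ A → ∀ᶠ r in atTop, ContainsForwardFlow A (flow g r z.1)) ∧
    (∀ β : BackwardRay g, β.endpoint ∈ A → ∀ᶠ r in atTop, ContainsBackwardFlow A (β.1 r))
  isOpen_univ := by
    refine ⟨by simp, fun z _ => Eventually.of_forall fun r => ?_,
      fun β _ => Eventually.of_forall fun r => ?_⟩
    · exact ⟨univ, univ_mem, 0, fun _ _ _ _ => mem_univ _, fun _ _ => mem_univ _⟩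
    · exact ⟨univ, univ_mem, 0, fun _ _ => ⟨fun _ _ => mem_univ _, mem_univ _⟩⟩
  isOpen_inter := by
    rintro A B ⟨hA, hA', hA''⟩ ⟨hB, hB', hB''⟩
    refine ⟨hA.inter hB, fun z hz => ?_, fun β hβ => ?_⟩
    · filter_upwards [hA' z hz.1, hB' z hz.2] with r h k
      obtain ⟨N, hN, t, h1, h2⟩ := h
      obtain ⟨M, hM, s, k1, k2⟩ := k
      exact ⟨N ∩ M, inter_mem hN hM, max t s,
        fun y hy a ha => ⟨h1 y hy.1 a ((le_max_left _ _).trans_lt ha),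
          k1 y hy.2 a ((le_max_right _ _).trans_lt ha)⟩,
        fun y hy => ⟨h2 y hy.1, k2 y hy.2⟩⟩
    · filter_upwards [hA'' β hβ.1, hB'' β hβ.2] with r h k
      obtain ⟨N, hN, t, h1⟩ := h
      obtain ⟨M, hM, s, k1⟩ := k
      exact ⟨N ∩ M, inter_mem hN hM, max t s, fun γ hγ =>
        ⟨fun a ha => ⟨(h1 γ hγ.1).1 a ((le_max_left _ _).trans_lt ha),
          (k1 γ hγ.2).1 a ((le_max_right _ _).trans_lt ha)⟩, (h1 γ hγ.1).2, (k1 γ hγ.2).2⟩⟩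
  isOpen_sUnion := by
    intro S hS
    refine ⟨?_, ?_, ?_⟩
    · have : {z : MappingTorus g | CompactifiedTorus.inner z ∈ ⋃₀ S} =
          ⋃ A ∈ S, {z : MappingTorus g | CompactifiedTorus.inner z ∈ A} := by
        ext z; simp
      rw [this]
      exact isOpen_biUnion fun A hA => (hS A hA).1
    · rintro z ⟨A, hA, hz⟩
      filter_upwards [(hS A hA).2.1 z hz] with r h
      obtain ⟨N, hN, t, h1, h2⟩ := h
      exact ⟨N, hN, t, fun y hy a ha => ⟨A, hA, h1 y hy a ha⟩, fun y hy => ⟨A, hA, h2 y hy⟩⟩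
    · rintro β ⟨A, hA, hβ⟩
      filter_upwards [(hS A hA).2.2 β hβ] with r h
      obtain ⟨N, hN, t, h1⟩ := h
      exact ⟨N, hN, t, fun γ hγ =>
        ⟨fun a ha => ⟨A, hA, (h1 γ hγ).1 a ha⟩, ⟨A, hA, (h1 γ hγ).2⟩⟩⟩

variable (g)

/-- The positive boundary of the compactified mapping torus. -/
def posBoundary : Set (CompactifiedTorus g) := range CompactifiedTorus.posPoint

/-- The negative boundary of the compactified mapping torus. -/
def negBoundary : Set (CompactifiedTorus g) := range CompactifiedTorus.negPoint

end Compactification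

/-- The space `Y` is a finite graph of Euler characteristic `χ`: it carries the structure of
a finite graph, and every such structure has `χ = #vertices - #edges`. -/
def IsFiniteGraphOfEulerChar (Y : Type u) [TopologicalSpace Y] (χ : ℤ) : Prop :=
  (∃ _S : CWComplex (univ : Set Y), IsFiniteGraph Y) ∧
  ∀ _S : CWComplex (univ : Set Y), IsFiniteGraph Y →
    (Nat.card (RelCWComplex.cell (univ : Set Y) 0) : ℤ) -
      (Nat.card (RelCWComplex.cell (univ : Set Y) 1) : ℤ) = χ

end EndPeriodic

-- Outside finitely many cells, `g` embeds the graph and carries open cells onto open cells by an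
-- injective map `γ`. This map has finitely many orbits: every cell near an end is joined by
-- iterates of `γ` to a neighbourhood difference `U E \ W E 1` of one of the finitely many ends, to
-- the cells where `g` is not controlled, or to the images of those, and all these regions meet
-- finitely many cells (`IsEndPeriodic.exists_actsOnCells`). The infinite forward orbits of cells
-- form subgraphs `A 0 ⊇ A 1 ⊇ ⋯` with `γ '' A n = A (n + 1)`, the infinite backward orbits form
-- subgraphs `B 0 ⊇ B 1 ⊇ ⋯` with `γ '' B (n + 1) = B n`, and only finitely many cells lie outside
-- `A 1 ∪ B 1` (`IsCellShift.exists_isTailPair`).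
--
-- A flowline that leaves every compact set in the forward direction ends up over `A 0`, so the
-- positive boundary is the orbit space of `g` on `A 0`: a finite graph with one cell for each cell
-- of `A 0 \ A 1`. In the same way the negative boundary is the orbit space of a local inverse `s`
-- of `g` on `B 0`, with cells `B 0 \ B 1` (`IsShiftQuotient.exists_isFiniteGraph`). Both are
-- Hausdorff because distinct orbits in a tail have disjoint saturated neighbourhoods.
--
-- For the comparison, `g` maps `A 0 ∪ B 1` homeomorphically onto `A 1 ∪ B 0`. As `g` is a homotopy
-- equivalence, the two pairs formed by `X` and these subgraphs have equal relative Euler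
-- characteristics. Each of these counts the cells of a finite complement: the cells outside `A 0 ∪
-- B 0`, together with `B 0 \ B 1` for the first pair and with `A 0 \ A 1` for the second. The
-- common part cancels (`HasTails.card_sub_card_eq`).
--
-- The cohomology of a pair is modelled by functions: degree zero by continuous integer-valued
-- functions vanishing on the subspace, degree one by such circle-valued functions modulo those
-- having a real lift that vanishes there. Homotopy invariance is then homotopy lifting for the
-- covering of the circle by the line, and the cell count is rank-nullity for the cellular
-- coboundary. The topological description also shows that the Euler characteristic of a finite
-- graph does not depend on its cell structure.

universe u

namespace EndPeriodic

/-! ### Cells of a graph -/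

section Cells

variable (X : Type u) [TopologicalSpace X] [CWComplex (univ : Set X)]

/-- The cells of all dimensions. -/
abbrev GCell : Type u := Σ n, RelCWComplex.cell (univ : Set X) n

variable {X}

/-- The open cell with a given index. -/
def oc (c : GCell X) : Set X := RelCWComplex.openCell (C := (univ : Set X)) c.1 c.2

/-- The closed cell with a given index. -/
def cc (c : GCell X) : Set X := RelCWComplex.closedCell (C := (univ : Set X)) c.1 c.2

theorem oc_subset_cc (c : GCell X) : oc c ⊆ cc c := RelCWComplex.openCell_subset_closedCell _ _

theorem oc_nonempty (c : GCell X) : (oc c).Nonempty := RelCWComplex.openCell_nonempty _ _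

theorem exists_mem_oc (x : X) : ∃ c : GCell X, x ∈ oc c := by
  have h : x ∈ (univ : Set X) := mem_univ x
  rw [← CWComplex.iUnion_openCell_eq_complex (C := (univ : Set X))] at h
  simp only [mem_iUnion] at h
  obtain ⟨n, j, h⟩ := h
  exact ⟨⟨n, j⟩, h⟩

/-- The cell whose interior contains a given point. -/
noncomputable def cellOf (x : X) : GCell X := (exists_mem_oc x).choose

theorem mem_oc_cellOf (x : X) : x ∈ oc (cellOf x) := (exists_mem_oc x).choose_spec

theorem mem_oc_iff {x : X} {c : GCell X} : x ∈ oc c ↔ cellOf x = c := by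
  constructor
  · intro h
    by_contra hne
    exact Set.disjoint_left.1 (RelCWComplex.disjoint_openCell_of_ne
      (i := (cellOf x).2) (j := c.2) hne) (mem_oc_cellOf x) h
  · rintro rfl
    exact mem_oc_cellOf x

theorem mem_cc_cellOf (x : X) : x ∈ cc (cellOf x) := oc_subset_cc _ (mem_oc_cellOf x)

theorem exists_cellOf_eq (c : GCell X) : ∃ x, cellOf x = c :=
  (oc_nonempty c).imp fun _ h => mem_oc_iff.1 h

/-- The cell `c` is a face of the cell `d`. -/
def Face (c d : GCell X) : Prop := (oc c ∩ cc d).Nonempty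

theorem Face.refl (c : GCell X) : Face c c :=
  let ⟨x, hx⟩ := oc_nonempty c
  ⟨x, hx, oc_subset_cc _ hx⟩

theorem cc_zero (v : RelCWComplex.cell (univ : Set X) 0) :
    cc (⟨0, v⟩ : GCell X) = {RelCWComplex.map 0 v ![]} :=
  RelCWComplex.closedCell_zero_eq_singleton

theorem oc_zero (v : RelCWComplex.cell (univ : Set X) 0) :
    oc (⟨0, v⟩ : GCell X) = {RelCWComplex.map 0 v ![]} :=
  RelCWComplex.openCell_zero_eq_singleton

theorem isCompact_cc (c : GCell X) : IsCompact (cc c) := RelCWComplex.isCompact_closedCell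

theorem iUnion_cc : ⋃ c : GCell X, cc c = univ :=
  eq_univ_of_forall fun x => mem_iUnion.2 ⟨_, mem_cc_cellOf x⟩

theorem norm_fun_fin_one (s : ℝ) : ‖(fun _ => s : Fin 1 → ℝ)‖ = |s| := by
  rw [pi_norm_const, Real.norm_eq_abs]

theorem eq_fun_fin_one (z : Fin 1 → ℝ) : z = fun _ => z 0 := by
  ext i
  rw [Subsingleton.elim i 0]

theorem oc_one (e : RelCWComplex.cell (univ : Set X) 1) :
    oc (⟨1, e⟩ : GCell X) = edgePath e '' Ioo (-1) 1 := by
  ext x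
  simp only [oc, RelCWComplex.openCell, mem_image, mem_ball_zero_iff]
  constructor
  · rintro ⟨z, hz, rfl⟩
    rw [eq_fun_fin_one z, norm_fun_fin_one, abs_lt] at hz
    exact ⟨z 0, hz, by rw [edgePath, ← eq_fun_fin_one z]⟩
  · rintro ⟨s, hs, rfl⟩
    exact ⟨fun _ => s, by rwa [norm_fun_fin_one, abs_lt], rfl⟩

theorem cc_one (e : RelCWComplex.cell (univ : Set X) 1) :
    cc (⟨1, e⟩ : GCell X) = edgePath e '' Icc (-1) 1 := by
  ext x
  simp only [cc, RelCWComplex.closedCell, mem_image, mem_closedBall_zero_iff]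
  constructor
  · rintro ⟨z, hz, rfl⟩
    rw [eq_fun_fin_one z, norm_fun_fin_one, abs_le] at hz
    exact ⟨z 0, hz, by rw [edgePath, ← eq_fun_fin_one z]⟩
  · rintro ⟨s, hs, rfl⟩
    exact ⟨fun _ => s, by rwa [norm_fun_fin_one, abs_le], rfl⟩

theorem continuousOn_edgePath (e : RelCWComplex.cell (univ : Set X) 1) :
    ContinuousOn (edgePath e) (Icc (-1) 1) := by
  refine (RelCWComplex.continuousOn (C := (univ : Set X)) 1 e).comp
    (Continuous.continuousOn (by fun_prop)) ?_
  intro s hs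
  rwa [mem_closedBall_zero_iff, norm_fun_fin_one, abs_le]

theorem injOn_edgePath (e : RelCWComplex.cell (univ : Set X) 1) :
    InjOn (edgePath e) (Ioo (-1) 1) := by
  intro s hs t ht h
  have := (RelCWComplex.map (C := (univ : Set X)) 1 e).injOn
    (x₁ := fun _ => s) (x₂ := fun _ => t) ?_ ?_ h
  · exact congrFun this 0
  all_goals
    rw [RelCWComplex.source_eq, mem_ball_zero_iff, norm_fun_fin_one, abs_lt]
    assumption

theorem cellOf_edgePath (e : RelCWComplex.cell (univ : Set X) 1) {s : ℝ} (hs : s ∈ Ioo (-1) 1) :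
    cellOf (edgePath e s) = ⟨1, e⟩ :=
  mem_oc_iff.1 (by rw [oc_one]; exact mem_image_of_mem _ hs)

theorem cellOf_vertex (v : RelCWComplex.cell (univ : Set X) 0) :
    cellOf (RelCWComplex.map (C := (univ : Set X)) 0 v ![]) = ⟨0, v⟩ :=
  mem_oc_iff.1 (by rw [oc_zero]; rfl)

theorem mem_vertices_iff {x : X} : x ∈ vertices X ↔ (cellOf x).1 = 0 := by
  simp only [vertices, mem_iUnion]
  constructor
  · rintro ⟨v, hv⟩
    rw [RelCWComplex.closedCell_zero_eq_singleton] at hv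
    rw [hv, cellOf_vertex]
  · intro h
    have hx := mem_oc_cellOf x
    generalize cellOf x = c at h hx
    obtain ⟨n, v⟩ := c
    subst h
    exact ⟨v, oc_subset_cc ⟨0, v⟩ hx⟩

theorem frontier_edge_mem_vertices (e : RelCWComplex.cell (univ : Set X) 1) {s : ℝ}
    (hs : s = -1 ∨ s = 1) : edgePath e s ∈ vertices X := by
  obtain ⟨I, hI⟩ := CWComplex.mapsTo (C := (univ : Set X)) 1 e
  have hz : (fun _ => s : Fin 1 → ℝ) ∈ Metric.sphere 0 1 := by
    rw [mem_sphere_zero_iff_norm, norm_fun_fin_one]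
    rcases hs with rfl | rfl <;> simp
  have := hI hz
  simp only [mem_iUnion] at this
  obtain ⟨m, hm, j, -, hj⟩ := this
  obtain rfl : m = 0 := by omega
  exact mem_iUnion.2 ⟨j, hj⟩

theorem edgePath_mem_vertices_iff (e : RelCWComplex.cell (univ : Set X) 1) {s : ℝ}
    (hs : s ∈ Icc (-1) 1) : edgePath e s ∈ vertices X ↔ s = -1 ∨ s = 1 := by
  refine ⟨fun h => ?_, frontier_edge_mem_vertices e⟩
  by_contra! hne
  rw [mem_vertices_iff, cellOf_edgePath e ⟨hs.1.lt_of_ne' hne.1, hs.2.lt_of_ne hne.2⟩] at h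
  simp at h

theorem GCell.dim_cases (hX : IsGraph X) (c : GCell X) : c.1 = 0 ∨ c.1 = 1 := by
  by_contra! h
  exact (hX.dim_le_one c.1 (by omega)).elim c.2

theorem Face.eq_or (hX : IsGraph X) {c d : GCell X} (h : Face c d) :
    c = d ∨ c.1 = 0 ∧ d.1 = 1 := by
  obtain ⟨x, hx, hxd⟩ := h
  obtain ⟨n, d⟩ := d
  rcases GCell.dim_cases hX ⟨n, d⟩ with rfl | rfl
  · left
    rw [cc_zero, ← oc_zero, mem_oc_iff] at hxd
    rw [← hxd, mem_oc_iff.1 hx]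
  · rw [cc_one] at hxd
    obtain ⟨s, hs, rfl⟩ := hxd
    by_cases h : s = -1 ∨ s = 1
    · right
      have := frontier_edge_mem_vertices d h
      rw [mem_vertices_iff, mem_oc_iff.1 hx] at this
      exact ⟨this, rfl⟩
    · left
      push Not at h
      rw [mem_oc_iff, cellOf_edgePath d ⟨hs.1.lt_of_ne' h.1, hs.2.lt_of_ne h.2⟩] at hx
      exact hx.symm

/-- In dimension at most one a proper face is a vertex, a single point, so meeting a closed cell
already means lying in it. -/
theorem Face.oc_subset (hX : IsGraph X) {c d : GCell X} (h : Face c d) : oc c ⊆ cc d := by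
  rcases h.eq_or hX with rfl | ⟨h0, -⟩
  · exact oc_subset_cc c
  · obtain ⟨x, hx, hxd⟩ := h
    obtain ⟨n, c⟩ := c
    subst h0
    rw [oc_zero] at hx ⊢
    rintro y rfl
    rwa [← mem_singleton_iff.1 hx]

theorem mem_cc_iff (hX : IsGraph X) {x : X} {d : GCell X} : x ∈ cc d ↔ Face (cellOf x) d :=
  ⟨fun h => ⟨x, mem_oc_cellOf x, h⟩, fun h => h.oc_subset hX (mem_oc_cellOf x)⟩

theorem Face.cc_subset (hX : IsGraph X) {c d : GCell X} (h : Face c d) : cc c ⊆ cc d := by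
  rcases h.eq_or hX with rfl | ⟨h0, -⟩
  · exact Subset.rfl
  · have := h.oc_subset hX
    obtain ⟨n, c⟩ := c
    subst h0
    rwa [cc_zero, ← oc_zero]

theorem Face.trans (hX : IsGraph X) {b c d : GCell X} (h : Face b c) (k : Face c d) : Face b d :=
  h.imp fun _ hx => ⟨hx.1, k.cc_subset hX hx.2⟩

theorem isClosed_cc (hX : IsGraph X) (c : GCell X) : IsClosed (cc c) :=
  have := hX.t2
  RelCWComplex.isClosed_closedCell

theorem closure_oc (hX : IsGraph X) (c : GCell X) : closure (oc c) = cc c :=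
  have := hX.t2
  RelCWComplex.closure_openCell_eq_closedCell

theorem locallyFinite_cc (hX : IsGraph X) : LocallyFinite (cc : GCell X → Set X) :=
  hX.locallyFinite

theorem finite_cc_inter (hX : IsGraph X) {K : Set X} (hK : IsCompact K) :
    {c : GCell X | (cc c ∩ K).Nonempty}.Finite :=
  (locallyFinite_cc hX).finite_nonempty_inter_compact hK

theorem finite_cellOf_image (hX : IsGraph X) {K : Set X} (hK : IsCompact K) :
    (cellOf '' K).Finite := by
  refine (finite_cc_inter hX hK).subset ?_
  rintro _ ⟨x, hx, rfl⟩
  exact ⟨x, mem_cc_cellOf x, hx⟩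

theorem finite_cofaces (hX : IsGraph X) (c : GCell X) : {d | Face c d}.Finite := by
  obtain ⟨x, hx⟩ := oc_nonempty c
  refine ((locallyFinite_cc hX).point_finite x).subset fun d (hd : Face c d) => ?_
  exact hd.oc_subset hX hx

theorem finite_faces (hX : IsGraph X) (d : GCell X) : {c | Face c d}.Finite := by
  refine (finite_cc_inter hX (isCompact_cc d)).subset fun c hc => ?_
  exact hc.mono (inter_subset_inter_left _ (oc_subset_cc c))

/-- A set of cells closed under taking faces. -/
def FaceClosed (S : Set (GCell X)) : Prop := ∀ ⦃c d⦄, Face c d → d ∈ S → c ∈ S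

theorem FaceClosed.preimage_eq (hX : IsGraph X) {S : Set (GCell X)} (hS : FaceClosed S) :
    cellOf ⁻¹' S = ⋃ c ∈ S, cc c := by
  ext x
  simp only [mem_preimage, mem_iUnion, exists_prop]
  exact ⟨fun h => ⟨_, h, mem_cc_cellOf x⟩, fun ⟨c, hc, hx⟩ => hS ((mem_cc_iff hX).1 hx) hc⟩

theorem FaceClosed.isClosed (hX : IsGraph X) {S : Set (GCell X)} (hS : FaceClosed S) :
    IsClosed (cellOf ⁻¹' S : Set X) := by
  rw [hS.preimage_eq hX, biUnion_eq_iUnion]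
  exact ((locallyFinite_cc hX).comp_injective Subtype.val_injective).isClosed_iUnion
    fun c => isClosed_cc hX c

theorem FaceClosed.isOpen_compl (hX : IsGraph X) {S : Set (GCell X)} (hS : FaceClosed Sᶜ) :
    IsOpen (cellOf ⁻¹' S : Set X) := by
  have := hS.isClosed hX
  rwa [preimage_compl, isClosed_compl_iff] at this

theorem FaceClosed.union {S T : Set (GCell X)} (hS : FaceClosed S) (hT : FaceClosed T) :
    FaceClosed (S ∪ T) :=
  fun _ _ h => Or.imp (hS h) (hT h)

theorem exists_nhds_finite_cells (hX : IsGraph X) (x : X) :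
    ∃ V ∈ 𝓝 x, (cellOf '' V).Finite := by
  obtain ⟨V, hV, hf⟩ := locallyFinite_cc hX x
  refine ⟨V, hV, hf.subset ?_⟩
  rintro _ ⟨y, hy, rfl⟩
  exact ⟨y, mem_cc_cellOf y, hy⟩

theorem forall_of_cells (hX : IsGraph X) {p : X → Prop} (hv : ∀ x ∈ vertices X, p x)
    (he : ∀ e, ∀ s ∈ Ioo (-1 : ℝ) 1, p (edgePath e s)) (x : X) : p x := by
  have hx := mem_oc_cellOf x
  have h0 := mem_vertices_iff (x := x)
  generalize cellOf x = c at hx h0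
  obtain ⟨n, c⟩ := c
  rcases GCell.dim_cases hX ⟨n, c⟩ with rfl | rfl
  · exact hv x (h0.2 rfl)
  · rw [oc_one] at hx
    obtain ⟨s, hs, rfl⟩ := hx
    exact he c s hs

theorem ext_on_cells (hX : IsGraph X) {T : Type*} {F G : X → T}
    (hv : ∀ x ∈ vertices X, F x = G x)
    (he : ∀ e, ∀ s ∈ Ioo (-1 : ℝ) 1, F (edgePath e s) = G (edgePath e s)) : F = G :=
  funext (forall_of_cells hX hv he)

/-- A continuous function on a graph is given by its values on vertices and by compatible
continuous functions on the edges. -/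
theorem exists_glue (hX : IsGraph X) {T : Type*} [TopologicalSpace T] (a : X → T)
    (φ : RelCWComplex.cell (univ : Set X) 1 → ℝ → T)
    (hφ : ∀ e, ContinuousOn (φ e) (Icc (-1) 1))
    (h0 : ∀ e, φ e (-1) = a (edgePath e (-1))) (h1 : ∀ e, φ e 1 = a (edgePath e 1)) :
    ∃ F : C(X, T), (∀ x ∈ vertices X, F x = a x) ∧
      ∀ e, ∀ s ∈ Icc (-1 : ℝ) 1, F (edgePath e s) = φ e s := by
  have key : ∀ x : X, ∃ t : T, (x ∈ vertices X → t = a x) ∧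
      ∀ e, ∀ s ∈ Icc (-1 : ℝ) 1, edgePath e s = x → t = φ e s := by
    intro x
    by_cases hx : x ∈ vertices X
    · refine ⟨a x, fun _ => rfl, ?_⟩
      rintro e s hs rfl
      rcases (edgePath_mem_vertices_iff e hs).1 hx with rfl | rfl
      · exact (h0 e).symm
      · exact (h1 e).symm
    · have hxc := mem_oc_cellOf x
      rw [mem_vertices_iff] at hx
      generalize hcx : cellOf x = c at hx hxc
      obtain ⟨n, c⟩ := c
      rcases GCell.dim_cases hX ⟨n, c⟩ with rfl | rfl
      · exact absurd rfl hx
      · rw [oc_one] at hxc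
        obtain ⟨s, hs, rfl⟩ := hxc
        refine ⟨φ c s, fun h => absurd h (by rw [mem_vertices_iff, hcx]; simp), ?_⟩
        intro e t ht het
        have ht' : t ∈ Ioo (-1 : ℝ) 1 := by
          by_contra hn
          have : t = -1 ∨ t = 1 := by
            by_contra! hh
            exact hn ⟨ht.1.lt_of_ne' hh.1, ht.2.lt_of_ne hh.2⟩
          have := frontier_edge_mem_vertices e this
          rw [het, mem_vertices_iff, hcx] at this
          simp at this
        have hce := cellOf_edgePath e ht'
        rw [het, hcx] at hce
        obtain rfl : c = e := by simpa using hce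
        rw [injOn_edgePath c ht' hs het]
  choose F hF1 hF2 using key
  refine ⟨⟨F, ?_⟩, fun x hx => hF1 x hx, fun e s hs => hF2 _ e s hs rfl⟩
  refine (locallyFinite_cc hX).continuous iUnion_cc (fun c => isClosed_cc hX c) ?_
  rintro ⟨n, c⟩
  rcases GCell.dim_cases hX ⟨n, c⟩ with rfl | rfl
  · rw [cc_zero]
    exact continuousOn_singleton _ _
  · rw [continuousOn_iff_isClosed]
    intro C hC
    -- Closedness of the preimage inside one closed edge comes from compactness of the parameter set
    -- in the Hausdorff space `X`.
    refine ⟨edgePath c '' (Icc (-1) 1 ∩ φ c ⁻¹' C), ?_, ?_⟩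
    · have := hX.t2
      refine IsCompact.isClosed (IsCompact.image_of_continuousOn ?_ ?_)
      · exact isCompact_Icc.of_isClosed_subset
          ((hφ c).preimage_isClosed_of_isClosed isClosed_Icc hC) inter_subset_left
      · exact (continuousOn_edgePath c).mono inter_subset_left
    · ext x
      rw [cc_one]
      constructor
      · rintro ⟨hx, s, hs, rfl⟩
        refine ⟨⟨s, ⟨hs, ?_⟩, rfl⟩, s, hs, rfl⟩
        rwa [mem_preimage, ← hF2 _ c s hs rfl]
      · rintro ⟨⟨s, ⟨hs, hsC⟩, rfl⟩, -⟩
        refine ⟨?_, s, hs, rfl⟩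
        rwa [mem_preimage, hF2 _ c s hs rfl]

end Cells

/-! ### First cohomology through circle-valued functions -/

section Cohomology

variable {X : Type u} [TopologicalSpace X]

/-- Continuous integer-valued functions vanishing on `B`. -/
def intFunctions (B : Set X) : Submodule ℤ C(X, ℤ) where
  carrier := {f | ∀ x ∈ B, f x = 0}
  add_mem' := fun hf hg x hx => by simp [hf x hx, hg x hx]
  zero_mem' := fun _ _ => rfl
  smul_mem' := fun c f hf x hx => by simp [hf x hx]

/-- Continuous circle-valued functions vanishing on `B`. -/
def circleFunctions (B : Set X) : Submodule ℤ C(X, UnitAddCircle) where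
  carrier := {f | ∀ x ∈ B, f x = 0}
  add_mem' := fun hf hg x hx => by simp [hf x hx, hg x hx]
  zero_mem' := fun _ _ => rfl
  smul_mem' := fun c f hf x hx => by simp [hf x hx]

/-- The circle-valued function `f` vanishing on `B` has a continuous real lift vanishing on `B`. -/
def HasLift (B : Set X) (f : C(X, UnitAddCircle)) : Prop :=
  ∃ h : C(X, ℝ), (∀ x ∈ B, h x = 0) ∧ ∀ x, (h x : UnitAddCircle) = f x

/-- The circle-valued functions with a continuous real lift vanishing on `B`. -/
def liftableFunctions (B : Set X) : Submodule ℤ (circleFunctions B) where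
  carrier := {f | HasLift B f.1}
  add_mem' := by
    rintro f g ⟨h, hB, hf⟩ ⟨k, kB, kg⟩
    exact ⟨h + k, fun x hx => by simp [hB x hx, kB x hx], fun x => by simp [hf, kg]⟩
  zero_mem' := ⟨0, fun _ _ => rfl, fun _ => by simp⟩
  smul_mem' := by
    rintro c f ⟨h, hB, hf⟩
    exact ⟨c • h, fun x hx => by simp [hB x hx], fun x => by simp [← hf]⟩

/-- The first cohomology group of the pair `(X, B)`. -/
abbrev CircleCohomology (B : Set X) : Type u := circleFunctions B ⧸ liftableFunctions B

/-- The Euler characteristic of the pair `(X, B)`. -/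
noncomputable def cohomologicalEulerChar (B : Set X) : ℤ :=
  (Module.finrank ℤ (intFunctions B) : ℤ) - Module.finrank ℤ (CircleCohomology B)

end Cohomology

/-! ### Cellular computation of the relative Euler characteristic -/

section CellularComputation

variable {X : Type u} [TopologicalSpace X] [CWComplex (univ : Set X)]

/-- The vertices outside a set of cells. -/
abbrev VertexCompl (S : Set (GCell X)) : Type u :=
  {v : RelCWComplex.cell (univ : Set X) 0 // (⟨0, v⟩ : GCell X) ∉ S}

/-- The edges outside a set of cells. -/
abbrev EdgeCompl (S : Set (GCell X)) : Type u :=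
  {e : RelCWComplex.cell (univ : Set X) 1 // (⟨1, e⟩ : GCell X) ∉ S}

/-- The point given by a vertex. -/
def vertexPoint (S : Set (GCell X)) (v : VertexCompl S) : X :=
  RelCWComplex.map (C := (univ : Set X)) 0 v.1 ![]

theorem vertexPoint_injective (S : Set (GCell X)) : Function.Injective (vertexPoint S) := by
  intro v w h
  have := congrArg cellOf h
  rw [vertexPoint, vertexPoint, cellOf_vertex, cellOf_vertex] at this
  exact Subtype.ext (by simpa using this)

theorem exists_vertexPoint {S : Set (GCell X)} {x : X} (hx : x ∈ vertices X)
    (hS : cellOf x ∉ S) : ∃ v : VertexCompl S, vertexPoint S v = x := by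
  rw [mem_vertices_iff] at hx
  have h := mem_oc_cellOf x
  generalize cellOf x = c at hx hS h
  obtain ⟨n, c⟩ := c
  subst hx
  exact ⟨⟨c, hS⟩, by rw [oc_zero] at h; exact h.symm⟩

theorem cellOf_vertexPoint {S : Set (GCell X)} (v : VertexCompl S) :
    cellOf (vertexPoint S v) = ⟨0, v.1⟩ := cellOf_vertex _

theorem vertexPoint_mem {S : Set (GCell X)} (v : VertexCompl S) :
    vertexPoint S v ∈ vertices X := by rw [mem_vertices_iff, cellOf_vertexPoint]

/-- Extension of a function on the vertices outside `S` by zero. -/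
noncomputable def vertexExtend (S : Set (GCell X)) : (VertexCompl S → ℤ) →ₗ[ℤ] (X → ℤ) :=
  Function.ExtendByZero.linearMap ℤ (vertexPoint S)

theorem vertexExtend_vertexPoint (S : Set (GCell X)) (ψ : VertexCompl S → ℤ) (v : VertexCompl S) :
    vertexExtend S ψ (vertexPoint S v) = ψ v :=
  (vertexPoint_injective S).extend_apply _ _ _

theorem vertexExtend_of_mem (S : Set (GCell X)) (ψ : VertexCompl S → ℤ) {x : X}
    (hx : cellOf x ∈ S) : vertexExtend S ψ x = 0 :=
  Function.extend_apply' _ _ _ (by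
    rintro ⟨v, rfl⟩
    rw [cellOf_vertexPoint] at hx
    exact v.2 hx)

theorem vertexExtend_eq (S : Set (GCell X)) (ψ : VertexCompl S → ℤ) {T : Type*} [AddGroupWithOne T]
    (h : X → T) (h0 : ∀ x, cellOf x ∈ S → h x = 0) (hv : ∀ v, h (vertexPoint S v) = ψ v) {x : X}
    (hx : x ∈ vertices X) : h x = vertexExtend S ψ x := by
  by_cases hS : cellOf x ∈ S
  · rw [vertexExtend_of_mem S ψ hS, h0 x hS, Int.cast_zero]
  · obtain ⟨v, rfl⟩ := exists_vertexPoint hx hS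
    rw [hv, vertexExtend_vertexPoint]

/-- Extension of a function on the edges outside `S` by zero. -/
noncomputable def edgeExtend (S : Set (GCell X)) :
    (EdgeCompl S → ℤ) →ₗ[ℤ] (RelCWComplex.cell (univ : Set X) 1 → ℤ) :=
  Function.ExtendByZero.linearMap ℤ Subtype.val

theorem edgeExtend_apply (S : Set (GCell X)) (φ : EdgeCompl S → ℤ) (e : EdgeCompl S) :
    edgeExtend S φ e.1 = φ e :=
  Subtype.val_injective.extend_apply _ _ _

theorem edgeExtend_of_mem (S : Set (GCell X)) (φ : EdgeCompl S → ℤ)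
    {e : RelCWComplex.cell (univ : Set X) 1} (he : (⟨1, e⟩ : GCell X) ∈ S) :
    edgeExtend S φ e = 0 :=
  Function.extend_apply' _ _ _ (by
    rintro ⟨v, rfl⟩
    exact v.2 he)

/-- The cellular coboundary relative to the cells in `S`. -/
noncomputable def coboundary (S : Set (GCell X)) : (VertexCompl S → ℤ) →ₗ[ℤ] (EdgeCompl S → ℤ) where
  toFun ψ e := vertexExtend S ψ (edgePath e.1 1) - vertexExtend S ψ (edgePath e.1 (-1))
  map_add' ψ ψ' := by
    ext e
    simp only [map_add, Pi.add_apply]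
    ring
  map_smul' c ψ := by
    ext e
    simp only [map_smul, Pi.smul_apply, smul_eq_mul, RingHom.id_apply]
    ring

theorem edgePath_mem_faceClosed {S : Set (GCell X)} (hS : FaceClosed S)
    {e : RelCWComplex.cell (univ : Set X) 1} (he : (⟨1, e⟩ : GCell X) ∈ S) {s : ℝ}
    (hs : s ∈ Icc (-1 : ℝ) 1) : cellOf (edgePath e s) ∈ S :=
  hS ⟨edgePath e s, mem_oc_cellOf _, by rw [cc_one]; exact mem_image_of_mem _ hs⟩ he

theorem left_mem_Icc' : (-1 : ℝ) ∈ Icc (-1 : ℝ) 1 := by norm_num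

theorem right_mem_Icc' : (1 : ℝ) ∈ Icc (-1 : ℝ) 1 := by norm_num

/-- By the intermediate value theorem, two different integer values would force a half-integer value
in between. -/
theorem eq_of_continuousOn_int {f : ℝ → ℝ} (hf : ContinuousOn f (Icc (-1) 1))
    (hi : ∀ s ∈ Icc (-1 : ℝ) 1, ∃ n : ℤ, f s = n) {s : ℝ} (hs : s ∈ Icc (-1 : ℝ) 1) :
    f s = f (-1) := by
  by_contra hne
  have hs1 : (-1 : ℝ) ≤ s := hs.1
  have hsub := intermediate_value_uIcc (a := -1) (b := s) (f := f)
    (hf.mono (by rw [uIcc_of_le hs1]; exact Icc_subset_Icc_right hs.2))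
  rw [uIcc_of_le hs1] at hsub
  obtain ⟨m, hm⟩ := hi _ left_mem_Icc'
  obtain ⟨n, hn⟩ := hi s hs
  have key : ∃ r ∈ uIcc (f (-1)) (f s), ∀ k : ℤ, r ≠ k := by
    rw [hm, hn] at hne ⊢
    have hmn : n ≠ m := by exact_mod_cast hne
    rcases hmn.lt_or_gt with h | h
    · refine ⟨n + 1 / 2, ?_, fun k hk => ?_⟩
      · have : (n : ℝ) + 1 ≤ m := by exact_mod_cast h
        rw [mem_uIcc]; right; constructor <;> linarith
      · have : (2 * n + 1 : ℝ) = 2 * k := by linarith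
        have : (2 * n + 1 : ℤ) = 2 * k := by exact_mod_cast this
        omega
    · refine ⟨m + 1 / 2, ?_, fun k hk => ?_⟩
      · have : (m : ℝ) + 1 ≤ n := by exact_mod_cast h
        rw [mem_uIcc]; left; constructor <;> linarith
      · have : (2 * m + 1 : ℝ) = 2 * k := by linarith
        have : (2 * m + 1 : ℤ) = 2 * k := by exact_mod_cast this
        omega
  obtain ⟨r, hr, hrk⟩ := key
  obtain ⟨t, ht, rfl⟩ := hsub hr
  obtain ⟨k, hk⟩ := hi t ⟨ht.1, ht.2.trans hs.2⟩
  exact hrk k hk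

theorem exists_int_of_coe_eq_zero {r : ℝ} (h : (r : UnitAddCircle) = 0) : ∃ n : ℤ, r = n := by
  rw [AddCircle.coe_eq_zero_iff] at h
  obtain ⟨n, hn⟩ := h
  exact ⟨n, by simpa using hn.symm⟩

theorem coe_intCast (n : ℤ) : ((n : ℝ) : UnitAddCircle) = 0 := by
  rw [AddCircle.coe_eq_zero_iff]
  exact ⟨n, by simp⟩

/-- A continuous integer-valued function is constant along each edge. It is thus determined by its
vertex values, and a vertex function arises in this way exactly when its coboundary vanishes. -/
theorem finrank_intFunctions (hX : IsGraph X) {S : Set (GCell X)} (hS : FaceClosed S) :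
    Module.finrank ℤ (intFunctions (cellOf ⁻¹' S : Set X)) =
      Module.finrank ℤ (LinearMap.ker (coboundary S)) := by
  have hconst : ∀ (f : C(X, ℤ)) e, ∀ s ∈ Icc (-1 : ℝ) 1,
      f (edgePath e s) = f (edgePath e (-1)) := by
    intro f e s hs
    have := eq_of_continuousOn_int (f := fun s => (f (edgePath e s) : ℝ))
      (((continuous_of_discreteTopology (f := ((↑) : ℤ → ℝ))).comp f.continuous).comp_continuousOn
        (continuousOn_edgePath e)) (fun s _ => ⟨_, rfl⟩) hs
    exact_mod_cast this
  let Φ : intFunctions (cellOf ⁻¹' S : Set X) →ₗ[ℤ] LinearMap.ker (coboundary S) :=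
    { toFun := fun f => ⟨fun v => f.1 (vertexPoint S v), by
        rw [LinearMap.mem_ker]
        ext e
        have h := fun x hx => vertexExtend_eq S (fun v => f.1 (vertexPoint S v)) f.1
          (fun x hx => f.2 x hx) (fun v => by simp) (x := x) hx
        simp only [Int.cast_id] at h
        change vertexExtend S _ _ - vertexExtend S _ _ = 0
        rw [← h _ (frontier_edge_mem_vertices _ (.inl rfl)),
          ← h _ (frontier_edge_mem_vertices _ (.inr rfl)),
          hconst f.1 e.1 1 right_mem_Icc', sub_self]⟩
      map_add' := fun f g => rfl
      map_smul' := fun c f => rfl }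
  refine (LinearEquiv.ofBijective Φ ⟨?_, ?_⟩).finrank_eq
  · intro f g h
    have hv : ∀ x ∈ vertices X, f.1 x = g.1 x := by
      intro x hx
      by_cases hxS : cellOf x ∈ S
      · rw [f.2 x hxS, g.2 x hxS]
      · obtain ⟨v, rfl⟩ := exists_vertexPoint hx hxS
        exact congrFun (congrArg Subtype.val h) v
    refine Subtype.ext (DFunLike.coe_injective (ext_on_cells hX hv fun e s hs => ?_))
    rw [hconst f.1 e s (Ioo_subset_Icc_self hs), hconst g.1 e s (Ioo_subset_Icc_self hs)]
    exact hv _ (frontier_edge_mem_vertices e (.inl rfl))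
  · rintro ⟨ψ, hψ⟩
    have hd : ∀ e, vertexExtend S ψ (edgePath e (-1)) = vertexExtend S ψ (edgePath e 1) := by
      intro e
      by_cases he : (⟨1, e⟩ : GCell X) ∈ S
      · rw [vertexExtend_of_mem S ψ (edgePath_mem_faceClosed hS he left_mem_Icc'),
          vertexExtend_of_mem S ψ (edgePath_mem_faceClosed hS he right_mem_Icc')]
      · have : coboundary S ψ ⟨e, he⟩ = 0 := by rw [LinearMap.mem_ker.1 hψ]; rfl
        exact (sub_eq_zero.1 this).symm
    obtain ⟨F, hF1, hF2⟩ := exists_glue hX (vertexExtend S ψ)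
      (fun e _ => vertexExtend S ψ (edgePath e (-1))) (fun e => continuousOn_const)
      (fun e => rfl) hd
    refine ⟨⟨F, ?_⟩, ?_⟩
    · intro x hx
      refine forall_of_cells hX (p := fun x => cellOf x ∈ S → F x = 0) (fun x hx h => ?_)
        (fun e s hs h => ?_) x hx
      · rw [hF1 x hx, vertexExtend_of_mem S ψ h]
      · rw [hF2 e s (Ioo_subset_Icc_self hs), vertexExtend_of_mem S ψ]
        rw [cellOf_edgePath e hs] at h
        exact edgePath_mem_faceClosed hS h left_mem_Icc'
    · refine Subtype.ext (funext fun v => ?_)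
      change F (vertexPoint S v) = ψ v
      rw [hF1 _ (vertexPoint_mem v), vertexExtend_vertexPoint]

theorem continuous_coe_circle : Continuous ((↑) : ℝ → UnitAddCircle) := AddCircle.continuous_mk' 1

theorem exists_edge_cocycle (hX : IsGraph X) {S : Set (GCell X)}
    (φ : EdgeCompl S → ℤ) : ∃ f : circleFunctions (cellOf ⁻¹' S : Set X),
      (∀ x ∈ vertices X, f.1 x = 0) ∧ ∀ e, ∀ s ∈ Icc (-1 : ℝ) 1,
        f.1 (edgePath e s) = ((edgeExtend S φ e * ((s + 1) / 2) : ℝ) : UnitAddCircle) := by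
  obtain ⟨F, hF1, hF2⟩ := exists_glue hX (fun _ : X => (0 : UnitAddCircle))
    -- The factor `(s + 1) / 2` rescales `[-1, 1]` to `[0, 1]`. Integrality of `φ` makes the loop
    -- close up at the right endpoint.
    (fun e s => ((edgeExtend S φ e * ((s + 1) / 2) : ℝ) : UnitAddCircle))
    (fun e => (continuous_coe_circle.comp (by fun_prop)).continuousOn)
    (fun e => by simp) (fun e => by
      have := coe_intCast (edgeExtend S φ e)
      norm_num)
  refine ⟨⟨F, ?_⟩, hF1, hF2⟩
  intro x hx
  refine forall_of_cells hX (p := fun x => cellOf x ∈ S → F x = 0) (fun x hx h => ?_)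
    (fun e s hs h => ?_) x hx
  · rw [hF1 x hx]
  · rw [cellOf_edgePath e hs] at h
    rw [hF2 e s (Ioo_subset_Icc_self hs), edgeExtend_of_mem S φ h]
    simp

/-- The circle-valued function wrapping around each edge a prescribed number of times. -/
noncomputable def edgeCocycle (hX : IsGraph X) {S : Set (GCell X)} :
    (EdgeCompl S → ℤ) →ₗ[ℤ] circleFunctions (cellOf ⁻¹' S : Set X) :=
  AddMonoidHom.toIntLinearMap <| AddMonoidHom.mk' (fun φ => (exists_edge_cocycle hX φ).choose) <| by
    intro φ ψ
    have h1 := (exists_edge_cocycle hX φ).choose_spec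
    have h2 := (exists_edge_cocycle hX ψ).choose_spec
    have h3 := (exists_edge_cocycle hX (φ + ψ)).choose_spec
    -- The chosen functions are additive in `φ` because their prescribed values on vertices and
    -- edges determine them.
    refine Subtype.ext (DFunLike.coe_injective (ext_on_cells hX (fun x hx => ?_)
      fun e s hs => ?_))
    · refine (h3.1 x hx).trans ?_
      change 0 = (exists_edge_cocycle hX φ).choose.1 x + (exists_edge_cocycle hX ψ).choose.1 x
      rw [h1.1 x hx, h2.1 x hx, add_zero]
    · have hs' := Ioo_subset_Icc_self hs
      refine (h3.2 e s hs').trans ?_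
      change _ = (exists_edge_cocycle hX φ).choose.1 (edgePath e s) +
        (exists_edge_cocycle hX ψ).choose.1 (edgePath e s)
      rw [h1.2 e s hs', h2.2 e s hs', ← AddCircle.coe_add, map_add, Pi.add_apply, Int.cast_add,
        add_mul]

theorem edgeCocycle_vertex (hX : IsGraph X) {S : Set (GCell X)}
    (φ : EdgeCompl S → ℤ) {x : X} (hx : x ∈ vertices X) : (edgeCocycle hX φ).1 x = 0 :=
  (exists_edge_cocycle hX φ).choose_spec.1 x hx

theorem edgeCocycle_edge (hX : IsGraph X) {S : Set (GCell X)}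
    (φ : EdgeCompl S → ℤ) (e : RelCWComplex.cell (univ : Set X) 1) {s : ℝ}
    (hs : s ∈ Icc (-1 : ℝ) 1) : (edgeCocycle hX φ).1 (edgePath e s) =
      ((edgeExtend S φ e * ((s + 1) / 2) : ℝ) : UnitAddCircle) :=
  (exists_edge_cocycle hX φ).choose_spec.2 e s hs

/-- Path lifting for the covering of the circle by the line, rescaled to `[-1, 1]`. The lift is
extended by constants so as to be continuous on all of `ℝ`. -/
theorem exists_lift_Icc {f : ℝ → UnitAddCircle} (hf : ContinuousOn f (Icc (-1) 1)) {r : ℝ}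
    (hr : (r : UnitAddCircle) = f (-1)) : ∃ ℓ : ℝ → ℝ, Continuous ℓ ∧ ℓ (-1) = r ∧
      ∀ s ∈ Icc (-1 : ℝ) 1, (ℓ s : UnitAddCircle) = f s := by
  have hmaps : ∀ t : unitInterval, (2 * (t : ℝ) - 1) ∈ Icc (-1 : ℝ) 1 := fun t =>
    ⟨by linarith [t.2.1], by linarith [t.2.2]⟩
  let γ : C(unitInterval, UnitAddCircle) := ⟨fun t => f (2 * t - 1),
    hf.comp_continuous (by fun_prop) hmaps⟩
  obtain ⟨Γ, hΓ, h0⟩ := (AddCircle.isCoveringMap_coe (1 : ℝ)).exists_path_lifts γ r (by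
    change f (2 * 0 - 1) = r
    rw [hr]; norm_num)
  refine ⟨fun s => Γ (projIcc 0 1 zero_le_one ((s + 1) / 2)), by fun_prop, ?_, ?_⟩
  · rw [← h0]
    change Γ (projIcc 0 1 zero_le_one ((-1 + 1) / 2)) = Γ 0
    congr 1
    rw [neg_add_cancel, zero_div]
    exact projIcc_left _
  · intro s hs
    have h := congrFun hΓ (projIcc 0 1 zero_le_one ((s + 1) / 2))
    refine h.trans ?_
    change f _ = f s
    rw [projIcc_of_mem zero_le_one (x := (s + 1) / 2) ⟨by linarith [hs.1], by linarith [hs.2]⟩]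
    congr 1
    ring

/-- Real lifts `r` of `f` are chosen pointwise, zero on `S`, and `f` is lifted along each edge
starting from `r` at the left endpoint. At the right endpoint the lift misses `r` by an integer `n
e`. Subtracting a linear function of total increase `n e` gives lifts that agree at the vertices, so
`f` differs from the edge cocycle of `n` by a liftable function. -/
theorem edgeCocycle_surjective (hX : IsGraph X) {S : Set (GCell X)} (hS : FaceClosed S) :
    Function.Surjective ((liftableFunctions (cellOf ⁻¹' S : Set X)).mkQ ∘ₗ edgeCocycle hX) := by
  intro q
  obtain ⟨f, rfl⟩ := Submodule.mkQ_surjective _ q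
  have hr : ∀ x : X, ∃ r : ℝ, (r : UnitAddCircle) = f.1 x ∧ (cellOf x ∈ S → r = 0) := by
    intro x
    by_cases hx : cellOf x ∈ S
    · exact ⟨0, by rw [f.2 x hx]; simp, fun _ => rfl⟩
    · obtain ⟨r, hr⟩ := QuotientAddGroup.mk_surjective (f.1 x)
      exact ⟨r, hr, fun h => absurd h hx⟩
  choose r hr hr0 using hr
  have hl : ∀ e, ∃ (ℓ : ℝ → ℝ) (n : ℤ), Continuous ℓ ∧ ℓ (-1) = r (edgePath e (-1)) ∧
      (∀ s ∈ Icc (-1 : ℝ) 1, (ℓ s : UnitAddCircle) = f.1 (edgePath e s)) ∧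
      ℓ 1 = r (edgePath e 1) + n ∧
      ((⟨1, e⟩ : GCell X) ∈ S → n = 0 ∧ ∀ s, ℓ s = 0) := by
    intro e
    by_cases he : (⟨1, e⟩ : GCell X) ∈ S
    -- On an edge of `S` the lift must be identically zero, so that the glued lift vanishes on the
    -- subgraph.
    · have h := fun s hs => edgePath_mem_faceClosed hS he (s := s) hs
      exact ⟨0, 0, continuous_zero, (hr0 _ (h _ left_mem_Icc')).symm,
        fun s hs => by rw [f.2 _ (h s hs)]; simp,
        by simp [hr0 _ (h _ right_mem_Icc')], fun _ => ⟨rfl, fun _ => rfl⟩⟩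
    · obtain ⟨ℓ, h1, h2, h3⟩ := exists_lift_Icc (f := fun s => f.1 (edgePath e s))
        (f.1.continuous.comp_continuousOn (continuousOn_edgePath e)) (hr (edgePath e (-1)))
      obtain ⟨n, hn⟩ := exists_int_of_coe_eq_zero (r := ℓ 1 - r (edgePath e 1)) (by
        rw [AddCircle.coe_sub, h3 1 right_mem_Icc', hr, sub_self])
      exact ⟨ℓ, n, h1, h2, h3, by linarith, fun h => absurd h he⟩
  choose ℓ n hℓ1 hℓ2 hℓ3 hℓ4 hℓ5 using hl
  obtain ⟨k, hk1, hk2⟩ := exists_glue hX r (fun e s => ℓ e s - n e * ((s + 1) / 2))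
    (fun e => ((hℓ1 e).sub (by fun_prop)).continuousOn)
    (fun e => by simp [hℓ2]) (fun e => by simp only [hℓ4]; ring)
  have hn : edgeExtend S (fun e => n e.1) = n := by
    ext e
    by_cases he : (⟨1, e⟩ : GCell X) ∈ S
    · rw [edgeExtend_of_mem S _ he, (hℓ5 e he).1]
    · exact edgeExtend_apply S (fun e => n e.1) ⟨e, he⟩
  refine ⟨fun e => n e.1, ?_⟩
  rw [LinearMap.comp_apply, ← sub_eq_zero, ← map_sub, Submodule.mkQ_apply,
    Submodule.Quotient.mk_eq_zero]
  refine ⟨-k, ?_, ?_⟩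
  · intro x hx
    rw [ContinuousMap.neg_apply, neg_eq_zero]
    refine forall_of_cells hX (p := fun x => cellOf x ∈ S → k x = 0) (fun x hx h => ?_)
      (fun e s hs h => ?_) x hx
    · rw [hk1 x hx, hr0 x h]
    · rw [cellOf_edgePath e hs] at h
      rw [hk2 e s (Ioo_subset_Icc_self hs), (hℓ5 e h).1, (hℓ5 e h).2]
      simp
  · intro x
    refine congrFun (ext_on_cells hX (F := fun x => (((-k) x : ℝ) : UnitAddCircle))
      (G := fun x => (edgeCocycle hX (fun e => n e.1) - f).1 x) (fun x hx => ?_)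
      fun e s hs => ?_) x
    · simp [edgeCocycle_vertex hX _ hx, hk1 x hx, hr]
    · have hs' := Ioo_subset_Icc_self hs
      have h := edgeCocycle_edge hX (S := S) (fun e => n e.1) e hs'
      rw [hn] at h
      change _ = (edgeCocycle hX (fun e => n e.1)).1 (edgePath e s) - f.1 (edgePath e s)
      rw [h, ← hℓ3 e s hs', ← AddCircle.coe_sub, ContinuousMap.neg_apply, hk2 e s hs', neg_sub]

/-- A real lift `h` of an edge cocycle has integer values at vertices, and along an edge it differs
from the linear function of increase `φ e` by an integer-valued, hence constant, function. So `φ` is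
the coboundary of the vertex values of `h`. Conversely, linear interpolation of `ψ` along the edges
lifts the cocycle of its coboundary. -/
theorem ker_edgeCocycle (hX : IsGraph X) {S : Set (GCell X)} (hS : FaceClosed S) :
    LinearMap.ker ((liftableFunctions (cellOf ⁻¹' S : Set X)).mkQ ∘ₗ edgeCocycle hX) =
      LinearMap.range (coboundary S) := by
  ext φ
  rw [LinearMap.mem_ker, LinearMap.comp_apply, Submodule.mkQ_apply, Submodule.Quotient.mk_eq_zero,
    LinearMap.mem_range]
  constructor
  · rintro ⟨h, hB, hh⟩
    have hint : ∀ x ∈ vertices X, ∃ m : ℤ, h x = m := fun x hx =>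
      exists_int_of_coe_eq_zero (by rw [hh, edgeCocycle_vertex hX φ hx])
    choose ψ hψ using fun v : VertexCompl S => hint _ (vertexPoint_mem v)
    refine ⟨ψ, funext fun e => ?_⟩
    have hext := fun x hx => vertexExtend_eq S ψ h (fun x hx => hB x hx) hψ (x := x) hx
    have hc := eq_of_continuousOn_int
      (f := fun s => h (edgePath e.1 s) - edgeExtend S φ e.1 * ((s + 1) / 2))
      ((h.continuous.comp_continuousOn (continuousOn_edgePath e.1)).sub (by fun_prop))
      (fun s hs => exists_int_of_coe_eq_zero (by
        rw [AddCircle.coe_sub, hh, edgeCocycle_edge hX φ e.1 hs, sub_self])) right_mem_Icc'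
    rw [hext _ (frontier_edge_mem_vertices _ (.inl rfl)),
      hext _ (frontier_edge_mem_vertices _ (.inr rfl)), edgeExtend_apply] at hc
    change vertexExtend S ψ (edgePath e.1 1) - vertexExtend S ψ (edgePath e.1 (-1)) = φ e
    have : ((vertexExtend S ψ (edgePath e.1 1) : ℤ) : ℝ) -
      (vertexExtend S ψ (edgePath e.1 (-1)) : ℤ) = (φ e : ℤ) := by linarith
    exact_mod_cast this
  · rintro ⟨ψ, rfl⟩
    have hd : ∀ e, (edgeExtend S (coboundary S ψ) e : ℤ) =
        vertexExtend S ψ (edgePath e 1) - vertexExtend S ψ (edgePath e (-1)) := by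
      intro e
      by_cases he : (⟨1, e⟩ : GCell X) ∈ S
      · rw [vertexExtend_of_mem S ψ (edgePath_mem_faceClosed hS he left_mem_Icc'),
          vertexExtend_of_mem S ψ (edgePath_mem_faceClosed hS he right_mem_Icc'),
          edgeExtend_of_mem S _ he, sub_self]
      · exact edgeExtend_apply S _ ⟨e, he⟩
    obtain ⟨h, hh1, hh2⟩ := exists_glue hX (fun x => (vertexExtend S ψ x : ℝ))
      (fun e s => vertexExtend S ψ (edgePath e (-1)) +
        edgeExtend S (coboundary S ψ) e * ((s + 1) / 2))
      (fun e => by fun_prop) (fun e => by simp) (fun e => by rw [hd]; push_cast; ring)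
    refine ⟨h, ?_, ?_⟩
    · intro x hx
      refine forall_of_cells hX (p := fun x => cellOf x ∈ S → h x = 0) (fun x hx h => ?_)
        (fun e s hs h => ?_) x hx
      · rw [hh1 x hx, vertexExtend_of_mem S ψ h]; simp
      · rw [cellOf_edgePath e hs] at h
        rw [hh2 e s (Ioo_subset_Icc_self hs), edgeExtend_of_mem S _ h,
        vertexExtend_of_mem S ψ (edgePath_mem_faceClosed hS h left_mem_Icc')]
        simp
    · intro x
      refine congrFun (ext_on_cells hX (F := fun x => ((h x : ℝ) : UnitAddCircle))
        (G := (edgeCocycle hX (coboundary S ψ)).1) (fun x hx => ?_) fun e s hs => ?_) x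
      · simp only [edgeCocycle_vertex hX _ hx, hh1 x hx]
        exact coe_intCast _
      · have hs' := Ioo_subset_Icc_self hs
        simp only [edgeCocycle_edge hX _ e hs', hh2 e s hs', AddCircle.coe_add, coe_intCast,
          zero_add]

/-- The Euler characteristic of a graph relative to a subgraph with finite complement is
the number of vertices minus the number of edges of the complement. -/
theorem cohomologicalEulerChar_eq (hX : IsGraph X) {S : Set (GCell X)} (hS : FaceClosed S)
    (hfin : Sᶜ.Finite) : cohomologicalEulerChar (cellOf ⁻¹' S : Set X) =
      (Nat.card (VertexCompl S) : ℤ) - Nat.card (EdgeCompl S) := by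
  have : Finite (VertexCompl S) := by
    have := hfin.to_subtype
    refine Finite.of_injective (fun v : VertexCompl S => (⟨⟨0, v.1⟩, v.2⟩ : (Sᶜ : Set (GCell X)))) ?_
    intro v w h
    simpa [Subtype.ext_iff] using h
  have : Finite (EdgeCompl S) := by
    have := hfin.to_subtype
    refine Finite.of_injective (fun v : EdgeCompl S => (⟨⟨1, v.1⟩, v.2⟩ : (Sᶜ : Set (GCell X)))) ?_
    intro v w h
    simpa [Subtype.ext_iff] using h
  have := Fintype.ofFinite (VertexCompl S)
  have := Fintype.ofFinite (EdgeCompl S)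
  -- The kernel of the coboundary computes degree zero and its cokernel degree one, so the rank of
  -- its range cancels in the difference.
  have h1 : Module.finrank ℤ (LinearMap.range (coboundary S)) +
      Module.finrank ℤ (LinearMap.ker (coboundary S)) = Nat.card (VertexCompl S) := by
    have := Submodule.finrank_quotient_add_finrank (LinearMap.ker (coboundary S))
    rwa [(coboundary S).quotKerEquivRange.finrank_eq, Module.finrank_fintype_fun_eq_card,
      ← Nat.card_eq_fintype_card] at this
  have h2 : Module.finrank ℤ (CircleCohomology (cellOf ⁻¹' S : Set X)) +
      Module.finrank ℤ (LinearMap.range (coboundary S)) = Nat.card (EdgeCompl S) := by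
    have := Submodule.finrank_quotient_add_finrank (LinearMap.range (coboundary S))
    rwa [← ker_edgeCocycle hX hS,
      (LinearMap.quotKerEquivOfSurjective _ (edgeCocycle_surjective hX hS)).finrank_eq,
      ker_edgeCocycle hX hS, Module.finrank_fintype_fun_eq_card, ← Nat.card_eq_fintype_card] at this
  rw [cohomologicalEulerChar, finrank_intFunctions hX hS]
  omega

end CellularComputation

/-! ### Homotopy invariance and excision -/

section Invariance

variable {X : Type u} [TopologicalSpace X]

/-- The function `f ∘ H_t - f ∘ F` vanishes at `t = 0`, so it lifts to `ℝ` starting from zero. The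
lift at `t = 1` is the required one. -/
theorem hasLift_sub_of_homotopic {F G : C(X, X)} (H : F.Homotopic G) (f : C(X, UnitAddCircle)) :
    HasLift ∅ (f.comp G - f.comp F) := by
  obtain ⟨H⟩ := H
  let K : C(unitInterval × X, UnitAddCircle) :=
    f.comp H.toContinuousMap - (f.comp F).comp ContinuousMap.snd
  have cov := AddCircle.isCoveringMap_coe (1 : ℝ)
  have h0 : ∀ a, K (0, a) = ((0 : C(X, ℝ)) a : UnitAddCircle) := by
    intro a
    simp [K]
  refine ⟨(cov.liftHomotopy K 0 h0).comp (.prodMk (.const X 1) (.id X)), by simp, fun x => ?_⟩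
  refine (congrFun (cov.liftHomotopy_lifts K 0 h0) (1, x)).trans ?_
  simp [K]

theorem HasLift.comp {f : C(X, UnitAddCircle)} (hf : HasLift ∅ f) (F : C(X, X)) :
    HasLift ∅ (f.comp F) := by
  obtain ⟨h, -, hh⟩ := hf
  exact ⟨h.comp F, by simp, fun x => hh (F x)⟩

theorem HasLift.add {f g : C(X, UnitAddCircle)} (hf : HasLift ∅ f) (hg : HasLift ∅ g) :
    HasLift ∅ (f + g) := by
  obtain ⟨h, -, hh⟩ := hf
  obtain ⟨k, -, hk⟩ := hg
  exact ⟨h + k, by simp, fun x => by simp [hh, hk]⟩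

/-- Injectivity of the pullback in absolute degree one cohomology: `f` and the pullback of `f ∘ E`
by the homotopy inverse differ by a liftable function. -/
theorem hasLift_of_comp (E : ContinuousMap.HomotopyEquiv X X) {f : C(X, UnitAddCircle)}
    (hf : HasLift ∅ (f.comp E.toFun)) : HasLift ∅ f := by
  have := (hasLift_sub_of_homotopic E.right_inv f).add (hf.comp E.invFun)
  convert this using 1
  ext x
  simp

theorem exists_comp_hasLift (E : ContinuousMap.HomotopyEquiv X X) (f : C(X, UnitAddCircle)) :
    ∃ f' : C(X, UnitAddCircle), HasLift ∅ (f - f'.comp E.toFun) :=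
  ⟨f.comp E.invFun, hasLift_sub_of_homotopic E.left_inv f⟩

theorem exists_const_of_forall_int [PreconnectedSpace X] (h : C(X, ℝ))
    (hi : ∀ x, ∃ n : ℤ, h x = n) : ∃ n : ℤ, ∀ x, h x = n := by
  rcases isEmpty_or_nonempty X with hX | ⟨⟨x₀⟩⟩
  · exact ⟨0, fun x => hX.elim x⟩
  obtain ⟨n, hn⟩ := hi x₀
  refine ⟨n, fun x => ?_⟩
  have hemb : IsEmbedding ((↑) : ℤ → ℝ) := Int.isClosedEmbedding_coe_real.isEmbedding
  choose k hk using hi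
  have hkc : Continuous k := by
    rw [hemb.continuous_iff]
    exact h.continuous.congr fun x => hk x
  rw [hk, PreconnectedSpace.constant (inferInstance : PreconnectedSpace X) hkc (x := x) (y := x₀),
    ← hk, hn]

theorem coe_eq_coe_iff_exists_int {a b : ℝ} : (a : UnitAddCircle) = b ↔ ∃ n : ℤ, a - b = n := by
  constructor
  · intro h
    exact exists_int_of_coe_eq_zero (by rw [AddCircle.coe_sub, h, sub_self])
  · rintro ⟨n, hn⟩
    rw [← sub_eq_zero, ← AddCircle.coe_sub, hn, coe_intCast]

variable (E : ContinuousMap.HomotopyEquiv X X) {B C : Set X} (r : X → X)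

/-- Surjectivity of the pullback for pairs. The absolute statement gives `f'` and a real lift `h` of
`f - f' ∘ E` that need not vanish on `B`. Transporting `h` from `B` to `C` by `r` and extending to a
real function `w` on `X`, the corrections `f' + w` and `h - w ∘ E` vanish on `C` and `B`
respectively. -/
theorem exists_comp_hasLift_rel (hC : E '' B = C) (hr : ContinuousOn r C)
    (hrE : ∀ x ∈ B, r (E x) = x)
    (hext : ∀ v : X → ℝ, ContinuousOn v C → ∃ w : C(X, ℝ), EqOn w v C)
    {f : C(X, UnitAddCircle)} (hfB : ∀ x ∈ B, f x = 0) :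
    ∃ f' : C(X, UnitAddCircle), (∀ x ∈ C, f' x = 0) ∧ HasLift B (f - f'.comp E.toFun) := by
  obtain ⟨f', h, -, hh⟩ := exists_comp_hasLift E f
  obtain ⟨w, hw⟩ := hext (fun x => h (r x)) (h.continuous.comp_continuousOn hr)
  have hwE : ∀ x ∈ B, w (E x) = h x := by
    intro x hx
    rw [hw (hC ▸ mem_image_of_mem E hx)]
    simp only [hrE x hx]
  refine ⟨f' + ⟨fun x => (w x : UnitAddCircle), continuous_coe_circle.comp w.continuous⟩, ?_,
    h - w.comp E.toFun, ?_, ?_⟩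
  · intro x hx
    rw [← hC] at hx
    obtain ⟨y, hy, rfl⟩ := hx
    have := hh y
    simp only [ContinuousMap.sub_apply, hfB y hy, zero_sub, ContinuousMap.comp_apply] at this
    simp only [ContinuousMap.add_apply, ContinuousMap.coe_mk, hwE y hy, this]
    exact add_neg_cancel _
  · intro x hx
    simpa [sub_eq_zero] using (hwE x hx).symm
  · intro x
    have := hh x
    simp only [ContinuousMap.sub_apply, ContinuousMap.comp_apply] at this
    simp only [ContinuousMap.sub_apply, ContinuousMap.comp_apply, AddCircle.coe_sub, this,
      ContinuousMap.add_apply, ContinuousMap.coe_mk]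
    abel

variable [PreconnectedSpace X]

/-- Injectivity for pairs. An absolute lift `k` of `f` satisfies `k ∘ E - h = n` for a single
integer `n`, by connectedness, and `k - n` is a lift vanishing on `C`. -/
theorem hasLift_of_comp_rel (hC : E '' B = C) {f : C(X, UnitAddCircle)}
    (hf : HasLift B (f.comp E.toFun)) : HasLift C f := by
  obtain ⟨h, hB, hh⟩ := hf
  obtain ⟨k, -, hk⟩ := hasLift_of_comp E (f := f) ⟨h, by simp, hh⟩
  obtain ⟨n, hn⟩ := exists_const_of_forall_int (k.comp E.toFun - h) (fun x =>
    coe_eq_coe_iff_exists_int.1 ((hk _).trans (hh x).symm))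
  refine ⟨k - .const X (n : ℝ), ?_, fun x => ?_⟩
  · rintro x hx
    rw [← hC] at hx
    obtain ⟨y, hy, rfl⟩ := hx
    have := hn y
    simp only [ContinuousMap.sub_apply, ContinuousMap.comp_apply, hB y hy, sub_zero] at this
    simpa [sub_eq_zero] using this
  · simp [hk, coe_intCast]

/-- Continuous integer-valued functions on a connected space are constant, so it only matters
whether the subset is empty. -/
theorem intFunctions_eq (hC : E '' B = C) : intFunctions B = intFunctions C := by
  ext f
  have hc : ∀ x y, f x = f y := fun x y =>
    PreconnectedSpace.constant (inferInstance : PreconnectedSpace X) f.continuous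
  constructor
  · intro hf x hx
    rw [← hC] at hx
    obtain ⟨y, hy, rfl⟩ := hx
    rw [hc _ y, hf y hy]
  · intro hf x hx
    rw [hc _ (E x), hf _ (hC ▸ mem_image_of_mem E hx)]

/-- A homotopy equivalence of connected spaces restricting to a homeomorphism from `B` to `C`
preserves the relative Euler characteristic. -/
theorem cohomologicalEulerChar_eq_of_homotopyEquiv (hC : E '' B = C) (hr : ContinuousOn r C)
    (hrE : ∀ x ∈ B, r (E x) = x)
    (hext : ∀ v : X → ℝ, ContinuousOn v C → ∃ w : C(X, ℝ), EqOn w v C) :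
    cohomologicalEulerChar B = cohomologicalEulerChar C := by
  let Φ : circleFunctions C →ₗ[ℤ] circleFunctions B :=
    { toFun := fun f => ⟨f.1.comp E.toFun, fun x hx => f.2 _ (hC ▸ mem_image_of_mem E hx)⟩
      map_add' := fun f g => rfl
      map_smul' := fun c f => rfl }
  have hker : LinearMap.ker ((liftableFunctions B).mkQ ∘ₗ Φ) = liftableFunctions C := by
    ext f
    rw [LinearMap.mem_ker, LinearMap.comp_apply, Submodule.mkQ_apply, Submodule.Quotient.mk_eq_zero]
    constructor
    · intro h
      exact hasLift_of_comp_rel E hC h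
    · rintro ⟨h, hh, hf⟩
      exact ⟨h.comp E.toFun, fun x hx => hh _ (hC ▸ mem_image_of_mem E hx), fun x => hf _⟩
  have hsurj : Function.Surjective ((liftableFunctions B).mkQ ∘ₗ Φ) := by
    intro q
    obtain ⟨f, rfl⟩ := Submodule.mkQ_surjective _ q
    obtain ⟨f', h1, h2⟩ := exists_comp_hasLift_rel E r hC hr hrE hext f.2
    refine ⟨⟨f', h1⟩, ?_⟩
    symm
    rw [LinearMap.comp_apply, ← sub_eq_zero, ← map_sub, Submodule.mkQ_apply,
      Submodule.Quotient.mk_eq_zero]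
    exact h2
  have h := (LinearMap.quotKerEquivOfSurjective _ hsurj).finrank_eq
  rw [hker] at h
  rw [cohomologicalEulerChar, cohomologicalEulerChar, intFunctions_eq E hC, h]

end Invariance

/-! ### Extension of real functions from a subgraph -/

section GraphExtension

variable {X : Type u} [TopologicalSpace X] [CWComplex (univ : Set X)]

/-- Linear interpolation over the edges outside `S`. The values of `v` at vertices outside `S` may
be arbitrary, since functions on edges only have to match at their endpoints. -/
theorem exists_extension (hX : IsGraph X) {S : Set (GCell X)} (hS : FaceClosed S) (v : X → ℝ)
    (hv : ContinuousOn v (cellOf ⁻¹' S)) : ∃ w : C(X, ℝ), EqOn w v (cellOf ⁻¹' S) := by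
  classical
  obtain ⟨w, hw1, hw2⟩ := exists_glue hX v
    (fun e s => if (⟨1, e⟩ : GCell X) ∈ S then v (edgePath e s) else
      v (edgePath e (-1)) + (v (edgePath e 1) - v (edgePath e (-1))) * ((s + 1) / 2))
    (fun e => by
      by_cases he : (⟨1, e⟩ : GCell X) ∈ S
      · simp only [he, if_true]
        exact hv.comp (continuousOn_edgePath e) fun s hs => edgePath_mem_faceClosed hS he hs
      · simp only [he, if_false]
        fun_prop)
    (fun e => by simp) (fun e => by
      split_ifs
      · rfl
      · ring)
  refine ⟨w, fun x hx => ?_⟩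
  refine forall_of_cells hX (p := fun x => cellOf x ∈ S → w x = v x) (fun x hx h => hw1 x hx)
    (fun e s hs h => ?_) x hx
  rw [cellOf_edgePath e hs] at h
  rw [hw2 e s (Ioo_subset_Icc_self hs), if_pos h]

end GraphExtension

/-! ### Partially defined injections with finitely many orbits -/

section Orbits

variable {I : Type u}

/-- The iterates `γ^i c`, `i < m`, stay in `L`, and `γ^m c = d`. -/
def Chain (γ : I → I) (L : Set I) (c : I) (m : ℕ) (d : I) : Prop :=
  (∀ i < m, γ^[i] c ∈ L) ∧ γ^[m] c = d

/-- A face relation, and a map `γ` injective on a cofinite set `L` of cells, preserving the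
face relation, with finitely many orbits. -/
structure IsCellShift (F : I → I → Prop) (γ : I → I) (L D : Set I) : Prop where
  finite_cofaces : ∀ c, {d | F c d}.Finite
  finite_faces : ∀ d, {c | F c d}.Finite
  finite_compl : Lᶜ.Finite
  injOn : InjOn γ L
  mem_of_face : ∀ {c d}, F c d → d ∈ L → c ∈ L
  map_face : ∀ {c d}, F c d → d ∈ L → F (γ c) (γ d)
  exists_face : ∀ {c d}, d ∈ L → F c (γ d) → ∃ b, F b d ∧ γ b = c
  finite_orbits : D.Finite
  orbit_face : ∀ {c d}, F c d → d ∈ D → c ∈ D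
  exists_orbit : ∀ c, ∃ d ∈ D, ∃ m, Chain γ L d m c ∨ Chain γ L c m d

variable {F : I → I → Prop} {γ : I → I} {L D : Set I}

/-- The forward orbit of `c` stays in `L`, and is infinite. -/
def ForwardInfinite (γ : I → I) (L : Set I) (c : I) : Prop :=
  (∀ i, γ^[i] c ∈ L) ∧ Function.Injective fun i => γ^[i] c

/-- `b` is an infinite backward orbit in `L`. -/
def BackwardInfinite (γ : I → I) (L : Set I) (b : ℕ → I) : Prop :=
  (∀ n, b (n + 1) ∈ L ∧ γ (b (n + 1)) = b n) ∧ Function.Injective b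

/-- The points of the infinite forward orbits after time `n`. -/
def forwardTail (γ : I → I) (L D : Set I) (n : ℕ) : Set I :=
  {c | ∃ d ∈ D, ForwardInfinite γ L d ∧ ∃ m ≥ n, γ^[m] d = c}

/-- The points of the infinite backward orbits before time `-n`. -/
def backwardTail (γ : I → I) (L D : Set I) (n : ℕ) : Set I :=
  {c | ∃ b, BackwardInfinite γ L b ∧ b 0 ∈ D ∧ ∃ m ≥ n, b m = c}

theorem forwardTail_antitone : Antitone (forwardTail γ L D) :=
  fun _ _ h _ ⟨d, hd, hf, m, hm, e⟩ => ⟨d, hd, hf, m, h.trans hm, e⟩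

theorem backwardTail_antitone : Antitone (backwardTail γ L D) :=
  fun _ _ h _ ⟨d, hd, hf, m, hm, e⟩ => ⟨d, hd, hf, m, h.trans hm, e⟩

theorem forwardTail_subset (n : ℕ) : forwardTail γ L D n ⊆ L := by
  rintro _ ⟨d, -, hf, m, -, rfl⟩
  exact hf.1 m

theorem image_forwardTail (n : ℕ) : γ '' forwardTail γ L D n = forwardTail γ L D (n + 1) := by
  ext c
  constructor
  · rintro ⟨_, ⟨d, hd, hf, m, hm, rfl⟩, rfl⟩
    exact ⟨d, hd, hf, m + 1, by omega, Function.iterate_succ_apply' _ _ _⟩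
  · rintro ⟨d, hd, hf, m, hm, rfl⟩
    obtain ⟨m, rfl⟩ : ∃ k, m = k + 1 := ⟨m - 1, by omega⟩
    exact ⟨_, ⟨d, hd, hf, m, by omega, rfl⟩, (Function.iterate_succ_apply' _ _ _).symm⟩

theorem backwardTail_succ_subset (n : ℕ) : backwardTail γ L D (n + 1) ⊆ L := by
  rintro _ ⟨b, hb, -, m, hm, rfl⟩
  obtain ⟨m, rfl⟩ : ∃ k, m = k + 1 := ⟨m - 1, by omega⟩
  exact (hb.1 m).1

theorem image_backwardTail (n : ℕ) : γ '' backwardTail γ L D (n + 1) = backwardTail γ L D n := by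
  ext c
  constructor
  · rintro ⟨_, ⟨b, hb, h0, m, hm, rfl⟩, rfl⟩
    obtain ⟨m, rfl⟩ : ∃ k, m = k + 1 := ⟨m - 1, by omega⟩
    exact ⟨b, hb, h0, m, by omega, (hb.1 m).2.symm⟩
  · rintro ⟨b, hb, h0, m, hm, rfl⟩
    exact ⟨_, ⟨b, hb, h0, m + 1, by omega, rfl⟩, (hb.1 m).2⟩

namespace IsCellShift

variable (h : IsCellShift F γ L D)
include h

theorem preimage_backwardTail (n : ℕ) :
    {c ∈ L | γ c ∈ backwardTail γ L D n} = backwardTail γ L D (n + 1) := by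
  ext c
  constructor
  · rintro ⟨hc, b, hb, h0, m, hm, e⟩
    refine ⟨b, hb, h0, m + 1, by omega, h.injOn (hb.1 m).1 hc ?_⟩
    rw [← e, (hb.1 m).2]
  · intro hc
    exact ⟨backwardTail_succ_subset n hc, image_backwardTail (γ := γ) n ▸ mem_image_of_mem γ hc⟩

theorem backward_unique {b b' : ℕ → I} (hb : BackwardInfinite γ L b)
    (hb' : BackwardInfinite γ L b') (h0 : b 0 = b' 0) (n : ℕ) : b n = b' n := by
  induction n with
  | zero => exact h0
  | succ n ih => exact h.injOn (hb.1 n).1 (hb'.1 n).1 (by rw [(hb.1 n).2, (hb'.1 n).2, ih])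

/-- Each infinite forward orbit passes through `c` at most once, and there are finitely many
starting points, so the passage times are bounded. -/
theorem exists_notMem_forwardTail (c : I) : ∃ n, c ∉ forwardTail γ L D n := by
  have hfin : {m | ∃ d ∈ D, ForwardInfinite γ L d ∧ γ^[m] d = c}.Finite := by
    refine (h.finite_orbits.biUnion fun d _ =>
      (show {m | ForwardInfinite γ L d ∧ γ^[m] d = c}.Finite from ?_)).subset ?_
    · refine Set.Subsingleton.finite ?_
      rintro i ⟨hd, hi⟩ j ⟨-, hj⟩
      exact hd.2 (hi.trans hj.symm)
    · rintro m ⟨d, hd, hm⟩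
      exact mem_biUnion hd hm
  obtain ⟨n, hn⟩ := hfin.bddAbove
  refine ⟨n + 1, ?_⟩
  rintro ⟨d, hd, hf, m, hm, e⟩
  have : m ≤ n := hn ⟨d, hd, hf, e⟩
  omega

theorem exists_notMem_backwardTail (c : I) : ∃ n, c ∉ backwardTail γ L D n := by
  have hfin : {m | ∃ d ∈ D, ∃ b, BackwardInfinite γ L b ∧ b 0 = d ∧ b m = c}.Finite := by
    refine (h.finite_orbits.biUnion fun d _ =>
      (show {m | ∃ b, BackwardInfinite γ L b ∧ b 0 = d ∧ b m = c}.Finite from ?_)).subset ?_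
    · refine Set.Subsingleton.finite ?_
      rintro i ⟨b, hb, h0, hi⟩ j ⟨b', hb', h0', hj⟩
      rw [← h.backward_unique hb hb' (h0.trans h0'.symm)] at hj
      exact hb.2 (hi.trans hj.symm)
    · rintro m ⟨d, hd, hm⟩
      exact mem_biUnion hd hm
  obtain ⟨n, hn⟩ := hfin.bddAbove
  refine ⟨n + 1, ?_⟩
  rintro ⟨b, hb, hd, m, hm, e⟩
  have : m ≤ n := hn ⟨_, hd, b, hb, rfl, e⟩
  omega

omit h in
theorem exists_disjoint_of_antitone {T : Set I} (hT : T.Finite) {S : ℕ → Set I} (hS : Antitone S)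
    (hc : ∀ c, ∃ n, c ∉ S n) : ∃ n, Disjoint (S n) T := by
  choose f hf using hc
  obtain ⟨n, hn⟩ := (hT.image f).bddAbove
  refine ⟨n, Set.disjoint_left.2 fun c hc hcT => hf c (hS (hn (mem_image_of_mem f hcT)) hc)⟩

/-- A repetition in `e` would recur infinitely often by `hper`, making one cell a face of infinitely
many different `b n`, against local finiteness. -/
theorem injective_of_face {b e : ℕ → I} (hb : Function.Injective b) (he : ∀ n, F (e n) (b n))
    (hper : ∀ i j, e i = e j → i ≠ j → ∃ f : ℕ → ℕ, Function.Injective f ∧ ∀ k, e (f k) = e i) :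
    Function.Injective e := by
  intro i j hij
  by_contra hne
  obtain ⟨f, hf, hfe⟩ := hper i j hij hne
  refine (h.finite_cofaces (e i)).not_infinite
    ((infinite_range_of_injective (hb.comp hf)).mono ?_)
  rintro _ ⟨k, rfl⟩
  exact hfe k ▸ he (f k)

theorem forwardInfinite_of_face {c d : I} (hcd : F c d) (hd : ForwardInfinite γ L d) :
    ForwardInfinite γ L c := by
  have hF : ∀ i, F (γ^[i] c) (γ^[i] d) := by
    intro i
    induction i with
    | zero => exact hcd
    | succ i ih =>
      rw [Function.iterate_succ_apply', Function.iterate_succ_apply']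
      exact h.map_face ih (hd.1 i)
  refine ⟨fun i => h.mem_of_face (hF i) (hd.1 i), h.injective_of_face hd.2 hF ?_⟩
  -- A repetition makes the orbit periodic from time `i` on, with period `p = j - i`.
  have : ∀ i j, γ^[i] c = γ^[j] c → i < j →
      ∃ f : ℕ → ℕ, Function.Injective f ∧ ∀ k, γ^[f k] c = γ^[i] c := by
    intro i j hij hlt
    obtain ⟨p, rfl⟩ : ∃ p, j = i + p := ⟨j - i, by omega⟩
    have hp : 0 < p := by omega
    refine ⟨fun k => i + k * p, fun k l hkl => ?_, fun k => ?_⟩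
    · have : k * p = l * p := by simpa using hkl
      exact Nat.eq_of_mul_eq_mul_right hp this
    · induction k with
      | zero => simp
      | succ k ih =>
        have e : i + (k + 1) * p = k * p + (i + p) := by ring
        change γ^[i + (k + 1) * p] c = _
        rw [e, Function.iterate_add_apply, ← hij, ← Function.iterate_add_apply, add_comm]
        exact ih
  intro i j hij hne
  rcases hne.lt_or_gt with hlt | hlt
  · exact this i j hij hlt
  · obtain ⟨f, hf, hfe⟩ := this j i hij.symm hlt
    exact ⟨f, hf, fun k => (hfe k).trans hij.symm⟩

/-- A face of `γ^m d` comes from a face of `d` by lifting one step at a time. That face lies in `D`,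
which is closed under faces, and its orbit is again infinite. -/
theorem face_forwardTail {n : ℕ} {c d : I} (hcd : F c d) (hd : d ∈ forwardTail γ L D n) :
    c ∈ forwardTail γ L D n := by
  obtain ⟨d, hdD, hf, m, hm, rfl⟩ := hd
  have : ∀ m, ∀ c, F c (γ^[m] d) → ∃ b, F b d ∧ γ^[m] b = c := by
    intro m
    induction m with
    | zero => exact fun c hc => ⟨c, hc, rfl⟩
    | succ m ih =>
      intro c hc
      rw [Function.iterate_succ_apply'] at hc
      obtain ⟨b', hb', rfl⟩ := h.exists_face (hf.1 m) hc
      obtain ⟨b, hb, rfl⟩ := ih b' hb'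
      exact ⟨b, hb, Function.iterate_succ_apply' _ _ _⟩
  obtain ⟨b, hb, rfl⟩ := this m c hcd
  exact ⟨b, h.orbit_face hb hdD, h.forwardInfinite_of_face hb hf, m, hm, rfl⟩

omit h in
theorem backward_shift (hinj : InjOn γ L) {e : ℕ → I}
    (he : ∀ n, e (n + 1) ∈ L ∧ γ (e (n + 1)) = e n) {i j : ℕ} (hij : e i = e j) (k : ℕ) :
    e (i + k) = e (j + k) := by
  induction k with
  | zero => exact hij
  | succ k ih =>
    exact hinj (he (i + k)).1 (he (j + k)).1 ((he (i + k)).2.trans (ih.trans (he (j + k)).2.symm))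

omit h in
theorem backward_periodic (hinj : InjOn γ L) {e : ℕ → I}
    (he : ∀ n, e (n + 1) ∈ L ∧ γ (e (n + 1)) = e n) {i p : ℕ} (hij : e i = e (i + p)) (k : ℕ) :
    e (i + k * p) = e i := by
  induction k with
  | zero => simp
  | succ k ih =>
    rw [← ih, add_mul, one_mul, show i + (k * p + p) = (i + p) + k * p by ring]
    exact (backward_shift hinj he hij _).symm

theorem backwardInfinite_of_face {b e : ℕ → I} (hb : BackwardInfinite γ L b)
    (he : ∀ n, e (n + 1) ∈ L ∧ γ (e (n + 1)) = e n) (hF : ∀ n, F (e n) (b n)) :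
    BackwardInfinite γ L e := by
  refine ⟨he, h.injective_of_face hb.2 hF ?_⟩
  have : ∀ i j, e i = e j → i < j →
      ∃ f : ℕ → ℕ, Function.Injective f ∧ ∀ k, e (f k) = e i := by
    intro i j hij hlt
    obtain ⟨p, rfl⟩ : ∃ p, j = i + p := ⟨j - i, by omega⟩
    have hp : 0 < p := by omega
    refine ⟨fun k => i + k * p, fun k l hkl => ?_, backward_periodic h.injOn he hij⟩
    have : k * p = l * p := by simpa using hkl
    exact Nat.eq_of_mul_eq_mul_right hp this
  intro i j hij hne
  rcases hne.lt_or_gt with hlt | hlt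
  · exact this i j hij hlt
  · obtain ⟨f, hf, hfe⟩ := this j i hij.symm hlt
    exact ⟨f, hf, fun k => (hfe k).trans hij.symm⟩

/-- A face `c` of `b m` is pushed forward to a face of `b 0`, which lies in `D`. From there a
backward orbit of faces of the `b n` is chosen, and injectivity of `γ` on `L` forces it to pass
through `c` at index `m`. -/
theorem face_backwardTail {n : ℕ} {c d : I} (hcd : F c d) (hd : d ∈ backwardTail γ L D n) :
    c ∈ backwardTail γ L D n := by
  obtain ⟨b, hb, hbD, m, hm, rfl⟩ := hd
  have hpre : ∀ n (a : {a // F a (b n)}), ∃ a' : {a // F a (b (n + 1))}, γ a'.1 = a.1 := by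
    rintro n ⟨a, ha⟩
    rw [← (hb.1 n).2] at ha
    obtain ⟨a', ha', e⟩ := h.exists_face (hb.1 n).1 ha
    exact ⟨⟨a', ha'⟩, e⟩
  choose pre hpre using hpre
  have hfw : ∀ i ≤ m, F (γ^[i] c) (b (m - i)) := by
    intro i
    induction i with
    | zero => exact fun _ => hcd
    | succ i ih =>
      intro hi
      have h1 := (hb.1 (m - (i + 1)))
      rw [show m - (i + 1) + 1 = m - i by omega] at h1
      rw [Function.iterate_succ_apply', ← h1.2]
      exact h.map_face (ih (by omega)) h1.1
  have hfL : ∀ i < m, γ^[i] c ∈ L := by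
    intro i hi
    have h1 := (hb.1 (m - (i + 1)))
    rw [show m - (i + 1) + 1 = m - i by omega] at h1
    exact h.mem_of_face (hfw i hi.le) h1.1
  let e : ∀ n, {a // F a (b n)} := fun n => Nat.rec
    (⟨γ^[m] c, by simpa using hfw m le_rfl⟩) (fun n a => pre n a) n
  have he : ∀ n, (e (n + 1)).1 ∈ L ∧ γ (e (n + 1)).1 = (e n).1 := fun n =>
    ⟨h.mem_of_face (e (n + 1)).2 (hb.1 n).1, hpre n (e n)⟩
  have hinf := h.backwardInfinite_of_face (e := fun n => (e n).1) hb he fun n => (e n).2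
  -- For the first `m` steps the chosen preimages retrace the forward orbit of `c`.
  have hc : ∀ j ≤ m, (e j).1 = γ^[m - j] c := by
    intro j
    induction j with
    | zero => exact fun _ => rfl
    | succ j ih =>
      intro hj
      refine h.injOn (he j).1 (hfL _ (by omega)) ?_
      rw [(he j).2, ih (by omega), ← Function.iterate_succ_apply' γ,
        show (m - (j + 1)).succ = m - j by omega]
  refine ⟨fun n => (e n).1, hinf, h.orbit_face (e 0).2 hbD, m, hm, ?_⟩
  simpa using hc m le_rfl

omit h in
-- Either the orbit leaves `L`, which bounds the length of a chain, or it repeats itself and takes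
-- only finitely many values.
theorem finite_forward_chains {d : I} (hd : ¬ ForwardInfinite γ L d) :
    {c | ∃ m, Chain γ L d m c}.Finite := by
  simp only [ForwardInfinite, not_and_or, not_forall] at hd
  rcases hd with ⟨i, hi⟩ | hd
  · refine ((finite_le_nat i).image fun m => γ^[m] d).subset ?_
    rintro c ⟨m, hm, rfl⟩
    refine ⟨m, ?_, rfl⟩
    by_contra hmi
    exact hi (hm i (by simpa using hmi))
  · simp only [Function.Injective, not_forall] at hd
    obtain ⟨i, j, hij, hne⟩ := hd
    wlog hlt : i < j generalizing i j
    · exact this j i hij.symm (Ne.symm hne) (by omega)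
    have key : ∀ m, ∃ k ≤ j, γ^[k] d = γ^[m] d := by
      intro m
      induction m with
      | zero => exact ⟨0, Nat.zero_le _, rfl⟩
      | succ m ih =>
        obtain ⟨k, hk, e⟩ := ih
        rcases hk.lt_or_eq with hk | rfl
        · exact ⟨k + 1, hk, by rw [Function.iterate_succ_apply', e, Function.iterate_succ_apply']⟩
        · refine ⟨i + 1, hlt, ?_⟩
          rw [Function.iterate_succ_apply', Function.iterate_succ_apply', ← e]
          exact congrArg γ hij
    refine ((finite_le_nat j).image fun m => γ^[m] d).subset ?_
    rintro c ⟨m, -, rfl⟩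
    obtain ⟨k, hk, e⟩ := key m
    exact ⟨k, hk, e⟩

theorem chain_unique {m : ℕ} {c c' d : I} (hc : Chain γ L c m d) (hc' : Chain γ L c' m d) :
    c = c' := by
  induction m generalizing c c' with
  | zero => exact hc.2.trans hc'.2.symm
  | succ m ih =>
    have step : ∀ c, Chain γ L c (m + 1) d → Chain γ L (γ c) m d := fun c hc =>
      ⟨fun i hi => by simpa using hc.1 (i + 1) (by omega), by simpa using hc.2⟩
    exact h.injOn (hc.1 0 (by omega)) (hc'.1 0 (by omega)) (ih (step c hc) (step c' hc'))

/-- There is at most one chain of each length ending at `d`. If the lengths are bounded, finiteness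
is clear. Otherwise the starting points form a backward orbit, which either is injective, and then
lies in the backward tail, or is periodic. -/
theorem finite_backward_chains {d : I} (hd : d ∈ D) :
    ({c | ∃ m, Chain γ L c m d} \ backwardTail γ L D 0).Finite := by
  have step : ∀ m c, Chain γ L c (m + 1) d → Chain γ L (γ c) m d := fun m c hc =>
    ⟨fun i hi => by simpa using hc.1 (i + 1) (by omega), by simpa using hc.2⟩
  by_cases hall : ∀ m, ∃ c, Chain γ L c m d
  · choose b hb using hall
    have hbs : ∀ n, b (n + 1) ∈ L ∧ γ (b (n + 1)) = b n := fun n =>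
      ⟨(hb (n + 1)).1 0 (by omega), h.chain_unique (step n _ (hb (n + 1))) (hb n)⟩
    by_cases hinj : Function.Injective b
    · convert Set.finite_empty
      rw [sdiff_eq_empty]
      rintro c ⟨m, hm⟩
      refine ⟨b, ⟨hbs, hinj⟩, ?_, m, Nat.zero_le _, h.chain_unique (hb m) hm⟩
      rw [show b 0 = d from (hb 0).2]
      exact hd
    · simp only [Function.Injective, not_forall] at hinj
      obtain ⟨i, j, hij, hne⟩ := hinj
      wlog hlt : i < j generalizing i j
      · exact this j i hij.symm (Ne.symm hne) (by omega)
      have key : ∀ m, ∃ k ≤ j, b k = b m := by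
        intro m
        induction m with
        | zero => exact ⟨0, Nat.zero_le _, rfl⟩
        | succ m ih =>
          obtain ⟨k, hk, e⟩ := ih
          have e' := backward_shift h.injOn hbs e 1
          rcases hk.lt_or_eq with hk | rfl
          · exact ⟨k + 1, hk, e'⟩
          · exact ⟨i + 1, hlt, (backward_shift h.injOn hbs hij 1).trans e'⟩
      refine ((finite_le_nat j).image b).subset ?_
      rintro c ⟨⟨m, hm⟩, -⟩
      obtain ⟨k, hk, e⟩ := key m
      exact ⟨k, hk, e.trans (h.chain_unique (hb m) hm)⟩
  · push Not at hall
    obtain ⟨n, hn⟩ := hall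
    have hlt : ∀ m c, Chain γ L c m d → m < n := by
      intro m c hc
      by_contra hle
      obtain ⟨k, rfl⟩ : ∃ k, m = n + k := ⟨m - n, by omega⟩
      clear hle
      induction k generalizing c with
      | zero => exact hn c hc
      | succ k ih => exact ih _ (step _ _ hc)
    refine ((Set.finite_lt_nat n).biUnion fun m _ =>
      (show {c | Chain γ L c m d}.Finite from Set.Subsingleton.finite
        fun c hc c' hc' => h.chain_unique hc hc')).subset ?_
    rintro c ⟨⟨m, hm⟩, -⟩
    exact mem_biUnion (show m ∈ {m | m < n} from hlt m c hm) hm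

theorem finite_forwardTail_diff (n : ℕ) :
    (forwardTail γ L D n \ forwardTail γ L D (n + 1)).Finite := by
  refine (h.finite_orbits.image fun d => γ^[n] d).subset ?_
  rintro c ⟨⟨d, hd, hf, m, hm, rfl⟩, hc⟩
  obtain rfl : m = n := by
    by_contra hne
    exact hc ⟨d, hd, hf, m, by omega, rfl⟩
  exact ⟨d, hd, rfl⟩

theorem finite_backwardTail_diff (n : ℕ) :
    (backwardTail γ L D n \ backwardTail γ L D (n + 1)).Finite := by
  refine (h.finite_orbits.biUnion fun d _ =>
    (show {c | ∃ b, BackwardInfinite γ L b ∧ b 0 = d ∧ b n = c}.Finite from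
      Set.Subsingleton.finite ?_)).subset ?_
  · rintro c ⟨b, hb, h0, rfl⟩ c' ⟨b', hb', h0', rfl⟩
    exact h.backward_unique hb hb' (h0.trans h0'.symm) n
  · rintro c ⟨⟨b, hb, hd, m, hm, rfl⟩, hc⟩
    obtain rfl : m = n := by
      by_contra hne
      exact hc ⟨b, hb, hd, m, by omega, rfl⟩
    exact mem_biUnion hd ⟨b, hb, rfl, rfl⟩

omit h in
theorem finite_diff_of_steps {S : ℕ → Set I} (hS : ∀ n, (S n \ S (n + 1)).Finite) (n : ℕ) :
    (S 0 \ S n).Finite := by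
  induction n with
  | zero => simp
  | succ n ih =>
    refine (ih.union (hS n)).subset fun c hc => ?_
    by_cases hn : c ∈ S n
    · exact .inr ⟨hn, hc.2⟩
    · exact .inl ⟨hc.1, hn⟩

/-- Every point is joined to the finite set `D` by a chain. The chains not belonging to infinite
orbits contribute finitely many points, and so do the initial pieces of the infinite orbits cut off
by `m` and `n`. -/
theorem finite_compl_tails (m n : ℕ) :
    (forwardTail γ L D m ∪ backwardTail γ L D n)ᶜ.Finite := by
  have h0 : (forwardTail γ L D 0 ∪ backwardTail γ L D 0)ᶜ.Finite := by
    refine ((h.finite_orbits.biUnion (t := fun d =>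
      {c | (∃ m, Chain γ L d m c) ∧ ¬ ForwardInfinite γ L d} ∪
        ({c | ∃ m, Chain γ L c m d} \ backwardTail γ L D 0)) fun d hd => ?_)).subset ?_
    · refine Finite.union ?_ (h.finite_backward_chains hd)
      by_cases hf : ForwardInfinite γ L d
      · simp [hf]
      · simpa [hf] using finite_forward_chains hf
    · intro c hc
      simp only [mem_compl_iff, mem_union, not_or] at hc
      obtain ⟨d, hd, m, hm⟩ := h.exists_orbit c
      refine mem_biUnion hd ?_
      rcases hm with hm | hm
      · exact .inl ⟨⟨m, hm⟩, fun hf => hc.1 ⟨d, hd, hf, m, Nat.zero_le _, hm.2⟩⟩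
      · exact .inr ⟨⟨m, hm⟩, hc.2⟩
  refine ((h0.union (finite_diff_of_steps h.finite_forwardTail_diff m)).union
    (finite_diff_of_steps h.finite_backwardTail_diff n)).subset ?_
  intro c hc
  simp only [mem_compl_iff, mem_union, not_or, Set.mem_sdiff] at hc ⊢
  tauto

/-- From a common point `b k = γ^m d`, moving forward `k` more steps reaches `b 0 ∈ D` along a
forward orbit. This is impossible once the forward tail has moved past `D`. -/
theorem exists_disjoint_tails : ∃ n, Disjoint (forwardTail γ L D n) (backwardTail γ L D 0) := by
  obtain ⟨n, hn⟩ := exists_disjoint_of_antitone h.finite_orbits forwardTail_antitone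
    h.exists_notMem_forwardTail
  refine ⟨n, Set.disjoint_left.2 ?_⟩
  rintro _ ⟨d, hd, hf, m, hm, rfl⟩ ⟨b, hb, hbD, k, -, hk⟩
  have hbk : ∀ k, γ^[k] (b k) = b 0 := by
    intro k
    induction k with
    | zero => rfl
    | succ k ih => rw [Function.iterate_succ_apply, (hb.1 k).2, ih]
  refine Set.disjoint_left.1 hn ⟨d, hd, hf, k + m, by omega, ?_⟩ hbD
  rw [Function.iterate_add_apply, ← hk, hbk]

end IsCellShift

/-- Disjoint forward and backward tails, closed under faces and with finite complement,
near which `γ` is a bijection. -/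
structure IsTailPair (F : I → I → Prop) (γ : I → I) (L : Set I) (A B : ℕ → Set I) : Prop where
  subset : ∀ n, A n ⊆ L
  image : ∀ n, γ '' A n = A (n + 1)
  antitone : Antitone A
  exists_notMem : ∀ c, ∃ n, c ∉ A n
  face : ∀ {n c d}, F c d → d ∈ A n → c ∈ A n
  coface_mem : ∀ {c d}, c ∈ A 0 → F c d → d ∈ L
  exists_coface : ∀ {c d}, c ∈ A 0 → F (γ c) d → ∃ e ∈ L, F c e ∧ γ e = d
  image_neg : ∀ n, γ '' B (n + 1) = B n
  preimage_neg : ∀ n, {c ∈ L | γ c ∈ B n} = B (n + 1)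
  antitone_neg : Antitone B
  exists_notMem_neg : ∀ c, ∃ n, c ∉ B n
  face_neg : ∀ {n c d}, F c d → d ∈ B n → c ∈ B n
  coface_mem_neg : ∀ {c d}, c ∈ B 0 → F c d → d ∈ L
  exists_coface_neg : ∀ {c d}, c ∈ B 1 → F (γ c) d → ∃ e ∈ L, F c e ∧ γ e = d
  disjoint : Disjoint (A 0) (B 0)
  finite_compl : (A 1 ∪ B 1)ᶜ.Finite

/-- The face `γ c` lifts to a face of `e` with the same image, which is `c` by injectivity. -/
theorem IsCellShift.exists_coface_of_mem (h : IsCellShift F γ L D) {c e : I} (hc : c ∈ L)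
    (he : e ∈ L) (hF : F (γ c) (γ e)) : F c e := by
  obtain ⟨b, hb, hbc⟩ := h.exists_face he hF
  rwa [← h.injOn (h.mem_of_face hb he) hc hbc]

theorem IsCellShift.exists_isTailPair (h : IsCellShift F γ L D) {T : Set I} (hT : T.Finite) :
    ∃ A B : ℕ → Set I, IsTailPair F γ L A B ∧ Disjoint (A 0) T ∧ Disjoint (B 0) T := by
  obtain ⟨n₀, h0⟩ := h.exists_disjoint_tails
  obtain ⟨n₁, h1⟩ := IsCellShift.exists_disjoint_of_antitone
    (hT.union ((h.finite_compl_tails 1 0).biUnion fun d _ => h.finite_faces d))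
    forwardTail_antitone h.exists_notMem_forwardTail
  obtain ⟨n₂, h2⟩ := IsCellShift.exists_disjoint_of_antitone
    (hT.union ((h.finite_compl_tails n₀ 1).biUnion fun d _ => h.finite_faces d))
    backwardTail_antitone h.exists_notMem_backwardTail
  -- Far out, a coface of a tail cell lies in the same tail: `n₀` keeps it out of the other tail,
  -- and `n₁` keeps it out of the finite complement. Index `1` rather than `0` makes the coface an
  -- image under `γ`.
  have hA : ∀ {c d}, c ∈ forwardTail γ L D (n₀ + n₁) → F c d → d ∈ forwardTail γ L D 1 := by
    intro c d hc hF
    by_contra hd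
    have hd' : d ∉ backwardTail γ L D 0 := fun hd' => Set.disjoint_left.1 h0
      (forwardTail_antitone (by omega) hc) (h.face_backwardTail hF hd')
    exact Set.disjoint_left.1 h1 (forwardTail_antitone (by omega) hc)
      (.inr (mem_biUnion (show d ∈ (_ ∪ _)ᶜ by simp [hd, hd']) hF))
  -- Here index `1` ensures membership in `L`, since the starting points `b 0` of backward orbits
  -- may lie outside `L`.
  have hB : ∀ {c d}, c ∈ backwardTail γ L D n₂ → F c d → d ∈ backwardTail γ L D 1 := by
    intro c d hc hF
    by_contra hd
    have hd' : d ∉ forwardTail γ L D n₀ := fun hd' => Set.disjoint_left.1 h0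
      (h.face_forwardTail hF hd') (backwardTail_antitone (by omega) hc)
    exact Set.disjoint_left.1 h2 hc
      (.inr (mem_biUnion (show d ∈ (_ ∪ _)ᶜ by simp [hd, hd']) hF))
  refine ⟨fun n => forwardTail γ L D (n₀ + n₁ + n), fun n => backwardTail γ L D (n₂ + n),
    ?_, ?_, ?_⟩
  · exact {
      subset := fun n => forwardTail_subset _
      image := fun n => image_forwardTail _
      antitone := fun m n hmn => forwardTail_antitone (by omega)
      exists_notMem := fun c => (h.exists_notMem_forwardTail c).imp
        fun n hn hc => hn (forwardTail_antitone (by omega) hc)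
      face := fun hF hd => h.face_forwardTail hF hd
      coface_mem := fun hc hF => forwardTail_subset _ (hA hc hF)
      exists_coface := by
        intro c d hc hF
        have hγ : γ c ∈ forwardTail γ L D (n₀ + n₁) := forwardTail_antitone (Nat.le_succ _)
          (image_forwardTail (γ := γ) _ ▸ mem_image_of_mem γ hc)
        have hd := hA hγ hF
        rw [← image_forwardTail 0] at hd
        obtain ⟨e, he, rfl⟩ := hd
        exact ⟨e, forwardTail_subset _ he, h.exists_coface_of_mem (forwardTail_subset _ hc)
          (forwardTail_subset _ he) hF, rfl⟩
      image_neg := fun n => image_backwardTail _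
      preimage_neg := fun n => h.preimage_backwardTail _
      antitone_neg := fun m n hmn => backwardTail_antitone (by omega)
      exists_notMem_neg := fun c => (h.exists_notMem_backwardTail c).imp
        fun n hn hc => hn (backwardTail_antitone (by omega) hc)
      face_neg := fun hF hd => h.face_backwardTail hF hd
      coface_mem_neg := fun hc hF => backwardTail_succ_subset 0 (hB hc hF)
      exists_coface_neg := by
        intro c d hc hF
        have hγ : γ c ∈ backwardTail γ L D n₂ :=
          image_backwardTail (γ := γ) (L := L) (D := D) n₂ ▸ mem_image_of_mem γ hc
        have hd := hB hγ hF
        rw [← image_backwardTail 1] at hd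
        obtain ⟨e, he, rfl⟩ := hd
        exact ⟨e, backwardTail_succ_subset _ he,
          h.exists_coface_of_mem (backwardTail_succ_subset _ hc)
          (backwardTail_succ_subset _ he) hF, rfl⟩
      disjoint := h0.mono (forwardTail_antitone (by omega)) (backwardTail_antitone (by omega))
      finite_compl := h.finite_compl_tails _ _ }
  · exact (disjoint_union_right.1 h1).1.mono_left (forwardTail_antitone (by omega))
  · exact (disjoint_union_right.1 h2).1

end Orbits

/-! ### Ends of a connected graph -/

theorem IsBasisOf.exists_notMem {X : Type u} [TopologicalSpace X] {E : Ends X} {W : ℕ → Set X}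
    (hW : IsBasisOf W E) (x : X) :
    ∃ n, x ∉ W n := by
  obtain ⟨⟨-, K, -, -, hK, hWK⟩, -⟩ := hW
  have hx : x ∈ ⋃ n, interior (K n) := hK ▸ mem_univ x
  obtain ⟨n, hn⟩ := mem_iUnion.1 hx
  obtain ⟨y, -, hy⟩ := hWK n
  refine ⟨n, fun hxn => ?_⟩
  rw [hy] at hxn
  exact connectedComponentIn_subset _ _ hxn (interior_subset hn)

section GraphEnds

variable {X : Type u} [TopologicalSpace X] [CWComplex (univ : Set X)]

theorem isPreconnected_oc (c : GCell X) : IsPreconnected (oc c) :=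
  (convex_ball (0 : Fin c.1 → ℝ) 1).isPreconnected.image _
    ((RelCWComplex.continuousOn (C := (univ : Set X)) c.1 c.2).mono Metric.ball_subset_closedBall)

theorem isPreconnected_cc (c : GCell X) : IsPreconnected (cc c) :=
  (convex_closedBall (0 : Fin c.1 → ℝ) 1).isPreconnected.image _
    (RelCWComplex.continuousOn (C := (univ : Set X)) c.1 c.2)

theorem isClosed_biUnion_cc (hX : IsGraph X) (S : Set (GCell X)) : IsClosed (⋃ c ∈ S, cc c) := by
  rw [biUnion_eq_iUnion]
  exact ((locallyFinite_cc hX).comp_injective Subtype.val_injective).isClosed_iUnion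
    fun c => isClosed_cc hX c

theorem isCompact_biUnion_cc {S : Set (GCell X)} (hS : S.Finite) : IsCompact (⋃ c ∈ S, cc c) :=
  hS.isCompact_biUnion fun c _ => isCompact_cc c

theorem faceClosed_cellOf_image (hX : IsGraph X) (S : Set (GCell X)) :
    ∃ T : Set (GCell X), FaceClosed T ∧ ⋃ c ∈ S, cc c = (cellOf ⁻¹' T : Set X) := by
  refine ⟨{c | ∃ d ∈ S, Face c d}, fun b c hbc ⟨d, hd, h⟩ => ⟨d, hd, hbc.trans hX h⟩, ?_⟩
  ext x
  simp only [mem_iUnion, exists_prop, mem_preimage, mem_ofPred_eq, mem_cc_iff hX]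

/-- The cells meeting a given set. -/
def cellsMeeting (K : Set X) : Set (GCell X) := {c | (cc c ∩ K).Nonempty}

/-- The union of the closed cells meeting a given set. -/
def cellNhd (K : Set X) : Set X := ⋃ c ∈ cellsMeeting K, cc c

theorem isCompact_cellNhd (hX : IsGraph X) {K : Set X} (hK : IsCompact K) :
    IsCompact (cellNhd K) :=
  isCompact_biUnion_cc (finite_cc_inter hX hK)

theorem subset_interior_cellNhd (hX : IsGraph X) (K : Set X) : K ⊆ interior (cellNhd K) := by
  have hop := (isClosed_biUnion_cc hX (cellsMeeting K)ᶜ).isOpen_compl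
  refine fun x hx => mem_interior.2 ⟨_, fun y hy => ?_, hop, ?_⟩
  · by_contra hyK
    refine hy (mem_biUnion (x := cellOf y) (fun hm => hyK ?_) (mem_cc_cellOf y))
    exact mem_biUnion hm (mem_cc_cellOf y)
  · simp only [mem_compl_iff, mem_iUnion, exists_prop, not_exists, not_and]
    exact fun c hc hxc => hc ⟨x, hxc, hx⟩

theorem subset_cellNhd (hX : IsGraph X) (K : Set X) : K ⊆ cellNhd K :=
  (subset_interior_cellNhd hX K).trans interior_subset

/-- Every component of the complement of a nonempty finite subgraph meets the cells adjacent to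
this subgraph. -/
theorem component_meets_cellNhd (hX : IsGraph X) [ConnectedSpace X] {K : Set X}
    (hne : K.Nonempty) {x : X} (hx : x ∈ Kᶜ) :
    (connectedComponentIn Kᶜ x ∩ cellNhd K).Nonempty := by
  by_contra hemp
  rw [not_nonempty_iff_eq_empty] at hemp
  set C := connectedComponentIn Kᶜ x with hC
  -- If `C` avoided the cells adjacent to `K`, every closed cell meeting `C` would miss `K` and so
  -- lie in `C`. Then `C` and its complement would both be unions of closed cells, and `C` would be
  -- clopen.
  have hsub : ∀ c : GCell X, (cc c ∩ C).Nonempty → cc c ⊆ C := by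
    rintro c ⟨y, hyc, hyC⟩
    have hcK : cc c ⊆ Kᶜ := by
      intro z hz hzK
      have : y ∈ C ∩ cellNhd K := ⟨hyC, mem_biUnion (show c ∈ cellsMeeting K from ⟨z, hz, hzK⟩) hyc⟩
      rw [hemp] at this
      exact this
    rw [hC, connectedComponentIn_eq hyC]
    exact (isPreconnected_cc c).subset_connectedComponentIn hyc hcK
  have h1 : IsClosed C := by
    convert isClosed_biUnion_cc hX {c | (cc c ∩ C).Nonempty} using 1
    refine Subset.antisymm (fun y hy => mem_biUnion (x := cellOf y) ⟨y, mem_cc_cellOf y, hy⟩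
      (mem_cc_cellOf y)) (iUnion₂_subset hsub)
  have h2 : IsClosed Cᶜ := by
    convert isClosed_biUnion_cc hX {c | ¬ (cc c ∩ C).Nonempty} using 1
    refine Subset.antisymm (fun y hy => mem_biUnion (x := cellOf y)
      (fun hn => hy (hsub _ hn (mem_cc_cellOf y))) (mem_cc_cellOf y))
      (iUnion₂_subset fun c hc y hy hyC => hc ⟨y, hy, hyC⟩)
  have huniv : C = univ := IsClopen.eq_univ ⟨h1, isClosed_compl_iff.1 h2⟩
    ⟨x, mem_connectedComponentIn hx⟩
  obtain ⟨k, hk⟩ := hne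
  have : k ∈ C := huniv ▸ mem_univ k
  exact connectedComponentIn_subset _ _ this hk

/-- The complement of a nonempty finite subgraph has finitely many components. -/
theorem finite_components (hX : IsGraph X) [ConnectedSpace X] {S : Set (GCell X)}
    (hS : S.Finite) (hne : S.Nonempty) :
    {C | ∃ x ∈ (⋃ c ∈ S, cc c)ᶜ, C = connectedComponentIn (⋃ c ∈ S, cc c)ᶜ x}.Finite := by
  obtain ⟨T, hT, hST⟩ := faceClosed_cellOf_image hX S
  have hK : IsCompact (⋃ c ∈ S, cc c) := isCompact_biUnion_cc hS
  have hKne : (⋃ c ∈ S, cc c).Nonempty := by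
    obtain ⟨c, hc⟩ := hne
    obtain ⟨x, hx⟩ := oc_nonempty c
    exact ⟨x, mem_biUnion hc (oc_subset_cc c hx)⟩
  rw [hST] at hK hKne ⊢
  choose pt hpt using fun c : GCell X => exists_cellOf_eq c
  -- A component is determined by any open cell inside it, and each component contains one of the
  -- finitely many cells whose interiors meet the compact neighbourhood of `K`.
  refine ((finite_cellOf_image hX (isCompact_cellNhd hX hK)).image
    fun c => connectedComponentIn (cellOf ⁻¹' T : Set X)ᶜ (pt c)).subset ?_
  rintro _ ⟨x, hx, rfl⟩
  obtain ⟨y, hyC, hy⟩ := component_meets_cellNhd hX hKne hx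
  refine ⟨cellOf y, mem_image_of_mem _ hy, ?_⟩
  have hyT : cellOf y ∉ T := connectedComponentIn_subset _ _ hyC
  rw [connectedComponentIn_eq hyC]
  refine connectedComponentIn_eq ?_
  refine (isPreconnected_oc (cellOf y)).subset_connectedComponentIn ?_ ?_ (mem_oc_cellOf y)
  · rw [mem_oc_iff, hpt]
  · intro z hz
    rw [mem_oc_iff] at hz
    rw [mem_compl_iff, mem_preimage, hz]
    exact hyT

/-- A set meeting infinitely many cells of a connected graph accumulates at some end. -/
theorem exists_isEndBasis_meeting (hX : IsGraph X) [ConnectedSpace X] {S : Set X}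
    (hS : (cellOf '' S).Infinite) : ∃ U, IsEndBasis U ∧ ∀ n, (U n ∩ S).Nonempty := by
  obtain ⟨x₀⟩ := (inferInstance : Nonempty X)
  let A : ℕ → Set (GCell X) := fun n => Nat.rec {cellOf x₀} (fun _ T => cellsMeeting (⋃ c ∈ T, cc c)) n
  let K : ℕ → Set X := fun n => ⋃ c ∈ A n, cc c
  have hKs : ∀ n, K (n + 1) = cellNhd (K n) := fun n => rfl
  have hAfin : ∀ n, (A n).Finite := by
    intro n
    induction n with
    | zero => exact finite_singleton _
    | succ n ih => exact finite_cc_inter hX (isCompact_biUnion_cc ih)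
  have hKc : ∀ n, IsCompact (K n) := fun n => isCompact_biUnion_cc (hAfin n)
  have hKmono : Monotone K := monotone_nat_of_le_succ fun n => subset_cellNhd hX _
  have hAmono : ∀ n, A n ⊆ A (n + 1) := by
    intro n c hc
    obtain ⟨y, hy⟩ := oc_nonempty c
    exact ⟨y, oc_subset_cc c hy, mem_biUnion hc (oc_subset_cc c hy)⟩
  have hx₀ : ∀ n, x₀ ∈ K n := fun n => hKmono (Nat.zero_le n)
    (mem_biUnion (mem_singleton _) (mem_cc_cellOf x₀))
  have hAne : ∀ n, (A n).Nonempty := by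
    intro n
    have := hx₀ n
    simp only [K, mem_iUnion, exists_prop] at this
    exact this.imp fun c hc => hc.1
  -- The union of the iterated cell neighbourhoods is open, and closed as a union of closed cells,
  -- so connectedness makes it everything.
  have hKint : ⋃ n, interior (K n) = univ := by
    have heq : ⋃ n, interior (K n) = ⋃ n, K n := by
      refine Subset.antisymm (iUnion_mono fun n => interior_subset) (iUnion_subset fun n => ?_)
      exact (subset_interior_cellNhd hX (K n)).trans (subset_iUnion (fun n => interior (K n)) (n + 1))
    refine IsClopen.eq_univ ⟨?_, isOpen_iUnion fun n => isOpen_interior⟩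
      ⟨x₀, heq ▸ mem_iUnion.2 ⟨0, hx₀ 0⟩⟩
    rw [heq]
    convert isClosed_biUnion_cc hX (⋃ n, A n) using 1
    simp only [K, mem_iUnion, iUnion_exists]
    exact iUnion_comm _
  -- Pigeonhole: finitely many components and one compact set cannot each meet `T` in finitely many
  -- cells.
  have key : ∀ (n : ℕ) (T : Set X), (cellOf '' T).Infinite →
      ∃ x ∈ (K n)ᶜ, (cellOf '' (T ∩ connectedComponentIn (K n)ᶜ x)).Infinite := by
    intro n T hT
    by_contra! hall
    refine hT (((finite_cellOf_image hX (hKc n)).union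
      ((finite_components hX (hAfin n) (hAne n)).biUnion (t := fun C => cellOf '' (T ∩ C)) ?_)).subset ?_)
    · rintro _ ⟨x, hx, rfl⟩
      exact hall x hx
    · rintro _ ⟨x, hx, rfl⟩
      by_cases hxK : x ∈ K n
      · exact .inl (mem_image_of_mem _ hxK)
      · refine .inr (mem_biUnion (x := connectedComponentIn (K n)ᶜ x) ⟨x, hxK, rfl⟩ ?_)
        exact mem_image_of_mem _ ⟨hx, mem_connectedComponentIn hxK⟩
  choose! f hfK hf using key
  let V : ℕ → Set X := fun n => Nat.rec (S ∩ connectedComponentIn (K 0)ᶜ (f 0 S))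
    (fun n T => T ∩ connectedComponentIn (K (n + 1))ᶜ (f (n + 1) T)) n
  -- `P n` is the part of `S` surviving before stage `n`, so that `P 0 = S` and `P (n + 1) = V n`.
  let P : ℕ → Set X := fun n => Nat.rec S (fun n _ => V n) n
  have hVP : ∀ n, V n = P n ∩ connectedComponentIn (K n)ᶜ (f n (P n)) := by
    rintro (_ | n) <;> rfl
  have hPinf : ∀ n, (cellOf '' P n).Infinite := by
    intro n
    induction n with
    | zero => exact hS
    | succ n ih =>
      change (cellOf '' V n).Infinite
      rw [hVP]
      exact hf n _ ih
  have hVne : ∀ n, (V n).Nonempty := fun n => (hPinf (n + 1)).nonempty.of_image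
  refine ⟨fun n => connectedComponentIn (K n)ᶜ (f n (P n)), ⟨antitone_nat_of_succ_le fun n => ?_,
    K, hKmono, hKc, hKint, fun n => ⟨_, hfK n _ (hPinf n), rfl⟩⟩, fun n => ?_⟩
  · obtain ⟨y, hy⟩ := hVne (n + 1)
    rw [hVP (n + 1)] at hy
    have hy1 : y ∈ V n := hy.1
    rw [hVP n] at hy1
    change connectedComponentIn (K (n + 1))ᶜ (f (n + 1) (P (n + 1))) ⊆
      connectedComponentIn (K n)ᶜ (f n (P n))
    rw [connectedComponentIn_eq hy1.2]
    exact isPreconnected_connectedComponentIn.subset_connectedComponentIn hy.2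
      ((connectedComponentIn_subset _ _).trans (compl_subset_compl.2 (hKmono (Nat.le_succ n))))
  · have hPS : P n ⊆ S := by
      induction n with
      | zero => exact Subset.rfl
      | succ n ih =>
        change V n ⊆ S
        rw [hVP]
        exact inter_subset_left.trans ih
    obtain ⟨y, hy⟩ := hVne n
    rw [hVP] at hy
    exact ⟨y, hy.2, hPS hy.1⟩

/-- Otherwise the complement would accumulate at some end, but the neighbourhood of that end
contains a term of each of its bases. -/
theorem finite_cells_compl_endNhds (hX : IsGraph X) [ConnectedSpace X] {U : Ends X → Set X}
    (hU : ∀ E, IsEndNhd E (U E)) : (cellOf '' (⋃ E, U E)ᶜ).Finite := by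
  by_contra hinf
  obtain ⟨V, hV, hVS⟩ := exists_isEndBasis_meeting hX hinf
  obtain ⟨n, hn⟩ := (hU (Quotient.mk _ ⟨V, hV⟩)).2.1 V ⟨hV, rfl⟩
  obtain ⟨x, hxV, hx⟩ := hVS n
  exact hx (mem_iUnion.2 ⟨_, hn n le_rfl hxV⟩)

/-- The difference cannot accumulate at `E`, because `W n` contains a term of every basis of `E`,
nor at another end, because `A` meets only finitely many terms of its bases. -/
theorem finite_cells_endNhd_diff (hX : IsGraph X) [ConnectedSpace X] {E : Ends X} {A : Set X}
    (hA : IsEndNhd E A) {W : ℕ → Set X} (hW : IsBasisOf W E) (n : ℕ) :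
    (cellOf '' (A \ W n)).Finite := by
  by_contra hinf
  obtain ⟨V, hV, hVS⟩ := exists_isEndBasis_meeting hX hinf
  by_cases hE : (Quotient.mk (endSetoid X) ⟨V, hV⟩ : Ends X) = E
  · obtain ⟨hWb, rfl⟩ := hW
    obtain ⟨⟨j, hj⟩, -⟩ := Quotient.exact hE n
    obtain ⟨x, hxV, hx⟩ := hVS j
    exact hx.2 (hj hxV)
  · refine infinite_univ ((hA.2.2 _ hE V ⟨hV, rfl⟩).subset fun m _ => ?_)
    obtain ⟨x, hxV, hx⟩ := hVS m
    exact ⟨x, hxV, hx.1⟩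

end GraphEnds

/-! ### The action of an end-periodic map on cells -/

section CellAction

variable {X : Type u} [TopologicalSpace X] [CWComplex (univ : Set X)]

/-- A continuous self-map of a graph that maps the cells in `L` to cells by an injective map `γ`
with finitely many orbits, and embeds the union of these cells. -/
structure ActsOnCells (g : X → X) (γ : GCell X → GCell X) (L D : Set (GCell X)) : Prop
    extends IsCellShift Face γ L D where
  continuous : Continuous g
  image_oc : ∀ {c}, c ∈ L → g '' oc c = oc (γ c)
  isEmbedding : IsEmbedding ((cellOf ⁻¹' L : Set X).domRestrict g)

theorem exists_cell_image (hX : IsGraph X) {g : X → X} (hg : IsGraphMap g) {L : Set (GCell X)}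
    (hedge : ∀ e, (⟨1, e⟩ : GCell X) ∈ L → ∃ e', g '' openEdge e = openEdge e') {c : GCell X}
    (hc : c ∈ L) : ∃ c', g '' oc c = oc c' := by
  obtain ⟨n, c⟩ := c
  rcases GCell.dim_cases hX ⟨n, c⟩ with rfl | rfl
  · have hv : RelCWComplex.map (C := (univ : Set X)) 0 c ![] ∈ vertices X := by
      rw [mem_vertices_iff, cellOf_vertex]
    have := mem_vertices_iff.1 (hg.mapsTo_vertices hv)
    have h2 := mem_oc_cellOf (g (RelCWComplex.map (C := (univ : Set X)) 0 c ![]))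
    generalize cellOf (g (RelCWComplex.map (C := (univ : Set X)) 0 c ![])) = d at this h2
    obtain ⟨m, d⟩ := d
    obtain rfl : m = 0 := this
    refine ⟨⟨0, d⟩, ?_⟩
    rw [oc_zero, image_singleton, oc_zero]
    rw [oc_zero] at h2
    rw [mem_singleton_iff.1 h2]
  · obtain ⟨e', he'⟩ := hedge c hc
    exact ⟨⟨1, e'⟩, he'⟩

theorem cellOf_map {g : X → X} {γ : GCell X → GCell X} {L : Set (GCell X)}
    (hγ : ∀ {c}, c ∈ L → g '' oc c = oc (γ c)) {x : X} (hx : cellOf x ∈ L) :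
    cellOf (g x) = γ (cellOf x) :=
  mem_oc_iff.1 (hγ hx ▸ mem_image_of_mem g (mem_oc_cellOf x))

theorem image_cc (hX : IsGraph X) {g : X → X} (hg : Continuous g) {γ : GCell X → GCell X}
    {L : Set (GCell X)} (hγ : ∀ {c}, c ∈ L → g '' oc c = oc (γ c)) {c : GCell X} (hc : c ∈ L) :
    g '' cc c = cc (γ c) := by
  have := hX.t2
  rw [← closure_oc hX c, ← closure_oc hX (γ c), ← hγ hc]
  refine Subset.antisymm (image_closure_subset_closure_image hg) ?_
  refine closure_minimal (image_mono subset_closure) ?_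
  rw [closure_oc hX]
  exact ((isCompact_cc c).image hg).isClosed

/-- The chain is restarted whenever the orbit leaves `L`, since the next cell is then in `D`. -/
theorem forward_chain {g : X → X} {γ : GCell X → GCell X} {L D : Set (GCell X)}
    (hγ : ∀ {c}, c ∈ L → g '' oc c = oc (γ c)) (hD : ∀ x, cellOf x ∉ L → cellOf (g x) ∈ D) {y : X}
    (hy : cellOf y ∈ D) (m : ℕ) : ∃ d ∈ D, ∃ k, Chain γ L d k (cellOf (g^[m] y)) := by
  induction m with
  | zero => exact ⟨_, hy, 0, by simp, rfl⟩
  | succ m ih =>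
    rw [Function.iterate_succ_apply']
    by_cases hL : cellOf (g^[m] y) ∈ L
    · obtain ⟨d, hd, k, hk1, hk2⟩ := ih
      refine ⟨d, hd, k + 1, fun i hi => ?_, ?_⟩
      · rcases (Nat.lt_succ_iff.1 hi).lt_or_eq with h | rfl
        · exact hk1 i h
        · rwa [hk2]
      · rw [Function.iterate_succ_apply', hk2, cellOf_map hγ hL]
    · exact ⟨_, hD _ hL, 0, by simp, rfl⟩

/-- The chain stops at the first cell outside `L`, which is in `D`, or else after `m` steps. -/
theorem backward_chain {g : X → X} {γ : GCell X → GCell X} {L D : Set (GCell X)}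
    (hγ : ∀ {c}, c ∈ L → g '' oc c = oc (γ c)) (hD : Lᶜ ⊆ D) (m : ℕ) {x : X}
    (hx : cellOf (g^[m] x) ∈ D) : ∃ d ∈ D, ∃ k, Chain γ L (cellOf x) k d := by
  induction m generalizing x with
  | zero => exact ⟨_, hx, 0, by simp, rfl⟩
  | succ m ih =>
    by_cases hL : cellOf x ∈ L
    · obtain ⟨d, hd, k, hk1, hk2⟩ := ih (x := g x) (by rwa [← Function.iterate_succ_apply])
      rw [cellOf_map hγ hL] at hk1 hk2
      refine ⟨d, hd, k + 1, fun i hi => ?_, by rwa [Function.iterate_succ_apply]⟩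
      rcases i with _ | i
      · exact hL
      · rw [Function.iterate_succ_apply]
        exact hk1 i (by omega)
    · exact ⟨_, hD hL, 0, by simp, rfl⟩

/-- The set `L` consists of the closed cells inside the end neighbourhoods. A point of `U E` is
related by a power of `g^p` to the difference `U E \ W E 1`, which meets finitely many cells, and
this relation is translated into chains of cells. -/
theorem IsEndPeriodic.exists_actsOnCells (hX : IsGraph X) [ConnectedSpace X] [Finite (Ends X)]
    {g : X → X} (hg : IsEndPeriodic g) : ∃ γ L D, ActsOnCells g γ L D := by
  classical
  obtain ⟨U, hU, hemb, hedge, p, -, hp⟩ := hg.exists_nesting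
  set L : Set (GCell X) := {c | cc c ⊆ ⋃ E, U E} with hLdef
  have hLF : FaceClosed L := fun c d hcd hd => (hcd.cc_subset hX).trans hd
  have hsub : largestSubgraph (⋃ E, U E) = cellOf ⁻¹' L := by
    rw [hLF.preimage_eq hX]
    rfl
  rw [hsub] at hemb hedge
  have hex : ∀ c, c ∈ L → ∃ c', g '' oc c = oc c' := fun c hc =>
    exists_cell_image hX hg.toIsGraphMap (fun e he => hedge e fun x hx => by
      rw [mem_preimage, mem_oc_iff.1 (show x ∈ oc ⟨1, e⟩ from hx)]
      exact he) hc
  choose! γ hγ using hex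
  have hLfin : Lᶜ.Finite := by
    refine ((finite_cells_compl_endNhds hX hU).biUnion fun c _ => finite_cofaces hX c).subset ?_
    intro d hd
    obtain ⟨x, hx, hxU⟩ := not_subset.1 hd
    exact mem_biUnion (mem_image_of_mem _ hxU) ((mem_cc_iff hX).1 hx)
  have hginj : InjOn g (cellOf ⁻¹' L) := injOn_iff_injective.2 hemb.injective
  choose W hW0 hWb hWs using fun E => show ∃ W : ℕ → Set X, W 0 = U E ∧ IsBasisOf W E ∧
      ((∀ n, W n = g^[p * n] '' U E) ∨ ∀ n, W n = g^[p * n] ⁻¹' U E) by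
    rcases hp E with h | h
    · exact ⟨_, by simp, h.2, .inl fun n => rfl⟩
    · exact ⟨_, by simp, h.2, .inr fun n => rfl⟩
  -- The first two pieces catch the orbits that leave `L`, the third contains a fundamental domain
  -- near each end. Adding all faces afterwards makes `D` closed under faces.
  let D₀ : Set (GCell X) := Lᶜ ∪ cellOf '' (g '' ⋃ c ∈ Lᶜ, cc c) ∪ ⋃ E, cellOf '' (U E \ W E 1)
  have hD₀ : D₀.Finite := by
    refine (hLfin.union (finite_cellOf_image hX ((isCompact_biUnion_cc hLfin).image hg.continuous))).union
      (finite_iUnion fun E => finite_cells_endNhd_diff hX (hU E) (hWb E) 1)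
  let D : Set (GCell X) := ⋃ d ∈ D₀, {c | Face c d}
  have hD₀D : D₀ ⊆ D := fun d hd => mem_biUnion hd (Face.refl d)
  have hDg : ∀ x, cellOf x ∉ L → cellOf (g x) ∈ D := fun x hx => hD₀D <| .inl <| .inr <|
    mem_image_of_mem _ <| mem_image_of_mem _ <| mem_biUnion (show cellOf x ∈ Lᶜ from hx)
      (mem_cc_cellOf x)
  have hDL : Lᶜ ⊆ D := fun c hc => hD₀D (.inl (.inl hc))
  refine ⟨γ, L, D, ?_⟩
  exact {
    finite_cofaces := finite_cofaces hX
    finite_faces := finite_faces hX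
    finite_compl := hLfin
    injOn := by
      intro c hc d hd hcd
      obtain ⟨x, hx⟩ := oc_nonempty c
      have : g x ∈ g '' oc d := by
        rw [hγ d hd, ← hcd, ← hγ c hc]
        exact mem_image_of_mem g hx
      obtain ⟨y, hy, hyx⟩ := this
      rw [mem_oc_iff] at hx hy
      have := hginj (show cellOf y ∈ L from hy ▸ hd) (show cellOf x ∈ L from hx ▸ hc) hyx
      rw [← hx, ← hy, this]
    mem_of_face := fun h hd => hLF h hd
    map_face := by
      rintro c d ⟨x, hx, hxd⟩ hd
      refine ⟨g x, ?_, ?_⟩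
      · rw [← hγ c (hLF ⟨x, hx, hxd⟩ hd)]
        exact mem_image_of_mem g hx
      · rw [← image_cc hX hg.continuous (fun hc => hγ _ hc) hd]
        exact mem_image_of_mem g hxd
    exists_face := by
      rintro c d hd ⟨x, hx, hxd⟩
      rw [← image_cc hX hg.continuous (fun hc => hγ _ hc) hd] at hxd
      obtain ⟨y, hy, rfl⟩ := hxd
      have hF := (mem_cc_iff hX).1 hy
      refine ⟨cellOf y, hF, ?_⟩
      rw [← cellOf_map (fun hc => hγ _ hc) (hLF hF hd), mem_oc_iff.1 hx]
    finite_orbits := hD₀.biUnion fun d _ => finite_faces hX d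
    orbit_face := by
      intro c d hcd hd
      obtain ⟨e, he, hde⟩ := mem_iUnion₂.1 hd
      exact mem_biUnion he (hcd.trans hX hde)
    exists_orbit := by
      intro c
      by_cases hc : c ∈ L
      swap
      · exact ⟨c, hDL hc, 0, .inl ⟨by simp, rfl⟩⟩
      obtain ⟨x, rfl⟩ := exists_cellOf_eq c
      obtain ⟨E, hE⟩ := mem_iUnion.1 (hc (mem_cc_cellOf x))
      -- At this exit index, `x` is the image under `g^[p * n]` of a point of `U E \ W E 1` in the
      -- attracting case, and is mapped into `U E \ W E 1` by `g^[p * n]` in the repelling case.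
      have hfind : ∃ n, x ∈ W E n ∧ x ∉ W E (n + 1) := by
        by_contra! hall
        obtain ⟨n, hn⟩ := (hWb E).exists_notMem x
        refine hn ?_
        clear hn
        induction n with
        | zero => rwa [hW0]
        | succ n ih => exact hall n ih
      obtain ⟨n, hn, hn'⟩ := hfind
      rcases hWs E with h | h
      · rw [h] at hn hn'
        obtain ⟨y, hy, rfl⟩ := hn
        have hyD : cellOf y ∈ D := hD₀D (.inr (mem_iUnion.2 ⟨E, mem_image_of_mem _ ⟨hy, ?_⟩⟩))
        · obtain ⟨d, hd, k, hk⟩ := forward_chain (fun hc => hγ _ hc) hDg hyD (p * n)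
          exact ⟨d, hd, k, .inl hk⟩
        · rw [h]
          rintro ⟨z, hz, rfl⟩
          refine hn' ⟨z, hz, ?_⟩
          rw [← Function.iterate_add_apply]
          congr 2
          ring
      · rw [h] at hn hn'
        have hyD : cellOf (g^[p * n] x) ∈ D :=
          hD₀D (.inr (mem_iUnion.2 ⟨E, mem_image_of_mem _ ⟨hn, ?_⟩⟩))
        · obtain ⟨d, hd, k, hk⟩ := backward_chain (fun hc => hγ _ hc) hDL (p * n) hyD
          exact ⟨d, hd, k, .inr hk⟩
        · rw [h]
          intro hmem
          refine hn' ?_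
          rw [mem_preimage, ← Function.iterate_add_apply] at hmem
          rw [mem_preimage]
          convert hmem using 2
          ring
    continuous := hg.continuous
    image_oc := fun hc => hγ _ hc
    isEmbedding := hemb }

end CellAction

/-! ### Mapping torus -/

section Torus

variable {X : Type u} (g : X → X)

theorem MappingTorus.mk_one (x : X) : MappingTorus.mk g x 1 = MappingTorus.mk g (g x) 0 :=
  Quot.sound (TorusRel.glue x)

/-- The base point of the flow segment through a point of the mapping torus. -/
noncomputable def basePoint : MappingTorus g → X :=
  Quot.lift (fun q => g^[⌊(q.2 : ℝ)⌋₊] q.1) (by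
    rintro _ _ ⟨x⟩
    simp)

/-- The height of a point of the mapping torus above the base. -/
noncomputable def height : MappingTorus g → ℝ :=
  Quot.lift (fun q => Int.fract (q.2 : ℝ)) (by
    rintro _ _ ⟨x⟩
    simp)

theorem flowPoint_add_nat (x : X) (n : ℕ) {r : ℝ} (hr : 0 ≤ r) :
    flowPoint g x (r + n) = flowPoint g (g^[n] x) r := by
  induction n generalizing x r with
  | zero => simp
  | succ n ih =>
    rw [Nat.cast_succ, ← add_assoc, flowPoint_add_one g x (by positivity), ih _ hr,
      Function.iterate_succ_apply]

theorem flowPoint_of_lt_one (x : X) {r : ℝ} (h0 : 0 ≤ r) (h1 : r < 1) :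
    flowPoint g x r = MappingTorus.mk g x ⟨r, h0, h1.le⟩ := by
  have hf : ⌊r⌋₊ = 0 := Nat.floor_eq_zero.2 h1
  have hr : Int.fract r = r := Int.fract_eq_self.2 ⟨h0, h1⟩
  simp only [flowPoint, hf, hr, Function.iterate_zero, id_eq]

theorem flowPoint_zero (x : X) : flowPoint g x 0 = MappingTorus.mk g x 0 :=
  flowPoint_of_lt_one g x le_rfl zero_lt_one

theorem flowPoint_natCast (x : X) (n : ℕ) :
    flowPoint g x n = MappingTorus.mk g (g^[n] x) 0 := by
  have := flowPoint_add_nat g x n le_rfl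
  rwa [zero_add, flowPoint_zero] at this

theorem flow_mk (t : ℝ≥0) (x : X) (s : unitInterval) :
    flow g t (MappingTorus.mk g x s) = flowPoint g x (s + t) := rfl

theorem flow_flowPoint (t : ℝ≥0) (x : X) {r : ℝ} (hr : 0 ≤ r) :
    flow g t (flowPoint g x r) = flowPoint g x (r + t) := by
  lift r to ℝ≥0 using hr
  have h := flow_add g t r (MappingTorus.mk g x 0)
  rw [flow_mk, flow_mk] at h
  simp only [NNReal.coe_add, Set.Icc.coe_zero, zero_add] at h
  rw [← h, add_comm]

theorem flow_zero (z : MappingTorus g) : flow g 0 z = z := by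
  obtain ⟨⟨x, s⟩, rfl⟩ := Quot.exists_rep z
  change flowPoint g x (s + ((0 : ℝ≥0) : ℝ)) = MappingTorus.mk g x s
  rw [NNReal.coe_zero, add_zero]
  rcases s.2.2.lt_or_eq with h | h
  · exact flowPoint_of_lt_one g x s.2.1 h
  · rw [show s = 1 from Subtype.ext h, MappingTorus.mk_one]
    have := flowPoint_natCast g x 1
    simpa using this

theorem basePoint_flowPoint (x : X) (r : ℝ) : basePoint g (flowPoint g x r) = g^[⌊r⌋₊] x := by
  change g^[⌊Int.fract r⌋₊] (g^[⌊r⌋₊] x) = _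
  rw [Nat.floor_eq_zero.2 (Int.fract_lt_one r)]
  rfl

theorem height_flowPoint (x : X) (r : ℝ) : height g (flowPoint g x r) = Int.fract r :=
  Int.fract_fract r

theorem height_nonneg (z : MappingTorus g) : 0 ≤ height g z := by
  obtain ⟨⟨x, s⟩, rfl⟩ := Quot.exists_rep z
  exact Int.fract_nonneg _

theorem height_lt_one (z : MappingTorus g) : height g z < 1 := by
  obtain ⟨⟨x, s⟩, rfl⟩ := Quot.exists_rep z
  exact Int.fract_lt_one _

theorem eq_flowPoint (z : MappingTorus g) : z = flowPoint g (basePoint g z) (height g z) := by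
  have key : ∃ x r, z = flowPoint g x r := by
    obtain ⟨⟨x, s⟩, rfl⟩ := Quot.exists_rep z
    refine ⟨x, s + (0 : ℝ≥0), ?_⟩
    rw [← flow_mk, flow_zero]
    rfl
  obtain ⟨x, r, rfl⟩ := key
  rw [basePoint_flowPoint, height_flowPoint,
    flowPoint_of_lt_one g _ (Int.fract_nonneg r) (Int.fract_lt_one r)]
  rfl

variable [TopologicalSpace X]

theorem MappingTorus.isOpen_iff {S : Set (MappingTorus g)} :
    IsOpen S ↔ IsOpen {q : X × unitInterval | MappingTorus.mk g q.1 q.2 ∈ S} := Iff.rfl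

theorem MappingTorus.continuous_mk :
    Continuous fun q : X × unitInterval => MappingTorus.mk g q.1 q.2 :=
  continuous_coinduced_rng

theorem exists_forall_notMem_of_monotone {T : ℕ → Set (MappingTorus g)} (hT : Monotone T)
    (hop : ∀ n, IsOpen (T n)) (hcov : ∀ z, ∃ n, z ∈ T n) {K : Set (MappingTorus g)}
    (hK : IsCompact K) : ∃ n, K ⊆ T n :=
  hK.elim_directed_cover T hop (fun z _ => mem_iUnion.2 (hcov z)) hT.directed_le

/-- A compact subset of the mapping torus misses the fibres over `C n`, for large `n`,
if `g` maps the complement of `C n` to the complement of `C (n + 1)`. -/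
theorem exists_notMem_compact_pos {C : ℕ → Set X} (hC : Antitone C) (hcl : ∀ n, IsClosed (C n))
    (hg : ∀ n, g ⁻¹' C (n + 1) = C n) (hex : ∀ x, ∃ n, x ∉ C n) {K : Set (MappingTorus g)}
    (hK : IsCompact K) : ∃ n, ∀ x ∈ C n, ∀ s, MappingTorus.mk g x s ∉ K := by
  -- Over `C n \ C (n + 1)` only the lower half of each fibre is taken. This respects the gluing,
  -- since `x ∉ C n` if and only if `g x ∉ C (n + 1)`, and keeps the set open.
  let T : ℕ → Set (MappingTorus g) := fun n => {z | Quot.lift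
    (fun q : X × unitInterval => q.1 ∉ C n ∨ q.1 ∉ C (n + 1) ∧ (q.2 : ℝ) < 1 / 2) (by
      rintro _ _ ⟨x⟩
      have h1 : g x ∈ C (n + 1) ↔ x ∈ C n := by rw [← hg n]; rfl
      have h2 : g x ∈ C (n + 1) → g x ∈ C n := fun h => hC (Nat.le_succ n) h
      have h3 : ¬ ((1 : unitInterval) : ℝ) < 1 / 2 := by norm_num
      have h4 : ((0 : unitInterval) : ℝ) < 1 / 2 := by norm_num
      simp only [eq_iff_iff, h3, h4, and_false, or_false, and_true]
      tauto) z}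
  have hTmk : ∀ n x s, MappingTorus.mk g x s ∈ T n ↔
      (x ∉ C n ∨ x ∉ C (n + 1) ∧ (s : ℝ) < 1 / 2) := fun n x s => Iff.rfl
  have hmono : Monotone T := by
    refine monotone_nat_of_le_succ fun n z hz => ?_
    obtain ⟨⟨x, s⟩, rfl⟩ := Quot.exists_rep z
    rcases (hTmk n x s).1 hz with h | h
    · exact (hTmk (n + 1) x s).2 (.inl fun h' => h (hC (Nat.le_succ n) h'))
    · exact (hTmk (n + 1) x s).2 (.inl h.1)
  have hop : ∀ n, IsOpen (T n) := by
    intro n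
    rw [MappingTorus.isOpen_iff]
    have h1 : IsOpen {q : X × unitInterval | q.1 ∉ C n} :=
      (hcl n).isOpen_compl.preimage continuous_fst
    have h2 : IsOpen {q : X × unitInterval | q.1 ∉ C (n + 1)} :=
      (hcl (n + 1)).isOpen_compl.preimage continuous_fst
    have h3 : IsOpen {q : X × unitInterval | (q.2 : ℝ) < 1 / 2} :=
      isOpen_lt (by fun_prop) continuous_const
    exact h1.union (h2.inter h3)
  have hcov : ∀ z, ∃ n, z ∈ T n := by
    intro z
    obtain ⟨⟨x, s⟩, rfl⟩ := Quot.exists_rep z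
    exact (hex x).imp fun n hn => (hTmk n x s).2 (.inl hn)
  obtain ⟨n, hn⟩ := exists_forall_notMem_of_monotone g hmono hop hcov hK
  refine ⟨n + 1, fun x hx s hs => ?_⟩
  rcases (hTmk n x s).1 (hn hs) with h | h
  · exact h (hC (Nat.le_succ n) hx)
  · exact h.1 hx

/-- A compact subset of the mapping torus misses the fibres over `C n`, for large `n`,
if the preimage of `C n` is `C (n + 1)`. -/
theorem exists_notMem_compact_neg {C : ℕ → Set X} (hC : Antitone C) (hcl : ∀ n, IsClosed (C n))
    (hg : ∀ n, g ⁻¹' C n = C (n + 1)) (hex : ∀ x, ∃ n, x ∉ C n) {K : Set (MappingTorus g)}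
    (hK : IsCompact K) : ∃ n, ∀ x ∈ C n, ∀ s, MappingTorus.mk g x s ∉ K := by
  -- Here the upper halves are taken over `C n \ C (n + 1)`, because now `g x ∉ C n` if and only if
  -- `x ∉ C (n + 1)`.
  let T : ℕ → Set (MappingTorus g) := fun n => {z | Quot.lift
    (fun q : X × unitInterval => q.1 ∉ C n ∨ q.1 ∉ C (n + 1) ∧ 1 / 2 < (q.2 : ℝ)) (by
      rintro _ _ ⟨x⟩
      have h1 : g x ∈ C n ↔ x ∈ C (n + 1) := by rw [← hg n]; rfl
      have h2 : x ∈ C (n + 1) → x ∈ C n := fun h => hC (Nat.le_succ n) h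
      have h3 : 1 / 2 < ((1 : unitInterval) : ℝ) := by norm_num
      have h4 : ¬ 1 / 2 < ((0 : unitInterval) : ℝ) := by norm_num
      simp only [eq_iff_iff, h3, h4, and_false, or_false, and_true]
      tauto) z}
  have hTmk : ∀ n x s, MappingTorus.mk g x s ∈ T n ↔
      (x ∉ C n ∨ x ∉ C (n + 1) ∧ 1 / 2 < (s : ℝ)) := fun n x s => Iff.rfl
  have hmono : Monotone T := by
    refine monotone_nat_of_le_succ fun n z hz => ?_
    obtain ⟨⟨x, s⟩, rfl⟩ := Quot.exists_rep z
    rcases (hTmk n x s).1 hz with h | h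
    · exact (hTmk (n + 1) x s).2 (.inl fun h' => h (hC (Nat.le_succ n) h'))
    · exact (hTmk (n + 1) x s).2 (.inl h.1)
  have hop : ∀ n, IsOpen (T n) := by
    intro n
    rw [MappingTorus.isOpen_iff]
    have h1 : IsOpen {q : X × unitInterval | q.1 ∉ C n} :=
      (hcl n).isOpen_compl.preimage continuous_fst
    have h2 : IsOpen {q : X × unitInterval | q.1 ∉ C (n + 1)} :=
      (hcl (n + 1)).isOpen_compl.preimage continuous_fst
    have h3 : IsOpen {q : X × unitInterval | 1 / 2 < (q.2 : ℝ)} :=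
      isOpen_lt continuous_const (by fun_prop)
    exact h1.union (h2.inter h3)
  have hcov : ∀ z, ∃ n, z ∈ T n := by
    intro z
    obtain ⟨⟨x, s⟩, rfl⟩ := Quot.exists_rep z
    exact (hex x).imp fun n hn => (hTmk n x s).2 (.inl hn)
  obtain ⟨n, hn⟩ := exists_forall_notMem_of_monotone g hmono hop hcov hK
  refine ⟨n + 1, fun x hx s hs => ?_⟩
  rcases (hTmk n x s).1 (hn hs) with h | h
  · exact h (hC (Nat.le_succ n) hx)
  · exact h.1 hx

theorem eventually_basePoint_notMem {ι : Type*} {l : Filter ι} {f : ι → MappingTorus g}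
    (hf : Tendsto f l (cocompact _)) {K : Set X} (hK : IsCompact K) :
    ∀ᶠ i in l, basePoint g (f i) ∉ K := by
  have hc : IsCompact ((fun q : X × unitInterval => MappingTorus.mk g q.1 q.2) '' K ×ˢ univ) :=
    (hK.prod isCompact_univ).image (MappingTorus.continuous_mk g)
  filter_upwards [hf.eventually hc.compl_mem_cocompact] with i hi hiK
  refine hi ⟨(basePoint g (f i), ⟨height g (f i), height_nonneg g _, (height_lt_one g _).le⟩),
    ⟨hiK, mem_univ _⟩, ?_⟩
  refine Eq.trans ?_ (eq_flowPoint g (f i)).symm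
  exact (flowPoint_of_lt_one g _ (height_nonneg g _) (height_lt_one g _)).symm

theorem tendsto_flow_of_forall {x : X} {s : unitInterval} {C : ℕ → Set X}
    (hC : ∀ K : Set (MappingTorus g), IsCompact K → ∃ n, ∀ x ∈ C n, ∀ s, MappingTorus.mk g x s ∉ K)
    (hx : ∀ n, ∀ᶠ m in atTop, g^[m] x ∈ C n) :
    Tendsto (fun t => flow g t (MappingTorus.mk g x s)) atTop (cocompact (MappingTorus g)) := by
  rw [(hasBasis_cocompact (X := MappingTorus g)).tendsto_right_iff]
  intro K hK
  obtain ⟨n, hn⟩ := hC K hK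
  have h1 : Tendsto (fun t : ℝ≥0 => ⌊(s : ℝ) + t⌋₊) atTop atTop :=
    tendsto_nat_floor_atTop.comp
      (tendsto_atTop_add_const_left _ _ (NNReal.tendsto_coe_atTop.2 tendsto_id))
  filter_upwards [h1.eventually (hx n)] with t ht
  exact hn _ ht _

end Torus

/-! ### Open sets of the compactified mapping torus -/

section OpenSets

variable {X : Type u} [TopologicalSpace X] (g : X → X)

/-- The union of an open set invariant under the flow and the forward endpoints of its points. -/
def posHull (O : Set (MappingTorus g)) : Set (CompactifiedTorus g) :=
  {w | (∃ z ∈ O, w = .inner z) ∨ ∃ z : ForwardRay g, z.1 ∈ O ∧ w = z.endpoint}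

theorem endpoint_mem_posHull {O : Set (MappingTorus g)}
    (hO : ∀ t z, flow g t z ∈ O ↔ z ∈ O) (z : ForwardRay g) :
    z.endpoint ∈ posHull g O ↔ z.1 ∈ O := by
  constructor
  · rintro (⟨_, _, h⟩ | ⟨w, hw, h⟩)
    · cases h
    · simp only [ForwardRay.endpoint, CompactifiedTorus.posPoint.injEq] at h
      obtain ⟨s, t, hst⟩ := Quotient.exact h
      rwa [← hO s, hst, hO]
  · exact fun h => .inr ⟨z, h, rfl⟩

theorem isOpen_posHull {O : Set (MappingTorus g)} (hop : IsOpen O)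
    (hO : ∀ t z, flow g t z ∈ O ↔ z ∈ O) : IsOpen (posHull g O) := by
  have hinner : ∀ z, (.inner z : CompactifiedTorus g) ∈ posHull g O ↔ z ∈ O := by
    intro z
    constructor
    · rintro (⟨w, hw, h⟩ | ⟨w, hw, h⟩)
      · cases h
        exact hw
      · cases h
    · exact fun h => .inl ⟨z, h, rfl⟩
  refine ⟨by simp only [hinner]; exact hop, fun z hz => Eventually.of_forall fun r => ?_, ?_⟩
  · rw [endpoint_mem_posHull g hO] at hz
    refine ⟨O, hop.mem_nhds ((hO r z.1).2 hz), 0, fun y hy s _ => ?_, fun y hy => ?_⟩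
    · exact (hinner _).2 ((hO s y).2 hy)
    · exact (endpoint_mem_posHull g hO y).2 hy
  · rintro β (⟨_, _, h⟩ | ⟨w, hw, h⟩) <;> cases h

/-- The union of an open set invariant under the backward flow and the backward endpoints of
its points. -/
def negHull (O : Set (MappingTorus g)) : Set (CompactifiedTorus g) :=
  {w | (∃ z ∈ O, w = .inner z) ∨ ∃ (β : BackwardRay g) (a : ℝ≥0), β.1 a ∈ O ∧ w = β.endpoint}

theorem backwardRay_mem {O : Set (MappingTorus g)} (hO : ∀ t z, flow g t z ∈ O → z ∈ O)
    (β : BackwardRay g) {a b : ℝ≥0} (hab : a ≤ b) (ha : β.1 a ∈ O) : β.1 b ∈ O := by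
  refine hO (b - a) _ ?_
  have := β.2.1 (b - a) a
  rw [add_tsub_cancel_of_le hab] at this
  rwa [this]

theorem endpoint_mem_negHull {O : Set (MappingTorus g)} (hO : ∀ t z, flow g t z ∈ O → z ∈ O)
    (β : BackwardRay g) : β.endpoint ∈ negHull g O ↔ ∃ a, β.1 a ∈ O := by
  constructor
  · rintro (⟨_, _, h⟩ | ⟨γ, a, ha, h⟩)
    · cases h
    · simp only [BackwardRay.endpoint, CompactifiedTorus.negPoint.injEq] at h
      obtain ⟨s, t, hst⟩ := Quotient.exact h
      refine ⟨a + s, ?_⟩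
      rw [hst a]
      exact backwardRay_mem g hO γ le_self_add ha
  · exact fun ⟨a, h⟩ => .inr ⟨β, a, h, rfl⟩

theorem isOpen_negHull {O : Set (MappingTorus g)} (hop : IsOpen O)
    (hO : ∀ t z, flow g t z ∈ O → z ∈ O) : IsOpen (negHull g O) := by
  have hinner : ∀ z, (.inner z : CompactifiedTorus g) ∈ negHull g O ↔ z ∈ O := by
    intro z
    constructor
    · rintro (⟨w, hw, h⟩ | ⟨w, a, hw, h⟩)
      · cases h
        exact hw
      · cases h
    · exact fun h => .inl ⟨z, h, rfl⟩
  refine ⟨by simp only [hinner]; exact hop, ?_, fun β hβ => ?_⟩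
  · rintro β (⟨_, _, h⟩ | ⟨w, _, hw, h⟩) <;> cases h
  · rw [endpoint_mem_negHull g hO] at hβ
    obtain ⟨a, ha⟩ := hβ
    filter_upwards [eventually_ge_atTop a] with r hr
    refine ⟨O, hop.mem_nhds (backwardRay_mem g hO β hr ha), 0, fun γ hγ => ⟨fun s _ => ?_, ?_⟩⟩
    · exact (hinner _).2 (backwardRay_mem g hO γ zero_le hγ)
    · exact (endpoint_mem_negHull g hO γ).2 ⟨0, hγ⟩

end OpenSets

/-! ### Separation of orbits -/

section Separation

variable {X : Type u} [TopologicalSpace X] [T2Space X]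

/-- Distinct orbits of an injective map that leaves compact sets have disjoint
saturated neighbourhoods. -/
theorem exists_disjoint_orbit_nhds {O : Set X} (hO : IsOpen O) {s : X → X} (hs : ContinuousOn s O)
    (hmap : MapsTo s O O) (hinj : InjOn s O)
    (hloc : ∀ y, ∃ V ∈ 𝓝 y, ∃ k₀, ∀ k ≥ k₀, Disjoint (s^[k] '' O) V) {x y : X} (hx : x ∈ O)
    (hy : y ∈ O) (hxy : ∀ m n, s^[m] x ≠ s^[n] y) :
    ∃ V W, IsOpen V ∧ IsOpen W ∧ x ∈ V ∧ y ∈ W ∧ V ⊆ O ∧ W ⊆ O ∧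
      ∀ m n, ∀ v ∈ V, ∀ w ∈ W, s^[m] v ≠ s^[n] w := by
  -- Iterates beyond `k₀` miss a neighbourhood of `y` altogether. The finitely many earlier ones are
  -- separated from `y` by continuity and the Hausdorff property.
  have one : ∀ x ∈ O, ∀ y, (∀ m, s^[m] x ≠ y) → ∃ V ∈ 𝓝 x, ∃ W ∈ 𝓝 y, ∀ m, ∀ v ∈ V ∩ O, ∀ w ∈ W,
      s^[m] v ≠ w := by
    intro x hx y hxy
    obtain ⟨W₀, hW₀, k₀, hk₀⟩ := hloc y
    have hk : ∀ k, ∃ V ∈ 𝓝 x, ∃ W ∈ 𝓝 y, ∀ v ∈ V, ∀ w ∈ W, s^[k] v ≠ w := by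
      intro k
      have hc : ContinuousAt s^[k] x := (hs.iterate hmap k).continuousAt (hO.mem_nhds hx)
      obtain ⟨P, Q, hP, hQ, hxP, hyQ, hPQ⟩ := t2_separation (hxy k)
      exact ⟨_, hc.preimage_mem_nhds (hP.mem_nhds hxP), Q, hQ.mem_nhds hyQ,
        fun v hv w hw h => Set.disjoint_left.1 hPQ hv (h ▸ hw)⟩
    choose V hV W hW hVW using hk
    refine ⟨⋂ k ∈ Finset.range k₀, V k, (Filter.biInter_finset_mem _).2 fun k _ => hV k,
      W₀ ∩ ⋂ k ∈ Finset.range k₀, W k,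
      inter_mem hW₀ ((Filter.biInter_finset_mem _).2 fun k _ => hW k), ?_⟩
    intro m v hv w hw hvw
    by_cases hm : m < k₀
    · exact hVW m v (mem_iInter₂.1 hv.1 m (Finset.mem_range.2 hm)) w
        (mem_iInter₂.1 hw.2 m (Finset.mem_range.2 hm)) hvw
    · exact Set.disjoint_left.1 (hk₀ m (not_lt.1 hm)) (mem_image_of_mem _ hv.2) (hvw ▸ hw.1)
  obtain ⟨V₁, hV₁, W₁, hW₁, h1⟩ := one x hx y fun m => hxy m 0
  obtain ⟨W₂, hW₂, V₂, hV₂, h2⟩ := one y hy x fun m => (hxy 0 m).symm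
  refine ⟨interior (V₁ ∩ V₂) ∩ O, interior (W₁ ∩ W₂) ∩ O, isOpen_interior.inter hO,
    isOpen_interior.inter hO, ⟨mem_interior_iff_mem_nhds.2 (inter_mem hV₁ hV₂), hx⟩,
    ⟨mem_interior_iff_mem_nhds.2 (inter_mem hW₁ hW₂), hy⟩, inter_subset_right, inter_subset_right,
    ?_⟩
  intro m n v hv w hw hvw
  have hv' := interior_subset hv.1
  have hw' := interior_subset hw.1
  -- Injectivity cancels the common iterates, leaving a coincidence between a point and an iterate
  -- of the other one.
  rcases le_total n m with h | h
  · obtain ⟨k, rfl⟩ := Nat.exists_eq_add_of_le h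
    rw [Function.iterate_add_apply] at hvw
    exact h1 k v ⟨hv'.1, hv.2⟩ w hw'.1 (hinj.iterate hmap n (hmap.iterate k hv.2) hw.2 hvw)
  · obtain ⟨k, rfl⟩ := Nat.exists_eq_add_of_le h
    rw [Function.iterate_add_apply] at hvw
    exact h2 k w ⟨hw'.2, hw.2⟩ v hv'.2 (hinj.iterate hmap m hv.2 (hmap.iterate k hw.2) hvw).symm

end Separation

/-! ### Tails of an end-periodic map -/

section Tails

variable {X : Type u} [TopologicalSpace X] [CWComplex (univ : Set X)]

/-- The cells having a face in `S`. -/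
def star (S : Set (GCell X)) : Set (GCell X) := {d | ∃ c ∈ S, Face c d}

theorem subset_star (S : Set (GCell X)) : S ⊆ star S := fun c hc => ⟨c, hc, Face.refl c⟩

theorem star_mono {S T : Set (GCell X)} (h : S ⊆ T) : star S ⊆ star T :=
  fun _ ⟨c, hc, hF⟩ => ⟨c, h hc, hF⟩

/-- The cells without a face in `S` are closed under faces. Stars provide the open neighbourhoods of
the closed tails in which orbits are separated. -/
theorem isOpen_star (hX : IsGraph X) (S : Set (GCell X)) : IsOpen (cellOf ⁻¹' star S : Set X) :=
  FaceClosed.isOpen_compl hX fun _ _ h hd ⟨c, hc, hF⟩ => hd ⟨c, hc, hF.trans hX h⟩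

theorem exists_nhds_disjoint_star (hX : IsGraph X) {A : ℕ → Set (GCell X)} (hA : Antitone A)
    (hex : ∀ c, ∃ n, c ∉ A n) (y : X) :
    ∃ V ∈ 𝓝 y, ∃ k₀, ∀ k ≥ k₀, Disjoint (cellOf ⁻¹' star (A k)) V := by
  obtain ⟨V, hV, hfin⟩ := exists_nhds_finite_cells hX y
  obtain ⟨k₀, hk₀⟩ := IsCellShift.exists_disjoint_of_antitone
    (hfin.biUnion fun d _ => finite_faces hX d) hA hex
  refine ⟨V, hV, k₀, fun k hk => Set.disjoint_left.2 ?_⟩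
  rintro x ⟨c, hc, hF⟩ hx
  exact Set.disjoint_left.1 hk₀ (hA hk hc) (mem_biUnion (mem_image_of_mem cellOf hx) hF)

/-- A map acting on cells, together with forward and backward tails. -/
structure HasTails (g : X → X) (γ : GCell X → GCell X) (L D : Set (GCell X))
    (A B : ℕ → Set (GCell X)) : Prop extends ActsOnCells g γ L D where
  tail : IsTailPair Face γ L A B
  avoid_pos : ∀ {x c}, cellOf x ∉ L → Face c (cellOf (g x)) → c ∉ A 0
  avoid_neg : ∀ {x c}, cellOf x ∉ L → Face c (cellOf (g x)) → c ∉ B 0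

/-- The tails are pushed beyond all faces of the cells met by the image of the compact uncontrolled
region, so no point outside `L` is mapped into a tail or its star. -/
theorem ActsOnCells.exists_hasTails (hX : IsGraph X) {g : X → X} {γ : GCell X → GCell X}
    {L D : Set (GCell X)} (h : ActsOnCells g γ L D) : ∃ A B, HasTails g γ L D A B := by
  obtain ⟨A, B, ht, hA, hB⟩ := h.exists_isTailPair
    ((finite_cellOf_image hX ((isCompact_biUnion_cc h.finite_compl).image h.continuous)).biUnion
      fun d _ => finite_faces hX d)
  have key : ∀ {x c}, cellOf x ∉ L → Face c (cellOf (g x)) →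
      c ∈ ⋃ d ∈ cellOf '' (g '' ⋃ c ∈ Lᶜ, cc c), {c | Face c d} := fun {x c} hx hF =>
    mem_biUnion (mem_image_of_mem _ (mem_image_of_mem _
      (mem_biUnion (show cellOf x ∈ Lᶜ from hx) (mem_cc_cellOf x)))) hF
  exact ⟨A, B, { h with
    tail := ht
    avoid_pos := fun hx hF hc => Set.disjoint_left.1 hA hc (key hx hF)
    avoid_neg := fun hx hF hc => Set.disjoint_left.1 hB hc (key hx hF) }⟩

variable {g : X → X} {γ : GCell X → GCell X} {L D : Set (GCell X)} {A B : ℕ → Set (GCell X)}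

namespace ActsOnCells

variable (h : ActsOnCells g γ L D)
include h

theorem injOn_cells : InjOn g (cellOf ⁻¹' L) := injOn_iff_injective.2 h.isEmbedding.injective

theorem cellOf_apply {x : X} (hx : cellOf x ∈ L) : cellOf (g x) = γ (cellOf x) :=
  cellOf_map h.image_oc hx

theorem image_preimage {S : Set (GCell X)} (hS : S ⊆ L) :
    g '' (cellOf ⁻¹' S) = cellOf ⁻¹' (γ '' S) := by
  ext y
  constructor
  · rintro ⟨x, hx, rfl⟩
    exact ⟨cellOf x, hx, (h.cellOf_apply (hS hx)).symm⟩
  · rintro ⟨c, hc, hcy⟩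
    have hy : y ∈ g '' oc c := by
      rw [h.image_oc (hS hc), mem_oc_iff, hcy]
    obtain ⟨x, hx, rfl⟩ := hy
    exact ⟨x, by rwa [mem_preimage, mem_oc_iff.1 hx], rfl⟩

/-- Since `g` embeds the subset with cells `L`, the image of `V` is the trace of an open set on the
image of the cells of `S`, which is open by assumption. -/
theorem isOpen_image {S : Set (GCell X)} (hS : S ⊆ L)
    (hop : IsOpen (cellOf ⁻¹' (γ '' S) : Set X)) {V : Set X} (hV : IsOpen V)
    (hVS : V ⊆ cellOf ⁻¹' S) : IsOpen (g '' V) := by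
  have h1 : IsOpen ((↑) ⁻¹' V : Set (cellOf ⁻¹' L : Set X)) := hV.preimage continuous_subtype_val
  obtain ⟨W, hW, hWV⟩ := h.isEmbedding.isInducing.isOpen_iff.1 h1
  have hmem : ∀ x, cellOf x ∈ L → (g x ∈ W ↔ x ∈ V) := fun x hx =>
    (Set.ext_iff.1 hWV ⟨x, hx⟩)
  convert hW.inter hop using 1
  rw [← h.image_preimage hS]
  ext y
  constructor
  · rintro ⟨x, hx, rfl⟩
    exact ⟨(hmem x (hS (hVS hx))).2 hx, mem_image_of_mem g (hVS hx)⟩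
  · rintro ⟨hy, x, hx, rfl⟩
    exact mem_image_of_mem g ((hmem x (hS hx)).1 hy)

end ActsOnCells

namespace HasTails

variable (h : HasTails g γ L D A B)
include h

/-- Points outside `L` are excluded by `avoid_pos`. The equality for the full preimage is the
hypothesis of `exists_notMem_compact_pos`. -/
theorem preimage_pos (n : ℕ) : g ⁻¹' (cellOf ⁻¹' A (n + 1)) = cellOf ⁻¹' A n := by
  ext x
  simp only [mem_preimage]
  constructor
  · intro hx
    by_cases hL : cellOf x ∈ L
    · rw [h.cellOf_apply hL, ← h.tail.image] at hx
      obtain ⟨c, hc, e⟩ := hx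
      rwa [← h.injOn (h.tail.subset n hc) hL e]
    · exact absurd (h.tail.antitone (Nat.zero_le _) hx) (h.avoid_pos hL (Face.refl _))
  · intro hx
    rw [h.cellOf_apply (h.tail.subset n hx), ← h.tail.image]
    exact mem_image_of_mem γ hx

theorem preimage_neg (n : ℕ) : g ⁻¹' (cellOf ⁻¹' B n) = cellOf ⁻¹' B (n + 1) := by
  ext x
  simp only [mem_preimage]
  rw [← h.tail.preimage_neg, Set.mem_sep_iff]
  by_cases hL : cellOf x ∈ L
  · rw [h.cellOf_apply hL]
    simp [hL]
  · simp only [hL, false_and, iff_false]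
    exact fun hx => h.avoid_neg hL (Face.refl _) (h.tail.antitone_neg (Nat.zero_le _) hx)

theorem star_pos_subset (n : ℕ) : star (A n) ⊆ L := fun _ ⟨_, hc, hF⟩ =>
  h.tail.coface_mem (h.tail.antitone (Nat.zero_le n) hc) hF

theorem star_neg_subset (n : ℕ) : star (B n) ⊆ L := fun _ ⟨_, hc, hF⟩ =>
  h.tail.coface_mem_neg (h.tail.antitone_neg (Nat.zero_le n) hc) hF

theorem image_star_pos (n : ℕ) : γ '' star (A n) = star (A (n + 1)) := by
  ext d
  constructor
  · rintro ⟨d, ⟨c, hc, hF⟩, rfl⟩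
    exact ⟨γ c, h.tail.image n ▸ mem_image_of_mem γ hc,
      h.map_face hF (h.star_pos_subset n ⟨c, hc, hF⟩)⟩
  · rintro ⟨c, hc, hF⟩
    rw [← h.tail.image] at hc
    obtain ⟨c, hc, rfl⟩ := hc
    obtain ⟨e, -, hce, rfl⟩ := h.tail.exists_coface (h.tail.antitone (Nat.zero_le n) hc) hF
    exact mem_image_of_mem γ ⟨c, hc, hce⟩

theorem image_star_neg (n : ℕ) : γ '' star (B (n + 1)) = star (B n) := by
  ext d
  constructor
  · rintro ⟨d, ⟨c, hc, hF⟩, rfl⟩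
    exact ⟨γ c, h.tail.image_neg n ▸ mem_image_of_mem γ hc,
      h.map_face hF (h.star_neg_subset _ ⟨c, hc, hF⟩)⟩
  · rintro ⟨c, hc, hF⟩
    rw [← h.tail.image_neg] at hc
    obtain ⟨c, hc, rfl⟩ := hc
    obtain ⟨e, -, hce, rfl⟩ := h.tail.exists_coface_neg
      (h.tail.antitone_neg (Nat.le_add_left 1 n) hc) hF
    exact mem_image_of_mem γ ⟨c, hc, hce⟩

theorem preimage_star_neg (n : ℕ) :
    g ⁻¹' (cellOf ⁻¹' star (B n)) = cellOf ⁻¹' star (B (n + 1)) := by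
  ext x
  simp only [mem_preimage]
  constructor
  · intro hx
    by_cases hL : cellOf x ∈ L
    · rw [h.cellOf_apply hL, ← h.image_star_neg] at hx
      obtain ⟨c, hc, e⟩ := hx
      rwa [← h.injOn (h.star_neg_subset _ hc) hL e]
    · obtain ⟨c, hc, hF⟩ := hx
      exact absurd (h.tail.antitone_neg (Nat.zero_le _) hc) (h.avoid_neg hL hF)
  · intro hx
    rw [h.cellOf_apply (h.star_neg_subset _ hx), ← h.image_star_neg]
    exact mem_image_of_mem γ hx

theorem image_pos (n : ℕ) :
    g '' (cellOf ⁻¹' star (A n)) = cellOf ⁻¹' star (A (n + 1)) := by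
  rw [h.image_preimage (h.star_pos_subset n), h.image_star_pos]

theorem image_neg (n : ℕ) :
    g '' (cellOf ⁻¹' star (B (n + 1))) = cellOf ⁻¹' star (B n) := by
  rw [h.image_preimage (h.star_neg_subset _), h.image_star_neg]

theorem mapsTo_pos : MapsTo g (cellOf ⁻¹' star (A 0)) (cellOf ⁻¹' star (A 0)) := by
  intro x hx
  have := mem_image_of_mem g hx
  rw [h.image_pos] at this
  exact star_mono (h.tail.antitone (Nat.zero_le 1)) this

theorem image_iterate_pos (n : ℕ) :
    g^[n] '' (cellOf ⁻¹' star (A 0)) = cellOf ⁻¹' star (A n) := by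
  induction n with
  | zero => simp
  | succ n ih => rw [Function.iterate_succ', image_comp, ih, h.image_pos]

theorem isOpen_image_iterate_pos (hX : IsGraph X) {V : Set X} (hV : IsOpen V)
    (hVs : V ⊆ cellOf ⁻¹' star (A 0)) (n : ℕ) : IsOpen (g^[n] '' V) := by
  induction n with
  | zero => simpa using hV
  | succ n ih =>
    rw [Function.iterate_succ', image_comp]
    refine h.isOpen_image (h.star_pos_subset n) ?_ ih ?_
    · rw [h.image_star_pos]
      exact isOpen_star hX _
    · rw [← h.image_iterate_pos]
      exact image_mono hVs

theorem iterate_mem_pos {x : X} (hx : cellOf x ∈ A 0) (n : ℕ) : cellOf (g^[n] x) ∈ A n := by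
  induction n with
  | zero => exact hx
  | succ n ih =>
    rw [Function.iterate_succ_apply']
    rw [← mem_preimage, ← h.preimage_pos] at ih
    exact ih

theorem mem_of_iterate_mem_neg {x : X} {m : ℕ} (hx : ∀ n ≤ m, cellOf (g^[n] x) ∈ B 0) :
    cellOf x ∈ B m := by
  induction m generalizing x with
  | zero => exact hx 0 le_rfl
  | succ m ih =>
    have : cellOf (g x) ∈ B m := ih fun n hn => by
      have := hx (n + 1) (by omega)
      rwa [Function.iterate_succ_apply] at this
    rw [← mem_preimage, ← mem_preimage (f := g), h.preimage_neg] at this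
    exact this

theorem isCompact_core :
    ∃ K : Set X, IsCompact K ∧ ∀ x, x ∉ K → cellOf x ∈ A 1 ∨ cellOf x ∈ B 1 := by
  refine ⟨_, isCompact_biUnion_cc h.tail.finite_compl, fun x hx => ?_⟩
  by_contra hn
  exact hx (mem_biUnion (show cellOf x ∈ (A 1 ∪ B 1)ᶜ from hn) (mem_cc_cellOf x))

theorem isClosed_pos (hX : IsGraph X) (n : ℕ) : IsClosed (cellOf ⁻¹' A n : Set X) :=
  FaceClosed.isClosed hX fun _ _ => h.tail.face

theorem isClosed_neg (hX : IsGraph X) (n : ℕ) : IsClosed (cellOf ⁻¹' B n : Set X) :=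
  FaceClosed.isClosed hX fun _ _ => h.tail.face_neg

end HasTails

end Tails

/-! ### The positive boundary -/

section Positive

variable {X : Type u} [TopologicalSpace X] [CWComplex (univ : Set X)]
  {g : X → X} {γ : GCell X → GCell X} {L D : Set (GCell X)} {A B : ℕ → Set (GCell X)}

namespace HasTails

variable (h : HasTails g γ L D A B)
include h

theorem tendsto_flow (hX : IsGraph X) {x : X} (hx : cellOf x ∈ A 0) (s : unitInterval) :
    Tendsto (fun t => flow g t (MappingTorus.mk g x s)) atTop (cocompact (MappingTorus g)) := by
  refine tendsto_flow_of_forall g (C := fun n => cellOf ⁻¹' A n)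
    (fun K hK => exists_notMem_compact_pos g (fun m n hmn => preimage_mono (h.tail.antitone hmn))
      (h.isClosed_pos hX) h.preimage_pos (fun x => h.tail.exists_notMem _) hK) fun n => ?_
  filter_upwards [eventually_ge_atTop n] with m hm
  exact h.tail.antitone hm (h.iterate_mem_pos hx m)

/-- An orbit leaving compact sets is eventually in `A 1 ∪ B 1`. If it never met `A 0` it would stay
in `B 0` from some time `M` on, and then `f M` would lie in every `B m`. -/
theorem exists_iterate_mem_pos {f : ℕ → X} (hf : ∀ n, g (f n) = f (n + 1))
    (hK : ∀ K : Set X, IsCompact K → ∀ᶠ n in atTop, f n ∉ K) : ∃ m, cellOf (f m) ∈ A 0 := by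
  obtain ⟨K, hKc, hKm⟩ := h.isCompact_core
  obtain ⟨M, hM⟩ := eventually_atTop.1 (hK K hKc)
  by_contra! hall
  have hB : ∀ n ≥ M, cellOf (f n) ∈ B 0 := fun n hn =>
    ((hKm _ (hM n hn)).resolve_left fun hA => hall n (h.tail.antitone zero_le_one hA)) |>
      h.tail.antitone_neg zero_le_one
  have hit : ∀ n, g^[n] (f M) = f (M + n) := by
    intro n
    induction n with
    | zero => rfl
    | succ n ih => rw [Function.iterate_succ_apply', ih, hf, add_assoc]
  obtain ⟨m, hm⟩ := h.tail.exists_notMem_neg (cellOf (f M))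
  exact hm (h.mem_of_iterate_mem_neg fun n _ => by rw [hit]; exact hB _ (by omega))

/-- The forward ray starting at a point of the forward tail. -/
def forwardRay (hX : IsGraph X) {x : X} (hx : cellOf x ∈ A 0) : ForwardRay g :=
  ⟨MappingTorus.mk g x 0, h.tendsto_flow hX hx 0⟩

/-- The forward endpoint, as a map to the positive boundary. -/
def posMap (hX : IsGraph X) (x : (cellOf ⁻¹' A 0 : Set X)) : posBoundary g :=
  ⟨(h.forwardRay hX x.2).endpoint, ⟨_, rfl⟩⟩

theorem iterate_mem_pos_zero {x : X} (hx : cellOf x ∈ A 0) (n : ℕ) : cellOf (g^[n] x) ∈ A 0 :=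
  h.tail.antitone (Nat.zero_le n) (h.iterate_mem_pos hx n)

theorem posMap_eq_iff (hX : IsGraph X) (x y : (cellOf ⁻¹' A 0 : Set X)) :
    h.posMap hX x = h.posMap hX y ↔ ∃ m n, g^[m] x.1 = g^[n] y.1 := by
  simp only [posMap, Subtype.mk.injEq, ForwardRay.endpoint, CompactifiedTorus.posPoint.injEq]
  constructor
  · intro hxy
    obtain ⟨s, t, hst⟩ := Quotient.exact hxy
    have := congrArg (basePoint g) hst
    simp only [forwardRay, flow_mk, basePoint_flowPoint] at this
    exact ⟨_, _, this⟩
  · rintro ⟨m, n, hmn⟩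
    refine Quotient.sound ⟨m, n, ?_⟩
    simp only [forwardRay, flow_mk, Set.Icc.coe_zero, zero_add, NNReal.coe_natCast,
      flowPoint_natCast, hmn]

theorem posMap_surjective (hX : IsGraph X) : Function.Surjective (h.posMap hX) := by
  rintro ⟨_, b, rfl⟩
  obtain ⟨z, rfl⟩ := Quotient.exists_rep b
  have hz := eq_flowPoint g z.1
  set x := basePoint g z.1
  set r := height g z.1
  have hr0 : 0 ≤ r := height_nonneg g z.1
  have hr1 : r < 1 := height_lt_one g z.1
  have ht : ∀ n : ℕ, (0 : ℝ) ≤ n + (1 - r) := fun n => by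
    have : (0 : ℝ) ≤ n := n.cast_nonneg
    linarith
  -- From height `r`, time `1 - r` leads up to the next copy of the base, and each further unit of
  -- time applies `g` once.
  have hflow : ∀ n : ℕ, flow g ((n + (1 - r)).toNNReal) z.1 =
      MappingTorus.mk g (g^[n + 1] x) 0 := by
    intro n
    rw [hz, flow_flowPoint g _ _ hr0, Real.coe_toNNReal _ (ht n), ← flowPoint_natCast]
    congr 1
    push_cast
    ring
  have htend : Tendsto (fun n : ℕ => (n + (1 - r)).toNNReal) atTop atTop :=
    tendsto_real_toNNReal_atTop.comp
      (tendsto_atTop_add_const_right _ _ tendsto_natCast_atTop_atTop)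
  obtain ⟨m, hm⟩ := h.exists_iterate_mem_pos (f := fun n => g^[n + 1] x)
    (fun n => (Function.iterate_succ_apply' g (n + 1) x).symm) (fun K hK => by
      filter_upwards [eventually_basePoint_notMem g (z.2.comp htend) hK] with n hn
      rw [Function.comp_apply, hflow] at hn
      simpa [basePoint, MappingTorus.mk] using hn)
  refine ⟨⟨_, hm⟩, Subtype.ext (congrArg CompactifiedTorus.posPoint (Quotient.sound ?_))⟩
  refine ⟨0, (m + (1 - r)).toNNReal, ?_⟩
  rw [flow_zero, hflow]
  rfl

theorem posMap_continuous (hX : IsGraph X) : Continuous (h.posMap hX) := by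
  refine Continuous.subtype_mk (continuous_def.2 fun W hW => ?_) _
  rw [isOpen_iff_mem_nhds]
  intro x hx
  obtain ⟨r, hr⟩ := eventually_atTop.1 (hW.2.1 (h.forwardRay hX x.2) hx)
  obtain ⟨n, hn⟩ := exists_nat_ge r
  obtain ⟨N, hN, -, -, hNW⟩ := hr n hn
  -- The neighbourhood condition holds only far along the flowline, so `x` and its neighbours are
  -- moved `n` steps ahead. This does not change their endpoints.
  have hflow : ∀ x, flow g (n : ℝ≥0) (MappingTorus.mk g x 0) = MappingTorus.mk g (g^[n] x) 0 := by
    intro x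
    rw [flow_mk, Set.Icc.coe_zero, zero_add, NNReal.coe_natCast, flowPoint_natCast]
  have hc : Continuous fun y : (cellOf ⁻¹' A 0 : Set X) => MappingTorus.mk g (g^[n] y.1) 0 :=
    (MappingTorus.continuous_mk g).comp
      (((h.continuous.iterate n).comp continuous_subtype_val).prodMk continuous_const)
  have hN' : N ∈ 𝓝 (MappingTorus.mk g (g^[n] x.1) 0) := by
    rw [← hflow]
    exact hN
  filter_upwards [hc.continuousAt.preimage_mem_nhds hN'] with y hy
  have h1 := hNW (h.forwardRay hX (h.iterate_mem_pos_zero y.2 n)) hy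
  have h2 : h.posMap hX ⟨_, h.iterate_mem_pos_zero y.2 n⟩ = h.posMap hX y :=
    (h.posMap_eq_iff hX _ _).2 ⟨0, n, rfl⟩
  have h3 := congrArg Subtype.val h2
  change (h.posMap hX y).1 ∈ W
  rw [← h3]
  exact h1

omit h in
/-- The flow-saturation of the fibres over `V`. -/
def saturation (g : X → X) (V : Set X) : Set (MappingTorus g) :=
  {z | ∃ m n, ∃ v ∈ V, g^[m] (basePoint g z) = g^[n] v}

omit h [TopologicalSpace X] [CWComplex (univ : Set X)] in
theorem flow_mem_saturation (V : Set X) (t : ℝ≥0) (z : MappingTorus g) :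
    flow g t z ∈ saturation g V ↔ z ∈ saturation g V := by
  have hz : basePoint g (flow g t z) = g^[⌊height g z + t⌋₊] (basePoint g z) := by
    conv_lhs => rw [eq_flowPoint g z, flow_flowPoint g _ _ (height_nonneg g z),
      basePoint_flowPoint]
  simp only [saturation, mem_ofPred_eq, hz]
  constructor
  · rintro ⟨m, n, v, hv, e⟩
    exact ⟨_, n, v, hv, by rw [Function.iterate_add_apply]; exact e⟩
  · rintro ⟨m, n, v, hv, e⟩
    refine ⟨m, ⌊height g z + t⌋₊ + n, v, hv, ?_⟩
    rw [← Function.iterate_add_apply, add_comm m, Function.iterate_add_apply, e,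
      Function.iterate_add_apply]

/-- Membership does not depend on the height, and over the base the saturation is the union of the
sets `g^[m] ⁻¹' (g^[n] '' V)`, which are open because iterates of `g` are open maps on the star of
the tail. -/
theorem isOpen_saturation (hX : IsGraph X) {V : Set X} (hV : IsOpen V)
    (hVs : V ⊆ cellOf ⁻¹' star (A 0)) : IsOpen (saturation g V) := by
  have hmk : ∀ x s, MappingTorus.mk g x s ∈ saturation g V ↔
      x ∈ ⋃ (m : ℕ) (n : ℕ), g^[m] ⁻¹' (g^[n] '' V) := by
    intro x s
    have : MappingTorus.mk g x s ∈ saturation g V ↔ MappingTorus.mk g x 0 ∈ saturation g V := by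
      have e : flow g (s : ℝ).toNNReal (flow g 1 (MappingTorus.mk g x 0)) =
          flow g 1 (MappingTorus.mk g x s) := by
        rw [← flow_add, flow_mk, flow_mk, Set.Icc.coe_zero, zero_add, NNReal.coe_add,
          Real.coe_toNNReal _ s.2.1]
      rw [← flow_mem_saturation V 1 (MappingTorus.mk g x s), ← e, flow_mem_saturation,
        flow_mem_saturation]
    rw [this]
    simp only [mem_iUnion, mem_preimage, mem_image, saturation, mem_ofPred_eq]
    have hb : basePoint g (MappingTorus.mk g x 0) = x := by simp [basePoint, MappingTorus.mk]
    rw [hb]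
    exact exists_congr fun m => exists_congr fun n =>
      ⟨fun ⟨v, hv, e⟩ => ⟨v, hv, e.symm⟩, fun ⟨v, hv, e⟩ => ⟨v, hv, e.symm⟩⟩
  rw [MappingTorus.isOpen_iff]
  simp only [hmk]
  refine IsOpen.preimage continuous_fst (isOpen_iUnion fun m => isOpen_iUnion fun n => ?_)
  exact (h.isOpen_image_iterate_pos hX hV hVs n).preimage (h.continuous.iterate m)

theorem t2Space_posBoundary (hX : IsGraph X) : T2Space (posBoundary g) := by
  have := hX.t2
  refine ⟨fun a b hab => ?_⟩
  obtain ⟨x, rfl⟩ := h.posMap_surjective hX a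
  obtain ⟨y, rfl⟩ := h.posMap_surjective hX b
  have hne := (h.posMap_eq_iff hX x y).not.1 hab
  push Not at hne
  obtain ⟨V, W, hV, hW, hxV, hyW, hVO, hWO, hd⟩ := exists_disjoint_orbit_nhds
    (isOpen_star hX (A 0)) h.continuous.continuousOn h.mapsTo_pos
    (h.injOn_cells.mono (preimage_mono (h.star_pos_subset 0))) (fun y => by
      obtain ⟨V, hV, k₀, hk₀⟩ :=
        exists_nhds_disjoint_star hX h.tail.antitone h.tail.exists_notMem y
      exact ⟨V, hV, k₀, fun k hk => by rw [h.image_iterate_pos]; exact hk₀ k hk⟩)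
    (subset_star _ x.2) (subset_star _ y.2) hne
  have hbase : ∀ x : X, basePoint g (MappingTorus.mk g x 0) = x := fun x => by
    simp [basePoint, MappingTorus.mk]
  have hmem : ∀ (V : Set X) (z : (cellOf ⁻¹' A 0 : Set X)), z.1 ∈ V →
      (h.posMap hX z).1 ∈ posHull g (saturation g V) := fun V z hz =>
    (endpoint_mem_posHull g (flow_mem_saturation V) _).2 ⟨0, 0, z.1, hz, hbase z.1⟩
  refine ⟨_, _, (isOpen_posHull g (h.isOpen_saturation hX hV hVO)
    (flow_mem_saturation V)).preimage continuous_subtype_val,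
    (isOpen_posHull g (h.isOpen_saturation hX hW hWO)
    (flow_mem_saturation W)).preimage continuous_subtype_val, hmem V x hxV, hmem W y hyW, ?_⟩
  rw [Set.disjoint_left]
  rintro c hc1 hc2
  obtain ⟨z, rfl⟩ := h.posMap_surjective hX c
  obtain ⟨m, n, v, hv, e1⟩ := (endpoint_mem_posHull g (flow_mem_saturation V) _).1 hc1
  obtain ⟨m', n', w, hw, e2⟩ := (endpoint_mem_posHull g (flow_mem_saturation W) _).1 hc2
  refine hd (m' + n) (m + n') v hv w hw ?_
  rw [Function.iterate_add_apply, ← e1, Function.iterate_add_apply _ m, ← e2,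
    ← Function.iterate_add_apply, ← Function.iterate_add_apply, add_comm]

end HasTails

end Positive

/-! ### The negative boundary -/

section Negative

variable {X : Type u} [TopologicalSpace X] [CWComplex (univ : Set X)]
  {g s : X → X} {γ : GCell X → GCell X} {L D : Set (GCell X)} {A B : ℕ → Set (GCell X)}

/-- A map with tails, together with its inverse `s` near the backward tail. -/
structure HasInverse (g : X → X) (γ : GCell X → GCell X) (L D : Set (GCell X))
    (A B : ℕ → Set (GCell X)) (s : X → X) : Prop extends HasTails g γ L D A B where
  mem : ∀ {x}, cellOf x ∈ star (B 0) → cellOf (s x) ∈ star (B 1)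
  apply : ∀ {x}, cellOf x ∈ star (B 0) → g (s x) = x

theorem HasTails.exists_hasInverse (h : HasTails g γ L D A B) :
    ∃ s, HasInverse g γ L D A B s := by
  have key : ∀ x : X, ∃ y, cellOf x ∈ star (B 0) → cellOf y ∈ star (B 1) ∧ g y = x := by
    intro x
    by_cases hx : cellOf x ∈ star (B 0)
    · have : x ∈ g '' (cellOf ⁻¹' star (B (0 + 1))) := by
        rw [h.image_neg]
        exact hx
      obtain ⟨y, hy, e⟩ := this
      exact ⟨y, fun _ => ⟨hy, e⟩⟩
    · exact ⟨x, fun h => absurd h hx⟩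
  choose s hs using key
  exact ⟨s, { h with mem := fun hx => (hs _ hx).1, apply := fun hx => (hs _ hx).2 }⟩

namespace HasInverse

variable (h : HasInverse g γ L D A B s)
include h

theorem eq_of_apply {x y : X} (hx : cellOf x ∈ star (B 0)) (e : g y = x) : s x = y := by
  have hy : cellOf y ∈ star (B (0 + 1)) := by
    rw [← mem_preimage, ← h.preimage_star_neg]
    simpa [e] using hx
  exact h.injOn_cells (h.star_neg_subset _ (h.mem hx)) (h.star_neg_subset _ hy)
    ((h.apply hx).trans e.symm)

theorem mem_star {n : ℕ} {x : X} (hx : cellOf x ∈ star (B n)) : cellOf (s x) ∈ star (B (n + 1)) := by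
  rw [← mem_preimage, ← h.preimage_star_neg, mem_preimage, mem_preimage,
    h.apply (star_mono (h.tail.antitone_neg (Nat.zero_le n)) hx)]
  exact hx

theorem mem_neg {n : ℕ} {x : X} (hx : cellOf x ∈ B n) : cellOf (s x) ∈ B (n + 1) := by
  rw [← mem_preimage, ← h.preimage_neg, mem_preimage, mem_preimage,
    h.apply (subset_star _ (h.tail.antitone_neg (Nat.zero_le n) hx))]
  exact hx

theorem iterate_mem_neg {x : X} (hx : cellOf x ∈ B 0) (n : ℕ) : cellOf (s^[n] x) ∈ B n := by
  induction n with
  | zero => exact hx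
  | succ n ih =>
    rw [Function.iterate_succ_apply']
    exact h.mem_neg ih

theorem iterate_mem_neg_zero {x : X} (hx : cellOf x ∈ B 0) (n : ℕ) : cellOf (s^[n] x) ∈ B 0 :=
  h.tail.antitone_neg (Nat.zero_le n) (h.iterate_mem_neg hx n)

theorem iterate_mem_star {x : X} (hx : cellOf x ∈ star (B 0)) (n : ℕ) :
    cellOf (s^[n] x) ∈ star (B n) := by
  induction n with
  | zero => exact hx
  | succ n ih =>
    rw [Function.iterate_succ_apply']
    exact h.mem_star ih

theorem iterate_apply {x : X} (hx : cellOf x ∈ star (B 0)) (n : ℕ) : g^[n] (s^[n] x) = x := by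
  induction n with
  | zero => rfl
  | succ n ih =>
    rw [Function.iterate_succ_apply, Function.iterate_succ_apply', h.apply, ih]
    exact star_mono (h.tail.antitone_neg (Nat.zero_le n)) (h.iterate_mem_star hx n)

theorem iterate_eq {x y : X} (hx : cellOf x ∈ star (B 0)) {n : ℕ} (e : g^[n] y = x) :
    s^[n] x = y := by
  induction n generalizing x with
  | zero => exact e.symm
  | succ n ih =>
    rw [Function.iterate_succ_apply'] at e
    have := h.eq_of_apply hx e
    rw [Function.iterate_succ_apply]
    exact ih (star_mono (h.tail.antitone_neg zero_le_one) (h.mem hx)) this.symm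

theorem mapsTo_neg : MapsTo s (cellOf ⁻¹' star (B 0)) (cellOf ⁻¹' star (B 0)) := fun _ hx =>
  star_mono (h.tail.antitone_neg zero_le_one) (h.mem hx)

theorem injOn_neg : InjOn s (cellOf ⁻¹' star (B 0)) := fun x hx y hy e => by
  rw [← h.apply hx, e, h.apply hy]

/-- Preimages under the local inverse are images under `g`, which is open from the star of `B 1`
onto the star of `B 0`. -/
theorem continuousOn_neg (hX : IsGraph X) : ContinuousOn s (cellOf ⁻¹' star (B 0)) := by
  rw [continuousOn_open_iff (isOpen_star hX _)]
  intro t ht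
  have : cellOf ⁻¹' star (B 0) ∩ s ⁻¹' t = g '' (cellOf ⁻¹' star (B 1) ∩ t) := by
    ext x
    constructor
    · rintro ⟨hx, hxt⟩
      exact ⟨s x, ⟨h.mem hx, hxt⟩, h.apply hx⟩
    · rintro ⟨y, ⟨hy, hyt⟩, rfl⟩
      have hgy : cellOf (g y) ∈ star (B 0) := by
        have := mem_image_of_mem g hy
        rwa [h.image_neg 0] at this
      refine ⟨hgy, ?_⟩
      rw [mem_preimage, h.eq_of_apply hgy rfl]
      exact hyt
  rw [this]
  refine h.isOpen_image (h.star_neg_subset 1) ?_ ((isOpen_star hX _).inter ht) inter_subset_left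
  rw [h.image_star_neg 0]
  exact isOpen_star hX _

omit h [TopologicalSpace X] [CWComplex (univ : Set X)] in
/-- The point reached by flowing backwards from `(x, 0)` for time `t`, along the backward orbit
of `x` under the local inverse `s`. -/
noncomputable def backPoint (g s : X → X) (x : X) (t : ℝ≥0) : MappingTorus g :=
  flowPoint g (s^[⌈t⌉₊] x) (⌈t⌉₊ - t)

/-- Going back `n` steps instead of `⌈t⌉₊` is compensated by flowing forward longer, because `g`
undoes `s`. The freedom in `n` lets two times be compared over a common base point. -/
theorem backPoint_eq {x : X} (hx : cellOf x ∈ B 0) {n : ℕ} {t : ℝ≥0} (ht : t ≤ n) :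
    backPoint g s x t = flowPoint g (s^[n] x) (n - t) := by
  obtain ⟨k, hk⟩ := Nat.exists_eq_add_of_le (Nat.ceil_le.2 ht)
  have h0 : (0 : ℝ) ≤ ⌈t⌉₊ - t := sub_nonneg.2 (by exact_mod_cast Nat.le_ceil t)
  have e : (n : ℝ) - t = ⌈t⌉₊ - t + k := by
    rw [hk]
    push_cast
    ring
  rw [backPoint, e, flowPoint_add_nat g _ _ h0, hk, add_comm, Function.iterate_add_apply s k,
    h.iterate_apply (subset_star _ (h.iterate_mem_neg_zero hx _))]

omit h [TopologicalSpace X] [CWComplex (univ : Set X)] in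
theorem exists_backPoint_eq_mk (x : X) (t : ℝ≥0) :
    ∃ r, backPoint g s x t = MappingTorus.mk g (s^[⌈t⌉₊] x) r := by
  have h0 : (0 : ℝ) ≤ ⌈t⌉₊ - t := sub_nonneg.2 (by exact_mod_cast Nat.le_ceil t)
  have h1 : (⌈t⌉₊ : ℝ) - t < 1 := by
    have : (⌈t⌉₊ : ℝ) < t + 1 := by exact_mod_cast Nat.ceil_lt_add_one (zero_le (a := t))
    linarith
  exact ⟨_, flowPoint_of_lt_one g _ h0 h1⟩

omit h [TopologicalSpace X] [CWComplex (univ : Set X)] in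
theorem basePoint_backPoint (x : X) (t : ℝ≥0) :
    basePoint g (backPoint g s x t) = s^[⌈t⌉₊] x := by
  have h1 : (⌈t⌉₊ : ℝ) - t < 1 := by
    have : (⌈t⌉₊ : ℝ) < t + 1 := by exact_mod_cast Nat.ceil_lt_add_one (zero_le (a := t))
    linarith
  rw [backPoint, basePoint_flowPoint, Nat.floor_eq_zero.2 h1, Function.iterate_zero, id]

theorem backPoint_natCast {x : X} (hx : cellOf x ∈ B 0) (n : ℕ) :
    backPoint g s x n = MappingTorus.mk g (s^[n] x) 0 := by
  rw [h.backPoint_eq hx (n := n) le_rfl, NNReal.coe_natCast, sub_self, flowPoint_zero]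

theorem backPoint_iterate {x : X} (hx : cellOf x ∈ B 0) (m : ℕ) (t : ℝ≥0) :
    backPoint g s (s^[m] x) t = backPoint g s x (t + m) := by
  have ht : t ≤ ⌈t⌉₊ := Nat.le_ceil t
  rw [h.backPoint_eq (h.iterate_mem_neg_zero hx m) ht,
    h.backPoint_eq hx (n := ⌈t⌉₊ + m) (by push_cast; gcongr), Function.iterate_add_apply]
  congr 1
  push_cast
  ring

theorem flow_backPoint {x : X} (hx : cellOf x ∈ B 0) (a t : ℝ≥0) :
    flow g a (backPoint g s x (t + a)) = backPoint g s x t := by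
  have ht : t + a ≤ ⌈t + a⌉₊ := Nat.le_ceil _
  rw [h.backPoint_eq hx ht, h.backPoint_eq hx (le_self_add.trans ht), flow_flowPoint]
  · congr 1
    push_cast
    ring
  · exact sub_nonneg.2 (by exact_mod_cast ht)

theorem tendsto_backPoint (hX : IsGraph X) {x : X} (hx : cellOf x ∈ B 0) :
    Tendsto (backPoint g s x) atTop (cocompact (MappingTorus g)) := by
  refine (hasBasis_cocompact.tendsto_right_iff).2 fun K hK => ?_
  obtain ⟨n, hn⟩ := exists_notMem_compact_neg g (C := fun n => cellOf ⁻¹' B n)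
    (fun m n hmn => preimage_mono (h.tail.antitone_neg hmn)) (h.isClosed_neg hX) h.preimage_neg
    (fun x => h.tail.exists_notMem_neg _) hK
  filter_upwards [eventually_ge_atTop (n : ℝ≥0)] with t ht
  obtain ⟨r, hr⟩ := exists_backPoint_eq_mk (g := g) (s := s) x t
  rw [hr]
  have : n ≤ ⌈t⌉₊ := by exact_mod_cast ht.trans (Nat.le_ceil t)
  exact hn _ (h.tail.antitone_neg this (h.iterate_mem_neg hx _)) r

/-- The backward ray starting at a point of the backward tail. -/
noncomputable def backwardRay (hX : IsGraph X) {x : X} (hx : cellOf x ∈ B 0) : BackwardRay g :=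
  ⟨backPoint g s x, fun a t => h.flow_backPoint hx a t, h.tendsto_backPoint hX hx⟩

/-- The backward endpoint, as a map to the negative boundary. -/
noncomputable def negMap (hX : IsGraph X) (x : (cellOf ⁻¹' B 0 : Set X)) : negBoundary g :=
  ⟨(h.backwardRay hX x.2).endpoint, ⟨_, rfl⟩⟩

theorem negMap_eq_iff (hX : IsGraph X) (x y : (cellOf ⁻¹' B 0 : Set X)) :
    h.negMap hX x = h.negMap hX y ↔ ∃ m n, s^[m] x.1 = s^[n] y.1 := by
  simp only [negMap, Subtype.mk.injEq, BackwardRay.endpoint, CompactifiedTorus.negPoint.injEq]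
  constructor
  · intro hxy
    obtain ⟨a, b, hab⟩ := Quotient.exact hxy
    have := congrArg (basePoint g) (hab 0)
    simp only [backwardRay, basePoint_backPoint] at this
    exact ⟨_, _, this⟩
  · rintro ⟨m, n, hmn⟩
    refine Quotient.sound ⟨m, n, fun t => ?_⟩
    simp only [backwardRay]
    rw [← h.backPoint_iterate x.2, ← h.backPoint_iterate y.2, hmn]

/-- Otherwise the backward orbit would lie in `A 0` from some index `M` on, and as an `m`-th forward
image of `b (M + m)` the point `b M` would lie in every `A m`. -/
theorem exists_mem_neg {b : ℕ → X} (hb : ∀ n, g (b (n + 1)) = b n)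
    (hK : ∀ K : Set X, IsCompact K → ∀ᶠ n in atTop, b n ∉ K) : ∃ m, cellOf (b m) ∈ B 0 := by
  obtain ⟨K, hKc, hKm⟩ := h.isCompact_core
  obtain ⟨M, hM⟩ := eventually_atTop.1 (hK K hKc)
  by_contra! hall
  have hA : ∀ n ≥ M, cellOf (b n) ∈ A 0 := fun n hn =>
    ((hKm _ (hM n hn)).resolve_right fun hB => hall n (h.tail.antitone_neg zero_le_one hB)) |>
      h.tail.antitone zero_le_one
  have hit : ∀ n m, g^[n] (b (m + n)) = b m := by
    intro n
    induction n with
    | zero => exact fun m => rfl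
    | succ n ih => intro m; rw [Function.iterate_succ_apply, ← add_assoc, hb, ih]
  obtain ⟨m, hm⟩ := h.tail.exists_notMem (cellOf (b M))
  refine hm ?_
  rw [← hit m M]
  exact h.iterate_mem_pos (hA _ (Nat.le_add_right M m)) m

omit h [CWComplex (univ : Set X)] in
theorem basePoint_height_succ (β : BackwardRay g) (t : ℝ≥0) :
    basePoint g (β.1 t) = g (basePoint g (β.1 (t + 1))) ∧
      height g (β.1 t) = height g (β.1 (t + 1)) := by
  have e := β.2.1 1 t
  have h0 := height_nonneg g (β.1 (t + 1))
  have h1 := height_lt_one g (β.1 (t + 1))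
  rw [eq_flowPoint g (β.1 (t + 1)), flow_flowPoint g _ _ h0, NNReal.coe_one,
    flowPoint_add_one g _ h0] at e
  rw [← e, basePoint_flowPoint, height_flowPoint, Nat.floor_eq_zero.2 h1,
    Int.fract_eq_self.2 ⟨h0, h1⟩]
  exact ⟨rfl, rfl⟩

theorem negMap_surjective (hX : IsGraph X) : Function.Surjective (h.negMap hX) := by
  rintro ⟨_, c, rfl⟩
  obtain ⟨β, rfl⟩ := Quotient.exists_rep c
  set b : ℕ → X := fun n => basePoint g (β.1 n) with hbdef
  have hb : ∀ n, g (b (n + 1)) = b n := fun n => by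
    simp only [hbdef]
    rw [(basePoint_height_succ β n).1]
    push_cast
    rfl
  obtain ⟨r, hr⟩ : ∃ r : ℝ≥0, (r : ℝ) = height g (β.1 0) :=
    ⟨⟨_, height_nonneg g _⟩, rfl⟩
  have hheight : ∀ n : ℕ, height g (β.1 n) = r := by
    intro n
    induction n with
    | zero => rw [hr, Nat.cast_zero]
    | succ n ih => rw [← ih, (basePoint_height_succ β n).2]; push_cast; rfl
  obtain ⟨m, hm⟩ := h.exists_mem_neg hb fun K hK =>
    eventually_basePoint_notMem g (β.2.2.comp (tendsto_natCast_atTop_atTop (R := ℝ≥0))) hK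
  have hit : ∀ n m, g^[n] (b (m + n)) = b m := by
    intro n
    induction n with
    | zero => exact fun m => rfl
    | succ n ih => intro m; rw [Function.iterate_succ_apply, ← add_assoc, hb, ih]
  refine ⟨⟨b m, hm⟩, Subtype.ext (congrArg CompactifiedTorus.negPoint (Quotient.sound ?_))⟩
  -- The height along `β` at integer times is constantly `r`, so `β` comes down to the base point `b
  -- m` after backward time `m + r`.
  refine ⟨0, m + r, fun t => ?_⟩
  simp only [backwardRay, add_zero]
  -- For large `k`, both rays at the time in question are obtained by flowing forward from the fibre
  -- over `s^[k] (b m) = b (m + k)`.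
  obtain ⟨k, hk⟩ := exists_nat_ge (r + t)
  have hsub : t + (m + r) + (k - (r + t)) = ((m + k : ℕ) : ℝ≥0) := by
    rw [show t + (m + r) = m + (r + t) by ring, add_assoc, add_tsub_cancel_of_le hk]
    push_cast
    rfl
  have e : flowPoint g (s^[k] (b m)) (r + ((k - (r + t) : ℝ≥0) : ℝ)) = β.1 (t + (m + r)) := by
    refine Eq.trans ?_ (β.2.1 (k - (r + t)) (t + (m + r)))
    refine (flow_flowPoint g (k - (r + t)) (s^[k] (b m)) r.2).symm.trans (congrArg _ ?_)
    rw [hsub, h.iterate_eq (subset_star _ hm) (hit k m)]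
    refine Eq.trans ?_ (eq_flowPoint g (β.1 _)).symm
    rw [hheight]
    rfl
  rw [← e, h.backPoint_eq hm (le_add_self.trans hk), NNReal.coe_sub hk]
  congr 1
  push_cast
  ring

theorem negMap_continuous (hX : IsGraph X) : Continuous (h.negMap hX) := by
  refine Continuous.subtype_mk (continuous_def.2 fun W hW => ?_) _
  rw [isOpen_iff_mem_nhds]
  intro x hx
  obtain ⟨r, hr⟩ := eventually_atTop.1 (hW.2.2 (h.backwardRay hX x.2) hx)
  obtain ⟨n, hn⟩ := exists_nat_ge r
  obtain ⟨N, hN, _, hNW⟩ := hr n hn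
  have hmaps : ∀ y : (cellOf ⁻¹' B 0 : Set X), y.1 ∈ (cellOf ⁻¹' star (B 0) : Set X) :=
    fun y => subset_star _ y.2
  have hc : Continuous fun y : (cellOf ⁻¹' B 0 : Set X) => MappingTorus.mk g (s^[n] y.1) 0 :=
    (MappingTorus.continuous_mk g).comp
      ((((h.continuousOn_neg hX).iterate h.mapsTo_neg n).comp_continuous continuous_subtype_val
        hmaps).prodMk continuous_const)
  have hN' : N ∈ 𝓝 (MappingTorus.mk g (s^[n] x.1) 0) := by
    rw [← h.backPoint_natCast x.2]
    exact hN
  filter_upwards [hc.continuousAt.preimage_mem_nhds hN'] with y hy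
  have hy' := h.iterate_mem_neg_zero y.2 n
  have h0 : (h.backwardRay hX hy').1 0 = MappingTorus.mk g (s^[n] y.1) 0 := by
    simpa [backwardRay] using h.backPoint_natCast hy' 0
  have h1 := (hNW (h.backwardRay hX hy') (by rw [h0]; exact hy)).2
  have h2 : h.negMap hX ⟨_, hy'⟩ = h.negMap hX y := (h.negMap_eq_iff hX _ _).2 ⟨0, n, rfl⟩
  have h3 := congrArg Subtype.val h2
  change (h.negMap hX y).1 ∈ W
  rw [← h3]
  exact h1

omit h [TopologicalSpace X] [CWComplex (univ : Set X)] in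
/-- The backward saturation of the lower halves of the fibres over `V`. -/
def backSaturation (g : X → X) (V : Set X) : Set (MappingTorus g) :=
  {z | Quot.lift (fun q : X × unitInterval =>
    -- The lower half fibres over `V` make the points `(x, 0)` with `x ∈ V` interior. They agree
    -- with the gluing, since `(x, 1)` belongs to the set when some `g^[n + 1] x` lies in `V`, as
    -- `(g x, 0)` does.
    (∃ n, g^[n + 1] q.1 ∈ V) ∨ q.1 ∈ V ∧ (q.2 : ℝ) < 1 / 2) (by
      rintro _ _ ⟨x⟩
      have h3 : ¬ ((1 : unitInterval) : ℝ) < 1 / 2 := by norm_num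
      have h4 : ((0 : unitInterval) : ℝ) < 1 / 2 := by norm_num
      simp only [eq_iff_iff, h3, h4, and_false, or_false, and_true]
      constructor
      · rintro ⟨n, hn⟩
        cases n with
        | zero => exact .inr hn
        | succ n => exact .inl ⟨n, hn⟩
      · rintro (⟨n, hn⟩ | hn)
        · exact ⟨n + 1, hn⟩
        · exact ⟨0, hn⟩) z}

omit h [TopologicalSpace X] [CWComplex (univ : Set X)] in
theorem mk_mem_backSaturation {V : Set X} {x : X} {r : unitInterval} :
    MappingTorus.mk g x r ∈ backSaturation g V ↔
      (∃ n, g^[n + 1] x ∈ V) ∨ x ∈ V ∧ (r : ℝ) < 1 / 2 := Iff.rfl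

omit h [CWComplex (univ : Set X)] in
theorem isOpen_backSaturation (hg : Continuous g) {V : Set X} (hV : IsOpen V) :
    IsOpen (backSaturation g V) := by
  rw [MappingTorus.isOpen_iff]
  simp only [mk_mem_backSaturation]
  have h1 : IsOpen {q : X × unitInterval | ∃ n, g^[n + 1] q.1 ∈ V} := by
    simp only [ofPred_exists]
    exact isOpen_iUnion fun n => hV.preimage ((hg.iterate (n + 1)).comp continuous_fst)
  exact h1.union ((hV.preimage continuous_fst).inter
    (isOpen_lt (continuous_subtype_val.comp continuous_snd) continuous_const))

omit h [TopologicalSpace X] [CWComplex (univ : Set X)] in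
theorem mem_backSaturation_of_flow {V : Set X} (t : ℝ≥0) (z : MappingTorus g)
    (hz : flow g t z ∈ backSaturation g V) : z ∈ backSaturation g V := by
  obtain ⟨⟨x, r⟩, rfl⟩ := Quot.exists_rep z
  have hr : (0 : ℝ) ≤ r := r.2.1
  change MappingTorus.mk g x r ∈ _
  rcases hz with ⟨n, hn⟩ | ⟨hV, hlt⟩
  · refine .inl ⟨n + ⌊(r : ℝ) + t⌋₊, ?_⟩
    rw [add_right_comm, Function.iterate_add_apply]
    exact hn
  · change g^[⌊(r : ℝ) + t⌋₊] x ∈ V at hV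
    change Int.fract ((r : ℝ) + t) < 1 / 2 at hlt
    rcases Nat.eq_zero_or_pos ⌊(r : ℝ) + t⌋₊ with h0 | hpos
    · rw [h0] at hV
      refine .inr ⟨hV, ?_⟩
      have ht : (0 : ℝ) ≤ t := t.2
      rw [Int.fract_eq_self.2 ⟨by positivity, Nat.floor_eq_zero.1 h0⟩] at hlt
      change (r : ℝ) < 1 / 2
      linarith
    · exact .inl ⟨⌊(r : ℝ) + t⌋₊ - 1, by rwa [Nat.sub_add_cancel hpos]⟩

theorem exists_iterate_eq_of_mem {V : Set X} (hV : V ⊆ cellOf ⁻¹' star (B 0)) {x : X} {a : ℝ≥0}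
    (ha : backPoint g s x a ∈ backSaturation g V) : ∃ v ∈ V, ∃ m n, s^[m] v = s^[n] x := by
  obtain ⟨r, hr⟩ := exists_backPoint_eq_mk (g := g) (s := s) x a
  rw [hr, mk_mem_backSaturation] at ha
  rcases ha with ⟨n, hn⟩ | ⟨hn, -⟩
  · exact ⟨_, hn, n + 1, _, h.iterate_eq (hV hn) rfl⟩
  · exact ⟨_, hn, 0, _, rfl⟩

theorem t2Space_negBoundary (hX : IsGraph X) : T2Space (negBoundary g) := by
  have := hX.t2
  refine ⟨fun a b hab => ?_⟩
  obtain ⟨x, rfl⟩ := h.negMap_surjective hX a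
  obtain ⟨y, rfl⟩ := h.negMap_surjective hX b
  have hne := (h.negMap_eq_iff hX x y).not.1 hab
  push Not at hne
  obtain ⟨V, W, hV, hW, hxV, hyW, hVO, hWO, hd⟩ := exists_disjoint_orbit_nhds
    (isOpen_star hX (B 0)) (h.continuousOn_neg hX) h.mapsTo_neg h.injOn_neg (fun y => by
      obtain ⟨V, hV, k₀, hk₀⟩ :=
        exists_nhds_disjoint_star hX h.tail.antitone_neg h.tail.exists_notMem_neg y
      refine ⟨V, hV, k₀, fun k hk => (hk₀ k hk).mono_left ?_⟩
      rintro _ ⟨z, hz, rfl⟩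
      exact h.iterate_mem_star hz k)
    (subset_star _ x.2) (subset_star _ y.2) hne
  have hmem : ∀ (V : Set X) (z : (cellOf ⁻¹' B 0 : Set X)), z.1 ∈ V →
      (h.negMap hX z).1 ∈ negHull g (backSaturation g V) := fun V z hz => by
    refine (endpoint_mem_negHull g mem_backSaturation_of_flow _).2 ⟨0, ?_⟩
    have h0 : (h.backwardRay hX z.2).1 0 = MappingTorus.mk g z.1 0 := by
      simpa [backwardRay] using h.backPoint_natCast z.2 0
    rw [h0, mk_mem_backSaturation]
    exact .inr ⟨hz, by norm_num⟩
  refine ⟨_, _, (isOpen_negHull g (isOpen_backSaturation h.continuous hV)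
    mem_backSaturation_of_flow).preimage continuous_subtype_val,
    (isOpen_negHull g (isOpen_backSaturation h.continuous hW)
    mem_backSaturation_of_flow).preimage continuous_subtype_val, hmem V x hxV, hmem W y hyW, ?_⟩
  rw [Set.disjoint_left]
  rintro c hc1 hc2
  obtain ⟨z, rfl⟩ := h.negMap_surjective hX c
  obtain ⟨a, ha⟩ := (endpoint_mem_negHull g mem_backSaturation_of_flow _).1 hc1
  obtain ⟨b, hb⟩ := (endpoint_mem_negHull g mem_backSaturation_of_flow _).1 hc2
  obtain ⟨v, hv, m, n, e1⟩ := h.exists_iterate_eq_of_mem hVO ha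
  obtain ⟨w, hw, m', n', e2⟩ := h.exists_iterate_eq_of_mem hWO hb
  refine hd (n' + m) (n + m') v hv w hw ?_
  rw [Function.iterate_add_apply, e1, Function.iterate_add_apply _ n, e2,
    ← Function.iterate_add_apply, ← Function.iterate_add_apply, add_comm]

end HasInverse

end Negative

/-! ### Quotients of a forward-invariant subgraph by a shift -/

section Quotient

variable {X : Type u} [TopologicalSpace X] [CWComplex (univ : Set X)]
  {Y : Type u} [TopologicalSpace Y]

theorem oc_subsingleton_iff (hX : IsGraph X) (c : GCell X) : (oc c).Subsingleton ↔ c.1 = 0 := by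
  obtain ⟨n, c⟩ := c
  rcases GCell.dim_cases hX ⟨n, c⟩ with rfl | rfl
  · rw [oc_zero]
    exact iff_of_true subsingleton_singleton rfl
  · refine iff_of_false (fun h => ?_) one_ne_zero
    rw [oc_one] at h
    have h0 : (0 : ℝ) ∈ Ioo (-1 : ℝ) 1 := by norm_num
    have h1 : (1 / 2 : ℝ) ∈ Ioo (-1 : ℝ) 1 := by norm_num
    have := injOn_edgePath c h0 h1 (h (mem_image_of_mem _ h0) (mem_image_of_mem _ h1))
    norm_num at this

/-- The map `q` identifies `Y` with the orbit space of the self-map `s` of the subgraph with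
cells `S 0`, where `s` shifts the cells by `σ`. -/
structure IsShiftQuotient (S : ℕ → Set (GCell X)) (σ : GCell X → GCell X) (s : X → X)
    (q : (cellOf ⁻¹' S 0 : Set X) → Y) : Prop where
  face : FaceClosed (S 0)
  image : ∀ n, σ '' S n = S (n + 1)
  antitone : Antitone S
  exists_notMem : ∀ c, ∃ n, c ∉ S n
  injOn : InjOn σ (S 0)
  finite : (S 0 \ S 1).Finite
  image_oc : ∀ {c}, c ∈ S 0 → s '' oc c = oc (σ c)
  injOn_map : InjOn s (cellOf ⁻¹' S 0)
  continuous : Continuous q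
  surjective : Function.Surjective q
  eq_iff : ∀ x y, q x = q y ↔ ∃ m n, s^[m] x.1 = s^[n] y.1

namespace IsShiftQuotient

variable {S : ℕ → Set (GCell X)} {σ : GCell X → GCell X} {s : X → X}
  {q : (cellOf ⁻¹' S 0 : Set X) → Y} (h : IsShiftQuotient S σ s q)
include h

theorem mapsTo : MapsTo σ (S 0) (S 0) := fun _ hc =>
  h.antitone zero_le_one (h.image 0 ▸ mem_image_of_mem σ hc)

theorem cellOf_apply {x : X} (hx : cellOf x ∈ S 0) : cellOf (s x) = σ (cellOf x) :=
  cellOf_map h.image_oc hx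

theorem mapsTo_map : MapsTo s (cellOf ⁻¹' S 0) (cellOf ⁻¹' S 0) := fun x hx => by
  rw [mem_preimage, h.cellOf_apply hx]
  exact h.mapsTo hx

theorem cellOf_iterate {x : X} (hx : cellOf x ∈ S 0) (n : ℕ) :
    cellOf (s^[n] x) = σ^[n] (cellOf x) := by
  induction n with
  | zero => rfl
  | succ n ih =>
    rw [Function.iterate_succ_apply', Function.iterate_succ_apply', ← ih,
      h.cellOf_apply (h.mapsTo_map.iterate n hx)]

/-- The vertices are exactly the cells whose interior has one point, and `s` is injective. -/
theorem dim_apply (hX : IsGraph X) {c : GCell X} (hc : c ∈ S 0) : (σ c).1 = 0 ↔ c.1 = 0 := by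
  rw [← oc_subsingleton_iff hX, ← oc_subsingleton_iff hX, ← h.image_oc hc]
  refine ⟨fun hs x hx y hy => ?_, fun hs => hs.image s⟩
  have hm : ∀ {x}, x ∈ oc c → x ∈ (cellOf ⁻¹' S 0 : Set X) := fun hx => by
    rwa [mem_preimage, mem_oc_iff.1 hx]
  exact h.injOn_map (hm hx) (hm hy) (hs (mem_image_of_mem s hx) (mem_image_of_mem s hy))

theorem dim_iterate (hX : IsGraph X) {c : GCell X} (hc : c ∈ S 0) (n : ℕ) :
    (σ^[n] c).1 = 0 ↔ c.1 = 0 := by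
  induction n with
  | zero => rfl
  | succ n ih => rw [Function.iterate_succ_apply', h.dim_apply hX (h.mapsTo.iterate n hc), ih]

theorem image_oc_iterate {c : GCell X} (hc : c ∈ S 0) (n : ℕ) :
    s^[n] '' oc c = oc (σ^[n] c) := by
  induction n with
  | zero => simp
  | succ n ih =>
    rw [Function.iterate_succ', image_comp, ih, h.image_oc (h.mapsTo.iterate n hc),
      Function.iterate_succ_apply']

/-- Undoing `σ` lowers the index `n` with `c ∉ S n`, so the descent stops in the fundamental domain
`S 0 \ S 1`. -/
theorem exists_iterate_eq {c : GCell X} (hc : c ∈ S 0) : ∃ d ∈ S 0 \ S 1, ∃ n, σ^[n] d = c := by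
  obtain ⟨n, hn⟩ := h.exists_notMem c
  induction n generalizing c with
  | zero => exact absurd hc hn
  | succ n ih =>
    by_cases h1 : c ∈ S 1
    · rw [← h.image 0] at h1
      obtain ⟨b, hb, rfl⟩ := h1
      obtain ⟨d, hd, k, rfl⟩ := ih hb fun hbn => hn (h.image n ▸ mem_image_of_mem σ hbn)
      exact ⟨d, hd, k + 1, Function.iterate_succ_apply' σ k d⟩
    · exact ⟨c, ⟨hc, h1⟩, 0, rfl⟩

theorem injOn_iterate (n : ℕ) : InjOn σ^[n] (S 0) := h.injOn.iterate h.mapsTo n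

/-- After cancelling the smaller exponent, a remaining positive power of `σ` would put a cell of the
fundamental domain into `S 1`. -/
theorem eq_of_iterate_eq {c d : GCell X} (hc : c ∈ S 0 \ S 1) (hd : d ∈ S 0 \ S 1) {m n : ℕ}
    (e : σ^[m] c = σ^[n] d) : m = n := by
  have key : ∀ {c d : GCell X}, c ∈ S 0 \ S 1 → d ∈ S 0 \ S 1 → ∀ {m n : ℕ},
      σ^[m] c = σ^[n] d → n ≤ m := by
    intro c d hc hd m n e
    by_contra! hlt
    obtain ⟨k, rfl⟩ := Nat.exists_eq_add_of_lt hlt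
    rw [add_assoc, Function.iterate_add_apply] at e
    have := h.injOn_iterate m hc.1 (h.mapsTo.iterate _ hd.1) e
    rw [Function.iterate_succ_apply'] at this
    refine hc.2 ?_
    rw [this, ← h.image 0]
    exact mem_image_of_mem σ (h.mapsTo.iterate k hd.1)
  exact le_antisymm (key hd hc e.symm) (key hc hd e)

theorem injective_of_notMem {x y : (cellOf ⁻¹' S 0 : Set X)} (hx : cellOf x.1 ∉ S 1)
    (hy : cellOf y.1 ∉ S 1) (e : q x = q y) : x = y := by
  obtain ⟨m, n, e⟩ := (h.eq_iff x y).1 e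
  have e' := congrArg cellOf e
  rw [h.cellOf_iterate x.2, h.cellOf_iterate y.2] at e'
  obtain rfl := h.eq_of_iterate_eq ⟨x.2, hx⟩ ⟨y.2, hy⟩ e'
  exact Subtype.ext (h.injOn_map.iterate h.mapsTo_map m x.2 y.2 e)

theorem exists_representative (x : (cellOf ⁻¹' S 0 : Set X)) :
    ∃ y : (cellOf ⁻¹' S 0 : Set X), cellOf y.1 ∉ S 1 ∧ q y = q x ∧
      ∃ n, σ^[n] (cellOf y.1) = cellOf x.1 := by
  obtain ⟨d, hd, n, hn⟩ := h.exists_iterate_eq x.2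
  have hx : x.1 ∈ s^[n] '' oc d := by rw [h.image_oc_iterate hd.1, hn]; exact mem_oc_cellOf _
  obtain ⟨y, hy, e⟩ := hx
  obtain rfl := mem_oc_iff.1 hy
  exact ⟨⟨y, hd.1⟩, hd.2, (h.eq_iff _ _).2 ⟨n, 0, e⟩, n, hn⟩

omit h in
/-- The cells of the quotient. -/
abbrev QuotCell (S : ℕ → Set (GCell X)) (n : ℕ) : Type u :=
  {v : RelCWComplex.cell (univ : Set X) n // (⟨n, v⟩ : GCell X) ∈ S 0 \ S 1}

theorem map_mem {n : ℕ} (i : QuotCell S n) {z : Fin n → ℝ} (hz : z ∈ Metric.closedBall 0 1) :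
    RelCWComplex.map (C := (univ : Set X)) n i.1 z ∈ (cellOf ⁻¹' S 0 : Set X) :=
  h.face ⟨_, mem_oc_cellOf _, mem_image_of_mem _ hz⟩ i.2.1

open Classical in
/-- The characteristic maps of the quotient. -/
noncomputable def cellMap {n : ℕ} (i : QuotCell S n) (z : Fin n → ℝ) : Y :=
  q ⟨RelCWComplex.map (C := (univ : Set X)) n i.1
    -- The default `0` only keeps the argument inside the subgraph when `z` is outside the closed
    -- ball.
    (if z ∈ Metric.closedBall 0 1 then z else 0), h.map_mem i (by split_ifs with hz <;> simp_all)⟩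

theorem cellMap_eq {n : ℕ} (i : QuotCell S n) {z : Fin n → ℝ} (hz : z ∈ Metric.closedBall 0 1) :
    h.cellMap i z = q ⟨_, h.map_mem i hz⟩ := by
  simp only [cellMap, if_pos hz]

theorem continuousOn_cellMap {n : ℕ} (i : QuotCell S n) :
    ContinuousOn (h.cellMap i) (Metric.closedBall 0 1) := by
  rw [continuousOn_iff_continuous_domRestrict]
  have : (Metric.closedBall 0 1).domRestrict (h.cellMap i) =
      fun z : (Metric.closedBall 0 1 : Set (Fin n → ℝ)) => q ⟨_, h.map_mem i z.2⟩ :=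
    funext fun z => h.cellMap_eq i z.2
  rw [this]
  exact h.continuous.comp ((continuousOn_iff_continuous_domRestrict.1
    (RelCWComplex.continuousOn (C := (univ : Set X)) n i.1)).subtype_mk _)

omit h in
theorem cellOf_map_ball {n : ℕ} (i : RelCWComplex.cell (univ : Set X) n) {z : Fin n → ℝ}
    (hz : z ∈ Metric.ball 0 1) : cellOf (RelCWComplex.map (C := (univ : Set X)) n i z) = ⟨n, i⟩ :=
  mem_oc_iff.1 (mem_image_of_mem _ hz)

omit h in
theorem cellOf_map_sphere (hX : IsGraph X) {n : ℕ} (i : RelCWComplex.cell (univ : Set X) n)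
    {z : Fin n → ℝ} (hz : z ∈ Metric.sphere 0 1) :
    n = 1 ∧ (cellOf (RelCWComplex.map (C := (univ : Set X)) n i z)).1 = 0 := by
  rcases GCell.dim_cases hX ⟨n, i⟩ with rfl | rfl
  · rw [mem_sphere_zero_iff_norm, Subsingleton.elim z 0, norm_zero] at hz
    exact absurd hz zero_ne_one
  · refine ⟨rfl, ?_⟩
    rw [mem_sphere_zero_iff_norm, eq_fun_fin_one z, norm_fun_fin_one] at hz
    rw [← mem_vertices_iff, eq_fun_fin_one z]
    exact frontier_edge_mem_vertices i ((eq_or_eq_neg_of_abs_eq hz).symm)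

theorem cellMap_ball_injective {m n : ℕ} {i : QuotCell S m} {j : QuotCell S n} {z : Fin m → ℝ}
    {w : Fin n → ℝ} (hz : z ∈ Metric.ball 0 1) (hw : w ∈ Metric.ball 0 1)
    (e : h.cellMap i z = h.cellMap j w) : RelCWComplex.map (C := (univ : Set X)) m i.1 z =
      RelCWComplex.map (C := (univ : Set X)) n j.1 w := by
  rw [h.cellMap_eq i (Metric.ball_subset_closedBall hz),
    h.cellMap_eq j (Metric.ball_subset_closedBall hw)] at e
  refine congrArg Subtype.val (h.injective_of_notMem ?_ ?_ e)
  · rw [cellOf_map_ball _ hz]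
    exact i.2.2
  · rw [cellOf_map_ball _ hw]
    exact j.2.2

theorem injOn_cellMap {n : ℕ} (i : QuotCell S n) : InjOn (h.cellMap i) (Metric.ball 0 1) := by
  intro z hz w hw e
  refine (RelCWComplex.map (C := (univ : Set X)) n i.1).injOn ?_ ?_
    (h.cellMap_ball_injective hz hw e)
  · rwa [RelCWComplex.source_eq]
  · rwa [RelCWComplex.source_eq]

/-- Boundary points of an edge are vertices, and the shift preserves dimension, so `q` never
identifies them with interior points. -/
theorem mem_ball_of_cellMap_eq (hX : IsGraph X) {n : ℕ} (i : QuotCell S n) {z w : Fin n → ℝ}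
    (hz : z ∈ Metric.closedBall 0 1) (hw : w ∈ Metric.ball 0 1)
    (e : h.cellMap i z = h.cellMap i w) : z ∈ Metric.ball 0 1 := by
  by_contra hzb
  have hzs : z ∈ Metric.sphere 0 1 := by
    rw [← Metric.closedBall_sdiff_ball]
    exact ⟨hz, hzb⟩
  obtain ⟨hn, h0⟩ := cellOf_map_sphere hX i.1 hzs
  rw [h.cellMap_eq i hz, h.cellMap_eq i (Metric.ball_subset_closedBall hw), h.eq_iff] at e
  obtain ⟨a, b, e⟩ := e
  rw [← h.dim_iterate hX (h.map_mem i hz) a, ← h.cellOf_iterate (h.map_mem i hz), e,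
    h.cellOf_iterate (h.map_mem i (Metric.ball_subset_closedBall hw)), cellOf_map_ball _ hw,
    h.dim_iterate hX i.2.1] at h0
  exact one_ne_zero (hn.symm.trans h0)

theorem cellMap_eq_of_mem (x : (cellOf ⁻¹' S 0 : Set X)) :
    ∃ (n : ℕ) (j : QuotCell S n), ∃ w ∈ Metric.ball 0 1, h.cellMap j w = q x ∧
      ∃ k, σ^[k] ⟨n, j.1⟩ = cellOf x.1 := by
  obtain ⟨⟨y, hy⟩, hy1, e, k, hk⟩ := h.exists_representative x
  obtain ⟨w, hw, hwy⟩ : y ∈ oc (cellOf y) := mem_oc_cellOf y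
  refine ⟨_, ⟨(cellOf y).2, ⟨hy, hy1⟩⟩, w, hw, ?_, k, hk⟩
  rw [h.cellMap_eq _ (Metric.ball_subset_closedBall hw), ← e]
  exact congrArg q (Subtype.ext hwy)

/-- The cells of the fundamental domain `S 0 \ S 1` give the cells of the quotient, with
characteristic maps composed with `q`. Each orbit meets exactly one open cell of the domain, in
exactly one point. -/
theorem exists_isFiniteGraph (hX : IsGraph X) [T2Space Y] :
    ∃ _T : CWComplex (univ : Set Y), IsFiniteGraph Y ∧
      ∀ n, Nat.card (RelCWComplex.cell (univ : Set Y) n) = Nat.card (QuotCell S n) := by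
  have hempty : ∀ n, 2 ≤ n → IsEmpty (QuotCell S n) := fun n hn =>
    ⟨fun i => (hX.dim_le_one n hn).elim i.1⟩
  have hfin : Finite (Σ n, QuotCell S n) := by
    have := h.finite.to_subtype
    refine Finite.of_injective (β := (S 0 \ S 1 : Set (GCell X)))
      (fun i => ⟨⟨i.1, i.2.1⟩, i.2.2⟩) ?_
    rintro ⟨m, i, hi⟩ ⟨n, j, hj⟩ e
    simp only [Subtype.mk.injEq, Sigma.mk.injEq] at e
    obtain ⟨rfl, e⟩ := e
    obtain rfl := eq_of_heq e
    rfl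
  have hfinn : ∀ n, Finite (QuotCell S n) := fun n =>
    Finite.of_injective (fun i => (⟨n, i⟩ : Σ n, QuotCell S n)) sigma_mk_injective
  let T : CWComplex (univ : Set Y) := CWComplex.mkFinite univ (QuotCell S)
    (fun n i => (h.injOn_cellMap i).toPartialEquiv (h.cellMap i) (Metric.ball 0 1))
    (by filter_upwards [eventually_ge_atTop 2] with n hn using hempty n hn) hfinn
    (fun n i => rfl) (fun n i => h.continuousOn_cellMap i) (fun n i => by
      rw [continuousOn_iff_isClosed]
      intro C hC
      refine ⟨h.cellMap i '' (Metric.closedBall 0 1 ∩ C), ?_, ?_⟩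
      · exact (((isCompact_closedBall _ _).inter_right hC).image_of_continuousOn
          ((h.continuousOn_cellMap i).mono inter_subset_left)).isClosed
      · ext y
        constructor
        · rintro ⟨hyC, z, hz, rfl⟩
          refine ⟨⟨z, ⟨Metric.ball_subset_closedBall hz, ?_⟩, rfl⟩, z, hz, rfl⟩
          rw [← ((h.injOn_cellMap i).toPartialEquiv _ _).left_inv hz]
          exact hyC
        · rintro ⟨⟨z, hz, rfl⟩, w, hw, e⟩
          have hzb := h.mem_ball_of_cellMap_eq hX i hz.1 hw e.symm
          refine ⟨?_, z, hzb, rfl⟩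
          rw [← ((h.injOn_cellMap i).toPartialEquiv _ _).left_inv hzb] at hz
          exact hz.2)
    (by
      rintro ⟨m, i⟩ - ⟨n, j⟩ - hne
      rw [Function.onFun, Set.disjoint_left]
      rintro _ ⟨z, hz, rfl⟩ ⟨w, hw, e⟩
      have := congrArg cellOf (h.cellMap_ball_injective hw hz e)
      rw [cellOf_map_ball _ hw, cellOf_map_ball _ hz] at this
      simp only [Sigma.mk.injEq] at this
      obtain ⟨rfl, e⟩ := this
      exact hne (by rw [Subtype.ext (eq_of_heq e)]))
    (fun n i z hz => by
      obtain ⟨rfl, h0⟩ := cellOf_map_sphere hX i.1 hz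
      have hzc := Metric.sphere_subset_closedBall hz
      -- An endpoint of the edge may lie outside the fundamental domain, but it is equivalent to a
      -- vertex inside it.
      obtain ⟨m, j, w, hw, e, k, hk⟩ := h.cellMap_eq_of_mem ⟨_, h.map_mem i hzc⟩
      have hm : m = 0 := by
        rw [← hk, h.dim_iterate hX j.2.1] at h0
        exact h0
      simp only [mem_iUnion]
      exact ⟨m, by omega, j, w, Metric.ball_subset_closedBall hw,
        e.trans (h.cellMap_eq i hzc).symm⟩)
    (by
      refine eq_univ_of_forall fun y => ?_
      obtain ⟨x, rfl⟩ := h.surjective y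
      obtain ⟨m, j, w, hw, e, -⟩ := h.cellMap_eq_of_mem x
      simp only [mem_iUnion]
      exact ⟨m, j, w, Metric.ball_subset_closedBall hw, e⟩)
  refine ⟨T, ?_, fun n => rfl⟩
  have hfin' : Finite (Σ n, RelCWComplex.cell (univ : Set Y) n) := hfin
  exact
    { t2 := inferInstance
      dim_le_one := hempty
      locallyFinite := locallyFinite_of_finite _
      finite_cells := hfin' }

end IsShiftQuotient

/-- The right-hand side makes no reference to cells, so the cell count is the same for all finite
graph structures on a space. -/
theorem IsFiniteGraph.card_sub_card_eq (hX : IsFiniteGraph X) :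
    (Nat.card (RelCWComplex.cell (univ : Set X) 0) : ℤ) -
      Nat.card (RelCWComplex.cell (univ : Set X) 1) = cohomologicalEulerChar (∅ : Set X) := by
  have := hX.finite_cells
  have key := cohomologicalEulerChar_eq hX.toIsGraph (S := ∅) (fun _ _ _ h => h) (Set.toFinite _)
  rw [preimage_empty] at key
  rw [key]
  congr 2
  · exact Nat.card_congr (Equiv.subtypeUnivEquiv fun v => notMem_empty _).symm
  · exact Nat.card_congr (Equiv.subtypeUnivEquiv fun v => notMem_empty _).symm

theorem IsShiftQuotient.isFiniteGraphOfEulerChar {S : ℕ → Set (GCell X)} {σ : GCell X → GCell X}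
    {s : X → X} {q : (cellOf ⁻¹' S 0 : Set X) → Y} (h : IsShiftQuotient S σ s q)
    (hX : IsGraph X) [T2Space Y] : IsFiniteGraphOfEulerChar Y
      (Nat.card (QuotCell S 0) - Nat.card (QuotCell S 1)) := by
  obtain ⟨T, hT, hcard⟩ := h.exists_isFiniteGraph hX
  refine ⟨⟨T, hT⟩, fun T' hT' => ?_⟩
  rw [← hcard, ← hcard]
  exact (@IsFiniteGraph.card_sub_card_eq Y _ T' hT').trans
    (@IsFiniteGraph.card_sub_card_eq Y _ T hT).symm

end Quotient

/-! ### Comparison of the two boundaries -/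

section Comparison

variable {X : Type u} [TopologicalSpace X] [CWComplex (univ : Set X)]
  {g s : X → X} {γ : GCell X → GCell X} {L D : Set (GCell X)} {A B : ℕ → Set (GCell X)}

theorem HasTails.isShiftQuotient (h : HasTails g γ L D A B) (hX : IsGraph X) :
    IsShiftQuotient A γ g (h.posMap hX) where
  face _ _ := h.tail.face
  image := h.tail.image
  antitone := h.tail.antitone
  exists_notMem := h.tail.exists_notMem
  injOn := h.injOn.mono (h.tail.subset 0)
  finite := h.tail.finite_compl.subset fun _ hc hc' => hc'.elim hc.2 fun hB =>
    Set.disjoint_left.1 h.tail.disjoint hc.1 (h.tail.antitone_neg zero_le_one hB)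
  image_oc hc := h.image_oc (h.tail.subset 0 hc)
  injOn_map := h.injOn_cells.mono (preimage_mono (h.tail.subset 0))
  continuous := h.posMap_continuous hX
  surjective := h.posMap_surjective hX
  eq_iff := h.posMap_eq_iff hX

theorem HasTails.neg_subset (h : HasTails g γ L D A B) (n : ℕ) : B n ⊆ L :=
  (subset_star _).trans (h.star_neg_subset n)

/-- The shift is the inverse of `γ` on the backward tail, read off from `s` at a chosen point of
each open cell. -/
theorem HasInverse.exists_isShiftQuotient (h : HasInverse g γ L D A B s) (hX : IsGraph X) :
    ∃ σ, IsShiftQuotient B σ s (h.negMap hX) := by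
  have hB : ∀ {x}, cellOf x ∈ B 0 → cellOf (s x) ∈ L ∧ γ (cellOf (s x)) = cellOf x := by
    intro x hx
    have hL := h.star_neg_subset 1 (h.mem (subset_star _ hx))
    exact ⟨hL, by rw [← h.cellOf_apply hL, h.apply (subset_star _ hx)]⟩
  choose p hp using fun c : GCell X => exists_cellOf_eq c
  have hσ : ∀ {c}, c ∈ B 0 → cellOf (s (p c)) ∈ L ∧ γ (cellOf (s (p c))) = c := by
    intro c hc
    have := hB (x := p c) (by rwa [hp])
    rwa [hp] at this
  refine ⟨fun c => cellOf (s (p c)), ?_⟩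
  exact
  { face := fun _ _ => h.tail.face_neg
    image := fun n => by
      ext d
      constructor
      · rintro ⟨c, hc, rfl⟩
        exact h.mem_neg (by rwa [hp])
      · intro hd
        have hd' := hd
        rw [← h.tail.preimage_neg] at hd'
        have := hσ (h.tail.antitone_neg (Nat.zero_le n) hd'.2)
        exact ⟨γ d, hd'.2, h.injOn this.1 hd'.1 this.2⟩
    antitone := h.tail.antitone_neg
    exists_notMem := h.tail.exists_notMem_neg
    injOn := fun c hc d hd e => by
      rw [← (hσ hc).2, ← (hσ hd).2]
      exact congrArg γ e
    finite := h.tail.finite_compl.subset fun _ hc hc' => hc'.elim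
      (fun hA => Set.disjoint_left.1 h.tail.disjoint (h.tail.antitone zero_le_one hA) hc.1) hc.2
    image_oc := fun {c} hc => by
      ext y
      constructor
      · rintro ⟨x, hx, rfl⟩
        rw [mem_oc_iff] at hx ⊢
        have := hB (hx.symm ▸ hc)
        exact h.injOn this.1 (hσ hc).1 (by rw [this.2, (hσ hc).2, hx])
      · intro hy
        rw [mem_oc_iff] at hy
        have hgy : cellOf (g y) = c := by
          rw [h.cellOf_apply (by rw [hy]; exact (hσ hc).1), hy, (hσ hc).2]
        refine ⟨g y, mem_oc_iff.2 hgy, h.eq_of_apply (subset_star _ ?_) rfl⟩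
        rwa [hgy]
    injOn_map := h.injOn_neg.mono (preimage_mono (subset_star _))
    continuous := h.negMap_continuous hX
    surjective := h.negMap_surjective hX
    eq_iff := h.negMap_eq_iff hX }

theorem card_cells_compl {S T U : Set (GCell X)} (hS : Sᶜ = T ∪ U) (hd : Disjoint T U)
    (hfin : Sᶜ.Finite) (n : ℕ) :
    Nat.card {v : RelCWComplex.cell (univ : Set X) n // (⟨n, v⟩ : GCell X) ∉ S} =
      Nat.card {v : RelCWComplex.cell (univ : Set X) n // (⟨n, v⟩ : GCell X) ∈ T} +
        Nat.card {v : RelCWComplex.cell (univ : Set X) n // (⟨n, v⟩ : GCell X) ∈ U} := by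
  have hfin' := hfin
  rw [hS] at hfin'
  have key := Set.ncard_union_eq (hd.preimage (Sigma.mk n))
    ((hfin'.subset subset_union_left).preimage sigma_mk_injective.injOn)
    ((hfin'.subset subset_union_right).preimage sigma_mk_injective.injOn)
  rw [← preimage_union, ← hS, ← Nat.card_coe_set_eq, ← Nat.card_coe_set_eq,
    ← Nat.card_coe_set_eq] at key
  exact key

/-- One application of `g` shrinks the forward tail and enlarges the backward tail, carrying the
first subgraph homeomorphically onto the second. -/
theorem HasTails.cohomologicalEulerChar_eq (h : HasTails g γ L D A B) (hX : IsGraph X)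
    [ConnectedSpace X] (E : ContinuousMap.HomotopyEquiv X X) (hE : ⇑E = g) :
    cohomologicalEulerChar (cellOf ⁻¹' (A 0 ∪ B 1) : Set X) =
      cohomologicalEulerChar (cellOf ⁻¹' (A 1 ∪ B 0) : Set X) := by
  have hL : A 0 ∪ B 1 ⊆ L := union_subset (h.tail.subset 0) (h.neg_subset 1)
  have himage : g '' (cellOf ⁻¹' (A 0 ∪ B 1)) = cellOf ⁻¹' (A 1 ∪ B 0) := by
    rw [h.image_preimage hL, image_union, h.tail.image, h.tail.image_neg]
  have hinv : ∀ y : X, ∃ x, cellOf y ∈ A 1 ∪ B 0 → cellOf x ∈ A 0 ∪ B 1 ∧ g x = y := by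
    intro y
    by_cases hy : cellOf y ∈ A 1 ∪ B 0
    · rw [← mem_preimage, ← himage] at hy
      obtain ⟨x, hx, e⟩ := hy
      exact ⟨x, fun _ => ⟨hx, e⟩⟩
    · exact ⟨y, fun h => absurd h hy⟩
  choose r hr using hinv
  refine cohomologicalEulerChar_eq_of_homotopyEquiv E r (by rw [hE, himage]) ?_ ?_
    fun v hv => exists_extension hX
      (FaceClosed.union (fun _ _ => h.tail.face) fun _ _ => h.tail.face_neg) v hv
  · rw [continuousOn_iff_continuous_domRestrict]
    have hc : Continuous fun y : (cellOf ⁻¹' (A 1 ∪ B 0) : Set X) =>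
        (⟨r y, hL (hr y y.2).1⟩ : (cellOf ⁻¹' L : Set X)) := by
      rw [h.isEmbedding.continuous_iff]
      exact continuous_subtype_val.congr fun y => (hr y y.2).2.symm
    exact continuous_subtype_val.comp hc
  · intro x hx
    have hgx : cellOf (g x) ∈ A 1 ∪ B 0 := by
      rw [← mem_preimage, ← himage]
      exact mem_image_of_mem g hx
    rw [hE]
    exact h.injOn_cells (hL (hr _ hgx).1) (hL hx) (hr _ hgx).2

theorem HasTails.card_sub_card_eq (h : HasTails g γ L D A B) (hX : IsGraph X)
    [ConnectedSpace X] (E : ContinuousMap.HomotopyEquiv X X) (hE : ⇑E = g) :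
    (Nat.card (IsShiftQuotient.QuotCell A 0) : ℤ) - Nat.card (IsShiftQuotient.QuotCell A 1) =
      Nat.card (IsShiftQuotient.QuotCell B 0) - Nat.card (IsShiftQuotient.QuotCell B 1) := by
  have hA := h.tail.antitone zero_le_one
  have hB := h.tail.antitone_neg zero_le_one
  have hd := h.tail.disjoint
  have hfA : (A 0 ∪ B 1)ᶜ.Finite :=
    h.tail.finite_compl.subset (compl_subset_compl.2 (union_subset_union_left _ hA))
  have hfB : (A 1 ∪ B 0)ᶜ.Finite :=
    h.tail.finite_compl.subset (compl_subset_compl.2 (union_subset_union_right _ hB))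
  have key := h.cohomologicalEulerChar_eq hX E hE
  rw [EndPeriodic.cohomologicalEulerChar_eq hX
      (FaceClosed.union (fun _ _ => h.tail.face) fun _ _ => h.tail.face_neg) hfA,
    EndPeriodic.cohomologicalEulerChar_eq hX
      (FaceClosed.union (fun _ _ => h.tail.face) fun _ _ => h.tail.face_neg) hfB] at key
  -- The two complements share the core `(A 0 ∪ B 0)ᶜ` and differ by the fundamental domains of the
  -- backward and the forward tail. The core cancels in the final count.
  have e1 : (A 0 ∪ B 1)ᶜ = (A 0 ∪ B 0)ᶜ ∪ B 0 \ B 1 := by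
    ext c
    have : c ∈ B 1 → c ∈ B 0 := fun h => hB h
    have : c ∈ A 0 → c ∉ B 0 := fun h => Set.disjoint_left.1 hd h
    simp only [mem_compl_iff, mem_union, Set.mem_sdiff]
    tauto
  have e2 : (A 1 ∪ B 0)ᶜ = (A 0 ∪ B 0)ᶜ ∪ A 0 \ A 1 := by
    ext c
    have : c ∈ A 1 → c ∈ A 0 := fun h => hA h
    have : c ∈ A 0 → c ∉ B 0 := fun h => Set.disjoint_left.1 hd h
    simp only [mem_compl_iff, mem_union, Set.mem_sdiff]
    tauto
  have hd1 : Disjoint (A 0 ∪ B 0)ᶜ (B 0 \ B 1) :=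
    Set.disjoint_left.2 fun c hc hc' => hc (.inr hc'.1)
  have hd2 : Disjoint (A 0 ∪ B 0)ᶜ (A 0 \ A 1) :=
    Set.disjoint_left.2 fun c hc hc' => hc (.inl hc'.1)
  simp only [VertexCompl, EdgeCompl, card_cells_compl e1 hd1 hfA, card_cells_compl e2 hd2 hfB,
    Nat.cast_add] at key
  simp only [IsShiftQuotient.QuotCell]
  linarith

end Comparison

end EndPeriodic

theorem mainTheorem5 {X : Type*} [TopologicalSpace X] [CWComplex (univ : Set X)]
    (hX : EndPeriodic.IsGraph X)
    (hinf : Infinite (Σ n, RelCWComplex.cell (univ : Set X) n))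
    (hconn : ConnectedSpace X)
    (hends : Finite (EndPeriodic.Ends X))
    (g : X → X) (hg : EndPeriodic.IsEndPeriodic g)
    (hequiv : ∃ h : ContinuousMap.HomotopyEquiv X X, ⇑h = g) :
    ∃ χ : ℤ, EndPeriodic.IsFiniteGraphOfEulerChar (EndPeriodic.posBoundary g) χ ∧
      EndPeriodic.IsFiniteGraphOfEulerChar (EndPeriodic.negBoundary g) χ := by
  obtain ⟨γ, L, D, hγ⟩ := hg.exists_actsOnCells hX
  obtain ⟨A, B, ht⟩ := hγ.exists_hasTails hX
  obtain ⟨s, hs⟩ := ht.exists_hasInverse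
  obtain ⟨σ, hσ⟩ := hs.exists_isShiftQuotient hX
  obtain ⟨E, hE⟩ := hequiv
  have := ht.t2Space_posBoundary hX
  have := hs.t2Space_negBoundary hX
  refine ⟨_, (ht.isShiftQuotient hX).isFiniteGraphOfEulerChar hX, ?_⟩
  rw [ht.card_sub_card_eq hX E hE]
  exact hσ.isFiniteGraphOfEulerChar hX
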